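/- Let $N\ge 1$, let $\hbar\in\mathbb C$ with $\mathrm{Re}\,\hbar<0$, and put $q^a=e^{\hbar a}$, so $0<|q|<1$. **Scalars.** Let $\bar\epsilon_i=\epsilon_i-\frac1N\sum_k\epsilon_k$ in $\mathbb R^N$, so that $(\bar\epsilon_i,\bar\epsilon_k)=\delta_{ik}-\frac1N$. Let $H$ be the complex vector space spanned by elements $(P+h)_{\bar\epsilon_j}$, $P_{\bar\epsilon_j}$ $(1\le j\le N)$ and $c$, subject only to $\sum_j(P+h)_{\bar\epsilon_j}=0=\sum_jP_{\bar\epsilon_j}$. Write $h_{\bar\epsilon_j}=(P+h)_{\bar\epsilon_j}-P_{\bar\epsilon_j}$. Let $\mathbb F$ be the field of meromorphic functions $f(P+h,P)$ on $H^*$; they may depend on $c$, and $\mathbb F\ni q^{\eta}$ for $\eta\in H$. Let $p$ be an indeterminate and $p^*=pq^{-2c}$. **$R$-matrices.** Let $\Theta_p(z)=(z;p)_\infty(p/z;p)_\infty(p;p)_\infty$ and $\{z\}=(z;p,q^{2N})_\infty=\prod_{m,n\ge0}(1-zp^mq^{2Nn})$. For $s=P$ or $s=P+h$ put $s_{j,l}=s_{\bar\epsilon_j}-s_{\bar\epsilon_l}$.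 Let $E_{ij}$ be the matrix units of $V=\mathbb C^N$, and let $R^\pm(z,s)=\rho^\pm(z)\bar R(z,s)$ with $$\bar R(z,s)=\sum_jE_{jj}\otimes E_{jj}+\sum_{j<l}\big(b(z,s_{j,l})E_{jj}\otimes E_{ll}+\bar b(z)E_{ll}\otimes E_{jj}+c(z,s_{j,l})E_{jl}\otimes E_{lj}+c(z,-s_{j,l})E_{lj}\otimes E_{jl}\big),$$ $$b(z,s)=q\frac{\Theta_p(q^{2s+2})\Theta_p(q^{2s-2})\Theta_p(z)}{\Theta_p(q^{2s})^2\Theta_p(q^2z)},\quad \bar b(z)=q\frac{\Theta_p(z)}{\Theta_p(q^2z)},\quad c(z,s)=\frac{\Theta_p(q^2)\Theta_p(q^{2s}z)}{\Theta_p(q^{2s})\Theta_p(q^2z)},$$ $$\rho^+(z)=q^{-\frac{N-1}N}\frac{\{q^2z\}\{q^{2N-2}z\}\{p/z\}\{pq^{2N}/z\}}{\{z\}\{q^{2N}z\}\{pq^2/z\}\{pq^{2N-2}/z\}},\qquad \rho^-(z)=q^{\frac{N-1}N}\frac{\{pq^2z\}\{pq^{2N-2}z\}\{1/z\}\{q^{2N}/z\}}{\{pz\}\{pq^{2N}z\}\{q^2/z\}\{q^{2N-2}/z\}}.$$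 The entries of $R^\pm$ are expanded in $p$, the coefficients being expanded as Laurent series in $z^{\pm1}$. So $R^\pm(z,s)$ is a formal series in $z,z^{-1}$ with coefficients in $\mathbb F[[p]]$. Let $R^{\pm*}(z,s)$ be $R^\pm(z,s)$ with $p$ replaced by $p^*$. **The algebra.** $E_{q,p}(\widehat{\mathfrak{gl}}_N)$ is the topological algebra over $\mathbb F[[p]]$ (with $p$ central, the $p$-adic topology, Hausdorff and $p$-torsion free) generated by $\bar L_{ij,n}$ $(1\le i,j\le N,\ n\in\mathbb Z)$, $\widehat d$ and the central elements $q^{\pm c/2}\in\mathbb F$. That is, it is the quotient of the $p$-adically complete algebra on these generators by the smallest closed two-sided ideal that has $p$-torsion-free quotient and contains the following relations. With $L^+_{ij}(z)=\sum_{n\in\mathbb Z}L_{ij,n}z^{-n}$, $L_{ij,n}=p^{\max(n,0)}\bar L_{ij,n}$ and $L^+(z)=\sum_{i,j} E_{ij}L^+_{ij}(z)$, they are $$R^{+(12)}(z_1/z_2,P+h)L^{+(1)}(z_1)L^{+(2)}(z_2)=L^{+(2)}(z_2)L^{+(1)}(z_1)R^{+*(12)}(z_1/z_2,P),$$ $$f(P+h,P)\,\bar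 L_{ij,n}=\bar L_{ij,n}\,f(P+h-\langle Q_{\bar\epsilon_i},P+h\rangle,\;P-\langle Q_{\bar\epsilon_j},P\rangle)\quad(f\in\mathbb F),\qquad [\widehat d,L^+(z)]=-z\tfrac{\partial}{\partial z}L^+(z),$$ where $\langle Q_{\bar\epsilon_i},(P+h)_{\bar\epsilon_k}\rangle=\langle Q_{\bar\epsilon_i},P_{\bar\epsilon_k}\rangle=(\bar\epsilon_i,\bar\epsilon_k)$. (The variable $c$ of $f$ is not shifted.) **The operator $L^-$.** Let $\pi_V(h_j)=E_{jj}-E_{j+1,j+1}$, $\pi_V(h_{\bar\epsilon_l})=E_{ll}-\frac1N$, $\pi_V(h^j)=\sum_{l\le j}\pi_V(h_{\bar\epsilon_l})$, $h^j=\sum_{l\le j}h_{\bar\epsilon_l}$, $P_j=P_{\bar\epsilon_j}-P_{\bar\epsilon_{j+1}}$, and $$L^-(z)=\big(\mathrm{Ad}(q^{-2\theta_V(P)})\otimes\mathrm{id}\big)\big(q^{2T_V}L^+(zp^*q^c)\big),$$ $$\theta_V(P)=-\sum_{j=1}^{N-1}\Big(\tfrac12\pi_V(h_j)\pi_V(h^j)+P_j\pi_V(h^j)\Big),\qquad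 T_V=\sum_{j=1}^{N-1}\pi_V(h_j)\otimes h^j.$$ Here $L^+_{ij}(zp^*q^c)=\sum_n p^{\max(-n,0)}q^{nc}\bar L_{ij,n}z^{-n}$, because $p^*q^c=pq^{-c}$. **Proposition.** As identities of formal series in $z_1,z_2$ whose coefficients are $p$-adically convergent in $E_{q,p}(\widehat{\mathfrak{gl}}_N)$, $$R^{-(12)}(z_1/z_2,P+h)L^{-(1)}(z_1)L^{-(2)}(z_2)=L^{-(2)}(z_2)L^{-(1)}(z_1)R^{-*(12)}(z_1/z_2,P),$$ $$R^{\pm(12)}(q^{\pm c}z_1/z_2,P+h)L^{\pm(1)}(z_1)L^{\mp(2)}(z_2)=L^{\mp(2)}(z_2)L^{\pm(1)}(z_1)R^{\pm*(12)}(q^{\mp c}z_1/z_2,P),$$ the last for both choices of sign. Here $L^{(1)}=L\otimes\mathrm{id}$ and $L^{(2)}=\mathrm{id}\otimes L$. In components, each relation $R\,L^{(1)}L'^{(2)}=L'^{(2)}L^{(1)}R'$ reads $$\sum_{i',j'}R_{ij}^{i'j'}L_{i'k}(z_1)L'_{j'l}(z_2)=\sum_{i',j'}L'_{jj'}(z_2)L_{ii'}(z_1)R'^{\,kl}_{i'j'},$$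 where $R_{ij}^{i'j'}$ is the coefficient of $E_{ii'}\otimes E_{jj'}$. -/

import Mathlib

open scoped PowerSeries PowerSeries.WithPiTopology

noncomputable section

namespace EllipticQG

/-! ### The dynamical parameters and the field of meromorphic functions -/

/-- Coordinates of the (dual of the) Cartan subalgebra of type `A_{N-1}`:
vectors of `ℂ^N` whose entries sum to zero. -/
def HBar (N : ℕ) : Submodule ℂ (Fin N → ℂ) where
  carrier := {x | ∑ i, x i = 0}
  add_mem' := by
    intro a b ha hb
    simp only [Set.mem_ofPred_eq, Pi.add_apply, Finset.sum_add_distrib] at *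
    rw [ha, hb, add_zero]
  zero_mem' := by simp
  smul_mem' := by
    intro c x hx
    simp only [Set.mem_ofPred_eq, Pi.smul_apply, smul_eq_mul] at *
    rw [← Finset.mul_sum, hx, mul_zero]

/-- The space `H^*`. A point `μ = (x, y, k)` is given by its pairings
`x_j = ⟨μ, (P+h)_{ε̄_j}⟩`, `y_j = ⟨μ, P_{ε̄_j}⟩`, `k = ⟨μ, c⟩`. -/
abbrev HStar (N : ℕ) : Type := HBar N × HBar N × ℂ

/-- The space `H`, as the dual of the finite dimensional space `H^*`. -/
abbrev H (N : ℕ) : Type := HStar N →L[ℂ] ℂ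

/-- The element `(P+h)_{ε̄_j}` of `H`. -/
def Ph {N : ℕ} (j : Fin N) : H N :=
  ((ContinuousLinearMap.proj (R := ℂ) (φ := fun _ : Fin N => ℂ) j).comp (HBar N).subtypeL).comp
    (ContinuousLinearMap.fst ℂ (HBar N) (HBar N × ℂ))

/-- The element `P_{ε̄_j}` of `H`. -/
def Pd {N : ℕ} (j : Fin N) : H N :=
  ((ContinuousLinearMap.proj (R := ℂ) (φ := fun _ : Fin N => ℂ) j).comp (HBar N).subtypeL).comp
    ((ContinuousLinearMap.fst ℂ (HBar N) ℂ).comp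
      (ContinuousLinearMap.snd ℂ (HBar N) (HBar N × ℂ)))

/-- The element `c` of `H`. -/
def cc (N : ℕ) : H N :=
  (ContinuousLinearMap.snd ℂ (HBar N) ℂ).comp (ContinuousLinearMap.snd ℂ (HBar N) (HBar N × ℂ))

/-- The ring of entire functions on `H^*`. -/
def Entire (N : ℕ) : Subalgebra ℂ (HStar N → ℂ) where
  carrier := {f | AnalyticOnNhd ℂ f Set.univ}
  mul_mem' := fun hf hg => AnalyticOnNhd.mul hf hg
  add_mem' := fun hf hg => AnalyticOnNhd.add hf hg
  algebraMap_mem' := fun r => (analyticOnNhd_const : AnalyticOnNhd ℂ (fun _ : HStar N => r) _)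

instance (N : ℕ) : IsDomain (Entire N) := by
  have : NoZeroDivisors (Entire N) := by
    constructor
    rintro ⟨f, hf⟩ ⟨g, hg⟩ h
    by_cases hf0 : f = 0
    · left; exact Subtype.ext hf0
    right
    obtain ⟨x, hx⟩ := Function.ne_iff.mp hf0
    have hfg : ∀ y, f y * g y = 0 := fun y => congrFun (congrArg Subtype.val h) y
    have hne : ∀ᶠ y in nhds x, f y ≠ 0 :=
      (hf x (Set.mem_univ x)).continuousAt.eventually_ne hx
    have hg0 : g =ᶠ[nhds x] 0 := by
      filter_upwards [hne] with y hy
      exact (mul_eq_zero.mp (hfg y)).resolve_left hy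
    have := AnalyticOnNhd.eqOn_zero_of_preconnected_of_eventuallyEq_zero hg
      isPreconnected_univ (Set.mem_univ x) hg0
    exact Subtype.ext (funext fun y => this (Set.mem_univ y))
  exact NoZeroDivisors.to_isDomain _

/-- The field `𝔽` of meromorphic functions on `H^*`. As `H^*` is a finite dimensional complex
vector space, every meromorphic function on it is a quotient of two entire functions. -/
abbrev MerField (N : ℕ) : Type := FractionRing (Entire N)

/-- The function `q^{a + h}` on `H^*`, for `a ∈ ℂ` and `h ∈ H`, where `q = exp ħ`. -/
def qpow {N : ℕ} (ħ a : ℂ) (h : H N) : MerField N :=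
  algebraMap (Entire N) (MerField N)
    ⟨fun μ => Complex.exp (ħ * (a + h μ)), fun μ _ =>
      (analyticAt_const.mul (analyticAt_const.add (h.analyticAt μ))).cexp⟩

/-- The translation `f ↦ f(· + v)` of entire functions. -/
def entireShift {N : ℕ} (v : HStar N) : Entire N ≃+* Entire N where
  toFun f := ⟨fun μ => f.1 (μ + v), fun μ _ =>
    AnalyticAt.fun_comp (f.2 (μ + v) (Set.mem_univ _)) (analyticAt_id.add analyticAt_const)⟩
  invFun f := ⟨fun μ => f.1 (μ - v), fun μ _ =>
    AnalyticAt.fun_comp (f.2 (μ - v) (Set.mem_univ _)) (analyticAt_id.sub analyticAt_const)⟩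
  left_inv f := by ext μ; simp
  right_inv f := by ext μ; simp
  map_mul' f g := rfl
  map_add' f g := rfl

/-- The translation `f ↦ f(· + v)` of meromorphic functions. -/
def shift {N : ℕ} (v : HStar N) : MerField N ≃+* MerField N :=
  IsFractionRing.ringEquivOfRingEquiv (entireShift v)

/-- The weight `ε̄_i`, with coordinates `(ε̄_i, ε̄_k) = δ_{ik} - 1/N`. -/
def epsBar {N : ℕ} (i : Fin N) : HBar N :=
  ⟨fun k => (if k = i then 1 else 0) - 1 / (N : ℂ), by
    have hN : (N : ℂ) ≠ 0 := Nat.cast_ne_zero.mpr (Nat.pos_iff_ne_zero.mp i.pos)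
    change ∑ k : Fin N, ((if k = i then (1 : ℂ) else 0) - 1 / (N : ℂ)) = 0
    simp [Finset.sum_sub_distrib, hN]⟩

/-! ### Infinite products and theta functions as formal power series in `p`

Below `K` is the field of formal Laurent series in `t` over `𝔽` (where `t = z` or `t = z⁻¹`), and
the variable of `K⟦X⟧` is `p`. -/

/-- `(x p; p)_∞ = ∏_{m ≥ 1} (1 - x p^m)`; only the factors with `m ≤ k` contribute to the
coefficient of `p^k`. -/
def poch {K : Type*} [Field K] (x : K) : K⟦X⟧ :=
  PowerSeries.mk fun k =>
    PowerSeries.coeff k (∏ m ∈ Finset.range k, (1 - PowerSeries.C x * PowerSeries.X ^ (m + 1)))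

/-- `Θ_p(x) = (x; p)_∞ (p/x; p)_∞ (p; p)_∞` for `x ≠ 0` not depending on `p`. -/
def theta {K : Type*} [Field K] (x : K) : K⟦X⟧ :=
  PowerSeries.C (1 - x) * poch x * poch x⁻¹ * poch 1

/-- The power series `(y; r)_∞ = ∏_{n ≥ 0} (1 - r^n y)` in the variable `y`, for `|r| < 1`; the
product converges coefficientwise. -/
def qProd (r : ℂ) : ℂ⟦X⟧ :=
  ∏' n : ℕ, (1 - PowerSeries.C (r ^ n) * PowerSeries.X)

/-- `(x p^m; r)_∞` as a power series in `p`, for `m ≥ 1`. -/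
def qProdAt {K : Type*} [Field K] [Algebra ℂ K] (r : ℂ) (x : K) (m : ℕ) : K⟦X⟧ :=
  PowerSeries.mk fun k =>
    if m ∣ k then algebraMap ℂ K (PowerSeries.coeff (k / m) (qProd r)) * x ^ (k / m) else 0

/-- `(x p; p, r)_∞ = ∏_{m ≥ 1} (x p^m; r)_∞`; only the factors with `m ≤ k` contribute to the
coefficient of `p^k`. With `r = q^{2N}` this is `{p x}`. -/
def dpoch {K : Type*} [Field K] [Algebra ℂ K] (r : ℂ) (x : K) : K⟦X⟧ :=
  PowerSeries.mk fun k =>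
    PowerSeries.coeff k (∏ m ∈ Finset.range k, qProdAt r x (m + 1))

/-- `(a t; p, r)_∞ = (a t; r)_∞ (a t p; p, r)_∞`, with `(a t; r)_∞` a power series in `t`.
With `r = q^{2N}` this is `{a t}`. -/
def dpochVar {F : Type*} [Field F] [Algebra ℂ F] (r a : ℂ) : (LaurentSeries F)⟦X⟧ :=
  PowerSeries.C (HahnSeries.ofPowerSeries ℤ F
      (PowerSeries.map (algebraMap ℂ F) (PowerSeries.rescale a (qProd r)))) *
    dpoch r (HahnSeries.single (1 : ℤ) (algebraMap ℂ F a))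

/-! ### The elliptic dynamical `R`-matrices -/

/-- The two signs. -/
inductive Sgn where
  | plus
  | minus

/-- The integer `±1`. -/
def Sgn.toInt : Sgn → ℤ
  | .plus => 1
  | .minus => -1

/-- `q^a` for `a ∈ ℂ`. -/
def qc (ħ a : ℂ) : ℂ := Complex.exp (ħ * a)

section RMatrix

variable {F : Type*} [Field F] [Algebra ℂ F]

/-- The variable `z` in the field of Laurent series in `t = z^{±1}`. -/
def zvar (F : Type*) [Field F] (e : Sgn) : LaurentSeries F := HahnSeries.single e.toInt 1

/-- A complex number as a constant of `F((t))`. -/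
def cst (F : Type*) [Field F] [Algebra ℂ F] (a : ℂ) : LaurentSeries F :=
  HahnSeries.C (algebraMap ℂ F a)

/-- `ρ^±(z)`, with the factors independent of `p` expanded in `t = z^{±1}`. Here `{·}` is
`dpochVar` for arguments `a t`, and `dpoch` (without the `p`) for arguments `p a t⁻¹`, `p a t`. -/
def rho (F : Type*) [Field F] [Algebra ℂ F] (ħ : ℂ) (N : ℕ) (e : Sgn) : (LaurentSeries F)⟦X⟧ :=
  let r := qc ħ (2 * N)
  let z := zvar F e
  match e with
  | .plus =>
    PowerSeries.C (cst F (qc ħ (-((N - 1) / N)))) *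
      (dpochVar r (qc ħ 2) * dpochVar r (qc ħ (2 * N - 2)) *
        dpoch r z⁻¹ * dpoch r (cst F (qc ħ (2 * N)) * z⁻¹)) *
      (dpochVar r 1 * dpochVar r (qc ħ (2 * N)) *
        dpoch r (cst F (qc ħ 2) * z⁻¹) * dpoch r (cst F (qc ħ (2 * N - 2)) * z⁻¹))⁻¹
  | .minus =>
    PowerSeries.C (cst F (qc ħ ((N - 1) / N))) *
      (dpoch r (cst F (qc ħ 2) * z) * dpoch r (cst F (qc ħ (2 * N - 2)) * z) *
        dpochVar r 1 * dpochVar r (qc ħ (2 * N))) *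
      (dpoch r z * dpoch r (cst F (qc ħ (2 * N)) * z) *
        dpochVar r (qc ħ 2) * dpochVar r (qc ħ (2 * N - 2)))⁻¹

/-- `b(z, s)`, where `S = q^{2s}`. -/
def bfun (ħ : ℂ) (e : Sgn) (S : F) : (LaurentSeries F)⟦X⟧ :=
  let z := zvar F e
  let S' : LaurentSeries F := HahnSeries.C S
  PowerSeries.C (cst F (qc ħ 1)) *
    (theta (cst F (qc ħ 2) * S') * theta (cst F (qc ħ (-2)) * S') * theta z) *
    (theta S' ^ 2 * theta (cst F (qc ħ 2) * z))⁻¹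

/-- `b̄(z)`. -/
def bbar (F : Type*) [Field F] [Algebra ℂ F] (ħ : ℂ) (e : Sgn) : (LaurentSeries F)⟦X⟧ :=
  let z := zvar F e
  PowerSeries.C (cst F (qc ħ 1)) * theta z * (theta (cst F (qc ħ 2) * z))⁻¹

/-- `c(z, s)`, where `S = q^{2s}`. -/
def cfun (ħ : ℂ) (e : Sgn) (S : F) : (LaurentSeries F)⟦X⟧ :=
  let z := zvar F e
  let S' : LaurentSeries F := HahnSeries.C S
  theta (cst F (qc ħ 2)) * theta (S' * z) * (theta S' * theta (cst F (qc ħ 2) * z))⁻¹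

/-- The coefficient of `E_{i i'} ⊗ E_{j j'}` in `R̄(z, s)`, where `S j l = q^{2 s_{j,l}}`. -/
def RbarEntry {N : ℕ} (ħ : ℂ) (e : Sgn) (S : Fin N → Fin N → F) (i j i' j' : Fin N) :
    (LaurentSeries F)⟦X⟧ :=
  if i = j then
    if i' = i ∧ j' = j then 1 else 0
  else if i' = i ∧ j' = j then
    if i < j then bfun ħ e (S i j) else bbar F ħ e
  else if i' = j ∧ j' = i then
    if i < j then cfun ħ e (S i j) else cfun ħ e (S j i)⁻¹
  else 0

/-- The coefficient of `z^n`, a power series in `p`, of the coefficient `R^±(z, s)_{ij}^{i'j'}`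
of `E_{i i'} ⊗ E_{j j'}` in `R^±(z, s)`, where `S j l = q^{2 s_{j,l}}`. -/
def Rcoeff {N : ℕ} (ħ : ℂ) (e : Sgn) (S : Fin N → Fin N → F) (i j i' j' : Fin N) (n : ℤ) : F⟦X⟧ :=
  PowerSeries.mk fun k =>
    (PowerSeries.coeff k (rho F ħ N e * RbarEntry ħ e S i j i' j')).coeff (e.toInt * n)

end RMatrix

/-- A formal series in `z` with `N² × N²` matrix coefficients over `𝔽[[p]]`; the argument
`i j i' j' n` gives the coefficient of `E_{i i'} ⊗ E_{j j'} z^n`. -/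
abbrev RSeries (N : ℕ) : Type := Fin N → Fin N → Fin N → Fin N → ℤ → (MerField N)⟦X⟧

/-- `R^±(z, P+h)`. -/
def RPh (ħ : ℂ) (N : ℕ) (e : Sgn) : RSeries N :=
  Rcoeff ħ e fun j l => qpow ħ 0 ((2 : ℂ) • (Ph j - Ph l))

/-- `R^{±*}(z, P)`: the matrix `R^±(z, P)` with `p` replaced by `p^* = p q^{-2c}`. -/
def RStarP (ħ : ℂ) (N : ℕ) (e : Sgn) : RSeries N := fun i j i' j' n =>
  PowerSeries.rescale (qpow ħ 0 ((-2 : ℂ) • cc N))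
    (Rcoeff ħ e (fun j l => qpow ħ 0 ((2 : ℂ) • (Pd j - Pd l))) i j i' j' n)

/-- `R(q^{e c} z)` for a series `R(z)` and a sign `e`. -/
def RSeries.spectralShift {N : ℕ} (ħ : ℂ) (e : Sgn) (R : RSeries N) : RSeries N :=
  fun i j i' j' n =>
    PowerSeries.C (qpow ħ 0 ((e.toInt * n : ℂ) • cc N)) * R i j i' j' n

/-! ### The algebra before the `RLL` relations are imposed -/

/-- Generators: the scalars `f ∈ 𝔽`, the `L̄_{ij,n}`, and `d̂`. The central elements `q^{±c/2}` are
the corresponding elements of `𝔽`. -/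
inductive Gen (N : ℕ) : Type where
  | scal (f : MerField N)
  | L (i j : Fin N) (n : ℤ)
  | d

open FreeAlgebra in
/-- The relations not involving `p`: `𝔽` is embedded as a `ℂ`-algebra;
`f(P+h, P) L̄_{ij,n} = L̄_{ij,n} f(P+h - ⟨Q_{ε̄_i}, P+h⟩, P - ⟨Q_{ε̄_j}, P⟩)`;
and `q^{±c/2}` are central. -/
inductive PreRel (ħ : ℂ) (N : ℕ) : FreeAlgebra ℂ (Gen N) → FreeAlgebra ℂ (Gen N) → Prop where
  | scal_add (f g : MerField N) :
      PreRel ħ N (ι ℂ (.scal (f + g))) (ι ℂ (.scal f) + ι ℂ (.scal g))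
  | scal_mul (f g : MerField N) :
      PreRel ħ N (ι ℂ (.scal (f * g))) (ι ℂ (.scal f) * ι ℂ (.scal g))
  | scal_algebraMap (a : ℂ) :
      PreRel ħ N (ι ℂ (.scal (algebraMap ℂ (MerField N) a))) (algebraMap ℂ _ a)
  | scal_L (f : MerField N) (i j : Fin N) (n : ℤ) :
      PreRel ħ N (ι ℂ (.scal f) * ι ℂ (.L i j n))
        (ι ℂ (.L i j n) * ι ℂ (.scal (shift (-epsBar i, -epsBar j, 0) f)))
  | c_d : PreRel ħ N (ι ℂ (.scal (qpow ħ 0 ((1 / 2 : ℂ) • cc N))) * ι ℂ .d)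
        (ι ℂ .d * ι ℂ (.scal (qpow ħ 0 ((1 / 2 : ℂ) • cc N))))
  | c_d_neg : PreRel ħ N (ι ℂ (.scal (qpow ħ 0 ((-1 / 2 : ℂ) • cc N))) * ι ℂ .d)
        (ι ℂ .d * ι ℂ (.scal (qpow ħ 0 ((-1 / 2 : ℂ) • cc N))))

/-- The algebra generated by `𝔽`, `L̄_{ij,n}`, `d̂` with the relations `PreRel`. -/
abbrev PreAlg (ħ : ℂ) (N : ℕ) : Type := RingQuot (PreRel ħ N)

instance (ħ : ℂ) (N : ℕ) : TopologicalSpace (PreAlg ħ N) := ⊥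

instance (ħ : ℂ) (N : ℕ) : DiscreteTopology (PreAlg ħ N) := ⟨rfl⟩

/-- A generator as an element of `PreAlg`. -/
def gen {ħ : ℂ} {N : ℕ} (x : Gen N) : PreAlg ħ N :=
  RingQuot.mkAlgHom ℂ (PreRel ħ N) (FreeAlgebra.ι ℂ x)

/-- The embedding of the scalars. -/
def preScal (ħ : ℂ) (N : ℕ) : MerField N →+* PreAlg ħ N where
  toFun f := gen (.scal f)
  map_one' := by
    have h := RingQuot.mkAlgHom_rel ℂ (PreRel.scal_algebraMap (ħ := ħ) (N := N) 1)
    simpa [gen] using h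
  map_zero' := by
    have h := RingQuot.mkAlgHom_rel ℂ (PreRel.scal_algebraMap (ħ := ħ) (N := N) 0)
    simpa [gen] using h
  map_mul' f g := by
    have h := RingQuot.mkAlgHom_rel ℂ (PreRel.scal_mul (ħ := ħ) f g)
    simpa [gen] using h
  map_add' f g := by
    have h := RingQuot.mkAlgHom_rel ℂ (PreRel.scal_add (ħ := ħ) f g)
    simpa [gen] using h

/-- The `p`-adic completion of `PreAlg[p]`: power series in the central variable `p`, with the
`p`-adic topology (the topology of coefficientwise convergence for discrete coefficients). -/
abbrev PAlg (ħ : ℂ) (N : ℕ) : Type := (PreAlg ħ N)⟦X⟧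

/-- The map `𝔽[[p]] → PAlg`. -/
def pScal (ħ : ℂ) (N : ℕ) : (MerField N)⟦X⟧ →+* PAlg ħ N := PowerSeries.map (preScal ħ N)

/-- `L_{ij,n} = p^{max(n,0)} L̄_{ij,n}`. -/
def Lmode (ħ : ℂ) {N : ℕ} (i j : Fin N) (n : ℤ) : PAlg ħ N :=
  PowerSeries.X ^ n.toNat * PowerSeries.C (gen (.L i j n))

/-- The coefficient of `z^m` in `L^+_{ij}(z) = ∑_n L_{ij,n} z^{-n}`. -/
def LplusP (ħ : ℂ) {N : ℕ} (i j : Fin N) (m : ℤ) : PAlg ħ N := Lmode ħ i j (-m)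

/-- The coefficient of `z^m` in `L^+_{ij}(z p^* q^c)`. As `p^* q^c = p q^{-c}`, it is
`(p q^{-c})^m p^{max(-m,0)} L̄_{ij,-m} = p^{max(m,0)} q^{-mc} L̄_{ij,-m}`. -/
def LplusShiftP (ħ : ℂ) {N : ℕ} (i j : Fin N) (m : ℤ) : PAlg ħ N :=
  PowerSeries.X ^ m.toNat *
    pScal ħ N (PowerSeries.C (qpow ħ 0 ((-m : ℂ) • cc N))) * PowerSeries.C (gen (.L i j (-m)))

/-! ### The dynamical gauge twist defining `L^-`

The sums over `k ∈ {1, …, N-1}` are written with `k ∈ {0, …, N-2}`, and the basis of `V` is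
indexed by `Fin N = {0, …, N-1}`. -/

/-- The `i`-th diagonal entry of `π_V(h_k) = E_{kk} - E_{k+1,k+1}`. -/
def piH {N : ℕ} (k : Fin (N - 1)) (i : Fin N) : ℂ :=
  (if (i : ℕ) = k then 1 else 0) - (if (i : ℕ) = k + 1 then 1 else 0)

/-- The `i`-th diagonal entry of `π_V(h^k) = ∑_{l ≤ k} π_V(h_{ε̄_l})`, where
`π_V(h_{ε̄_l}) = E_{ll} - 1/N`. -/
def piHUp {N : ℕ} (k : Fin (N - 1)) (i : Fin N) : ℂ :=
  ∑ l : Fin N, if (l : ℕ) ≤ k then ((if i = l then 1 else 0) - 1 / (N : ℂ)) else 0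

/-- `h^k = h_{Λ̄_k} = ∑_{l ≤ k} h_{ε̄_l}`, where `h_{ε̄_l} = (P+h)_{ε̄_l} - P_{ε̄_l}`. -/
def hUp {N : ℕ} (k : Fin (N - 1)) : H N :=
  ∑ l : Fin N, if (l : ℕ) ≤ k then Ph l - Pd l else 0

/-- `P_k = P_{ε̄_k} - P_{ε̄_{k+1}}`. -/
def Psimple {N : ℕ} (k : Fin (N - 1)) : H N :=
  Pd ⟨k, by omega⟩ - Pd ⟨k + 1, by omega⟩

/-- The scalar part of the `i`-th diagonal entry of
`θ_V(P) = - ∑_k (½ π_V(h_k) π_V(h^k) + P_k π_V(h^k))`. -/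
def thetaConst {N : ℕ} (i : Fin N) : ℂ := -∑ k : Fin (N - 1), 1 / 2 * (piH k i * piHUp k i)

/-- The part in `H` of the `i`-th diagonal entry of `θ_V(P)`. -/
def thetaLin {N : ℕ} (i : Fin N) : H N := -∑ k : Fin (N - 1), piHUp k i • Psimple k

/-- The `i`-th diagonal entry of `T_V = ∑_k π_V(h_k) ⊗ h^k`. -/
def TV {N : ℕ} (i : Fin N) : H N := ∑ k : Fin (N - 1), piH k i • hUp k

/-- The coefficient of `z^m` in the `(i,j)` entry of
`L^-(z) = (Ad(q^{-2θ_V(P)}) ⊗ id)(q^{2T_V} L^+(z p^* q^c))`. -/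
def LminusP (ħ : ℂ) {N : ℕ} (i j : Fin N) (m : ℤ) : PAlg ħ N :=
  pScal ħ N (PowerSeries.C (qpow ħ (-2 * thetaConst i) ((-2 : ℂ) • thetaLin i))) *
    (pScal ħ N (PowerSeries.C (qpow ħ 0 ((2 : ℂ) • TV i))) * LplusShiftP ħ i j m) *
    pScal ħ N (PowerSeries.C (qpow ħ (2 * thetaConst j) ((2 : ℂ) • thetaLin j)))

/-! ### The `RLL` relations in components -/

section RLL

variable {N : ℕ} {B : Type*} [Ring B] [TopologicalSpace B]

/-- The terms of the coefficient of `z₁^a z₂^b` in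
`∑_{i',j'} R(z₁/z₂)_{ij}^{i'j'} L_{i'k}(z₁) L'_{j'l}(z₂)`. -/
def lhsTerm (φ : (MerField N)⟦X⟧ →+* B) (R : RSeries N) (L L' : Fin N → Fin N → ℤ → B)
    (i j k l : Fin N) (a b : ℤ) (t : Fin N × Fin N × ℤ) : B :=
  φ (R i j t.1 t.2.1 t.2.2) * L t.1 k (a - t.2.2) * L' t.2.1 l (b + t.2.2)

/-- The terms of the coefficient of `z₁^a z₂^b` in
`∑_{i',j'} L'_{jj'}(z₂) L_{ii'}(z₁) R(z₁/z₂)_{i'j'}^{kl}`. -/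
def rhsTerm (φ : (MerField N)⟦X⟧ →+* B) (R : RSeries N) (L L' : Fin N → Fin N → ℤ → B)
    (i j k l : Fin N) (a b : ℤ) (t : Fin N × Fin N × ℤ) : B :=
  L' j t.2.1 (b + t.2.2) * L i t.1 (a - t.2.2) * φ (R t.1 t.2.1 k l t.2.2)

/-- The relation `R(z₁/z₂) L^{(1)}(z₁) L'^{(2)}(z₂) = L'^{(2)}(z₂) L^{(1)}(z₁) R'(z₁/z₂)`
between formal series in `z₁, z₂`: all the coefficients converge, and they agree. -/
def RLLHolds (φ : (MerField N)⟦X⟧ →+* B) (R R' : RSeries N) (L L' : Fin N → Fin N → ℤ → B) :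
    Prop :=
  ∀ (i j k l : Fin N) (a b : ℤ),
    Summable (lhsTerm φ R L L' i j k l a b) ∧ Summable (rhsTerm φ R' L L' i j k l a b) ∧
      ∑' t, lhsTerm φ R L L' i j k l a b t = ∑' t, rhsTerm φ R' L L' i j k l a b t

end RLL

/-! ### The elliptic algebra -/

/-- The closed two-sided ideals of `PAlg` with `p`-torsion free quotient which contain the
defining relations
`R^+(z₁/z₂, P+h) L^{+(1)}(z₁) L^{+(2)}(z₂) = L^{+(2)}(z₂) L^{+(1)}(z₁) R^{+*}(z₁/z₂, P)` and
`[d̂, L^+(z)] = - z ∂_z L^+(z)`. -/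
structure IsRelIdeal (ħ : ℂ) (N : ℕ) (I : Ideal (PAlg ħ N)) : Prop where
  isTwoSided : I.IsTwoSided
  isClosed : IsClosed (I : Set (PAlg ħ N))
  saturated : ∀ x : PAlg ħ N, PowerSeries.X * x ∈ I → x ∈ I
  rll : ∀ (i j k l : Fin N) (a b : ℤ),
    ∑' t, lhsTerm (pScal ħ N) (RPh ħ N .plus) (LplusP ħ) (LplusP ħ) i j k l a b t -
      ∑' t, rhsTerm (pScal ħ N) (RStarP ħ N .plus) (LplusP ħ) (LplusP ħ) i j k l a b t ∈ I
  d_L : ∀ (i j : Fin N) (n : ℤ),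
    PowerSeries.C (gen .d) * Lmode ħ i j n - Lmode ħ i j n * PowerSeries.C (gen .d)
      - (n : PAlg ħ N) * Lmode ħ i j n ∈ I

/-- The smallest such ideal. -/
def relIdeal (ħ : ℂ) (N : ℕ) : Ideal (PAlg ħ N) := sInf {I | IsRelIdeal ħ N I}

instance (ħ : ℂ) (N : ℕ) : (relIdeal ħ N).IsTwoSided := by
  refine ⟨fun {a} b ha => ?_⟩
  simp only [relIdeal, Submodule.mem_sInf, Set.mem_ofPred_eq] at ha ⊢
  intro I hI
  have := hI.isTwoSided
  exact Ideal.mul_mem_right (I := I) b (ha I hI)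

/-- The elliptic algebra `E_{q,p}(ĝl_N)`. -/
abbrev Eqp (ħ : ℂ) (N : ℕ) : Type := PAlg ħ N ⧸ relIdeal ħ N

/-- The topology of `E_{q,p}(ĝl_N)` is the quotient of the `p`-adic topology. -/
instance (ħ : ℂ) (N : ℕ) : TopologicalSpace (Eqp ħ N) :=
  TopologicalSpace.coinduced (Ideal.Quotient.mk (relIdeal ħ N)) inferInstance

/-- The map `𝔽[[p]] → E_{q,p}(ĝl_N)`. -/
def scal (ħ : ℂ) (N : ℕ) : (MerField N)⟦X⟧ →+* Eqp ħ N :=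
  (Ideal.Quotient.mk (relIdeal ħ N)).comp (pScal ħ N)

/-- The coefficient of `z^m` in `L^+_{ij}(z)`, in `E_{q,p}(ĝl_N)`. -/
def Lplus (ħ : ℂ) (N : ℕ) (i j : Fin N) (m : ℤ) : Eqp ħ N :=
  Ideal.Quotient.mk (relIdeal ħ N) (LplusP ħ i j m)

/-- The coefficient of `z^m` in `L^-_{ij}(z)`, in `E_{q,p}(ĝl_N)`. -/
def Lminus (ħ : ℂ) (N : ℕ) (i j : Fin N) (m : ℤ) : Eqp ħ N :=
  Ideal.Quotient.mk (relIdeal ħ N) (LminusP ħ i j m)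

end EllipticQG

end

/-! Undoing the gauge twist shows that, up to a monomial $q^{a+h}$, the coefficient of $z^m$ in
$L^-_{ij}$ is $p^m$ times that of $L^+_{ij}$ (`LminusP_eq`, `powRel_LminusP`). All three relations
therefore come from relations between two copies of $L^+$, by multiplying each term with a power of
$p$ and a monomial. As $m$ may be negative, "$y = p^m x$" is expressed by `PowRel`, which puts
powers of $p$ on both sides.

Two properties of the $R$-matrix are needed. Unitarity, $R^-(z)R^+_{21}(1/z)=1$ (`Rmat_unitarity`),
turns the defining relation, with its two tensor factors exchanged, into the same relation with
$R^-$ in place of $R^+$ (`rllMod_minus`). It rests on the three-term identity `theta_weierstrass`,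
itself a consequence of the Jacobi triple product, and on the cancellation $\rho^-(z)\rho^+(1/z)=1$.
Quasi-periodicity says that $R^+(pz)$ and $R^-(z)$ agree entry by entry up to a scalar
(`Rcoeff_shift`). Analytically the two series live in $|p|<|z|<1$ and $1<|z|<|p|^{-1}$, and
$z\mapsto pz$ carries the second annulus to the first; formally this is the exchange of $t$ and
$p/t$ on $F[[t,p/t]]$, encoded by `FlipPair`.

Fix the coefficient of $z_1^az_2^b$ and move every monomial to the far left, across the $L^+$'s.
Since $R$ preserves weights, the total power of $p$ and the total monomial are then the same for all
terms on both sides; the powers are $p^{a+b}$, $p^b$, $p^a$ in the three cases. The new relation is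
thus $p^M u$ times an old one, and a negative $M$ is harmless because the quotient has no
$p$-torsion (`RLLMod.of_powRel`). -/

noncomputable section

namespace EllipticQG

/-! ### The $q$-binomial theorem and truncated Pochhammer products. -/

open PowerSeries in
/-- Gaussian binomial coefficients, as power series in their parameter. -/
def gaussBinom (K : Type*) [CommRing K] : ℕ → ℕ → K⟦X⟧
  | _, 0 => 1
  | 0, _ + 1 => 0
  | n + 1, k + 1 => gaussBinom K n k + X ^ (k + 1) * gaussBinom K n (k + 1)

section Gauss

open PowerSeries

variable {K : Type*} [CommRing K]

@[simp] lemma gaussBinom_zero_right (n : ℕ) : gaussBinom K n 0 = 1 := by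
  cases n <;> rfl

lemma gaussBinom_succ_succ (n k : ℕ) :
    gaussBinom K (n + 1) (k + 1) = gaussBinom K n k + X ^ (k + 1) * gaussBinom K n (k + 1) := rfl

lemma gaussBinom_eq_zero_of_lt {n k : ℕ} (h : n < k) : gaussBinom K n k = 0 := by
  induction n generalizing k with
  | zero => obtain ⟨k, rfl⟩ := Nat.exists_eq_succ_of_ne_zero h.ne'; rfl
  | succ n ih =>
    obtain ⟨k, rfl⟩ := Nat.exists_eq_succ_of_ne_zero (Nat.ne_zero_of_lt h)
    rw [Nat.succ_eq_add_one, gaussBinom_succ_succ, ih (by omega), ih (by omega)]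
    simp

/-- The quotient of neighbouring binomials, cleared of denominators. Iterating it in $k$ gives the
product formula `pochFin_one_mul_gaussBinom`. -/
lemma gaussBinom_ratio (n k : ℕ) (h : k ≤ n) :
    (1 - X ^ (k + 1)) * gaussBinom K n (k + 1) = (1 - X ^ (n - k)) * gaussBinom K n k := by
  induction n generalizing k with
  | zero =>
    obtain rfl : k = 0 := by omega
    simp [gaussBinom]
  | succ n ih =>
    rcases h.eq_or_lt with rfl | h
    · simp [gaussBinom_eq_zero_of_lt]
    · have h1 := ih k (by omega)
      rw [gaussBinom_succ_succ, mul_add, mul_left_comm, h1]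
      have e1 : (X : K⟦X⟧) ^ (n + 1) = X ^ (k + 1) * X ^ (n - k) := by
        rw [← pow_add]; congr 1; omega
      cases k with
      | zero =>
        simp only [gaussBinom_zero_right, Nat.sub_zero] at *
        rw [e1]; ring
      | succ k =>
        have h2 := ih k (by omega)
        rw [gaussBinom_succ_succ]
        have e2 : (X : K⟦X⟧) ^ (n - k) = X * X ^ (n - (k + 1)) := by
          rw [← pow_succ']; congr 1; omega
        have e3 : n + 1 - (k + 1) = n - k := by omega
        rw [e3]
        rw [mul_add, mul_left_comm (1 - X ^ (n - k)), ← sub_eq_zero]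
        rw [e2] at h2 ⊢
        linear_combination h2

/-- The `q`-binomial theorem. -/
lemma prod_sub_mul_X_pow (a b : K⟦X⟧) (n : ℕ) :
    ∏ m ∈ Finset.range n, (a - b * X ^ m) = ∑ k ∈ Finset.range (n + 1),
      (-1) ^ k * X ^ (k.choose 2) * gaussBinom K n k * a ^ (n - k) * b ^ k := by
  induction n generalizing b with
  | zero => simp
  | succ n ih =>
    rw [Finset.prod_range_succ']
    have : ∀ m, a - b * X ^ (m + 1) = a - (b * X) * X ^ m := fun m => by ring
    simp_rw [this, ih]
    -- `f` and `g` collect the contributions of $a$ and of $-b$ in the split-off factor; Pascal's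
    -- rule merges `f (k + 1)` with `g k`.
    set f : ℕ → K⟦X⟧ := fun k =>
      (-1) ^ k * X ^ (k.choose 2) * X ^ k * gaussBinom K n k * a ^ (n + 1 - k) * b ^ k with hf
    set g : ℕ → K⟦X⟧ := fun k =>
      (-1) ^ (k + 1) * X ^ ((k + 1).choose 2) * gaussBinom K n k * a ^ (n - k) * b ^ (k + 1) with hg
    have h1 : (∑ k ∈ Finset.range (n + 1), (-1) ^ k * X ^ (k.choose 2) * gaussBinom K n k *
        a ^ (n - k) * (b * X) ^ k) * (a - b * X ^ 0) =
        ∑ k ∈ Finset.range (n + 1), f k + ∑ k ∈ Finset.range (n + 1), g k := by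
      rw [← Finset.sum_add_distrib, Finset.sum_mul]
      refine Finset.sum_congr rfl fun k hk => ?_
      have hk' : n + 1 - k = n - k + 1 := by have := Finset.mem_range.mp hk; omega
      simp only [hf, hg, hk', Nat.choose_succ_succ' k 1, Nat.choose_one_right]
      ring
    rw [h1, Finset.sum_range_succ' (fun k => (-1) ^ k * X ^ (k.choose 2) *
      gaussBinom K (n + 1) k * a ^ (n + 1 - k) * b ^ k)]
    have h2 : ∑ k ∈ Finset.range (n + 1), f k = ∑ k ∈ Finset.range (n + 1), f (k + 1) + f 0 := by
      rw [← Finset.sum_range_succ', Finset.sum_range_succ _ (n + 1)]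
      simp [hf, gaussBinom_eq_zero_of_lt]
    rw [h2, add_right_comm, ← Finset.sum_add_distrib]
    congr 1
    · refine Finset.sum_congr rfl fun k hk => ?_
      have hk' : n + 1 - (k + 1) = n - k := by omega
      simp only [hf, hg, hk', gaussBinom_succ_succ]
      ring
    · simp [hf]

/-- The finite product `∏_{1 ≤ m ≤ n} (1 - x p^m)`. -/
def pochFin (x : K) (n : ℕ) : K⟦X⟧ := ∏ m ∈ Finset.range n, (1 - C x * X ^ (m + 1))

lemma pochFin_one_mul_gaussBinom (n k : ℕ) (h : k ≤ n) :
    pochFin (1 : K) k * gaussBinom K n k = ∏ i ∈ Finset.range k, (1 - X ^ (n - i)) := by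
  induction k with
  | zero => simp [pochFin]
  | succ k ih =>
    have := gaussBinom_ratio (K := K) n k (by omega)
    rw [Finset.prod_range_succ, ← ih (by omega), mul_right_comm _ _ (1 - X ^ (n - k)),
      mul_assoc, mul_comm (1 - X ^ (n - k)), mul_comm _ (1 - X ^ (n - k)), ← this, pochFin,
      Finset.prod_range_succ, ← pochFin]
    simp [mul_assoc]

lemma X_pow_dvd_prod_sub_one {ι : Type*} (s : Finset ι) (f : ι → K⟦X⟧) (n : ℕ)
    (h : ∀ i ∈ s, X ^ n ∣ f i - 1) : X ^ n ∣ ∏ i ∈ s, f i - 1 := by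
  classical
  induction s using Finset.induction_on with
  | empty => simp
  | insert i s hi ih =>
    rw [Finset.prod_insert hi]
    have h1 := h i (Finset.mem_insert_self _ _)
    have h2 := ih fun j hj => h j (Finset.mem_insert_of_mem hj)
    have : f i * ∏ i ∈ s, f i - 1 = (f i - 1) * ∏ i ∈ s, f i + (∏ i ∈ s, f i - 1) := by ring
    rw [this]
    exact dvd_add (h1.mul_right _) h2

lemma X_pow_dvd_pochFin_sub (x : K) {k m n : ℕ} (hk : k ≤ m) (hm : m ≤ n) :
    X ^ (k + 1) ∣ pochFin x n - pochFin x m := by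
  obtain ⟨d, rfl⟩ := Nat.exists_eq_add_of_le hm
  rw [pochFin, Finset.prod_range_add, ← pochFin,
    show ∀ a b : K⟦X⟧, a * b - a = a * (b - 1) by intros; ring]
  refine (X_pow_dvd_prod_sub_one _ _ _ fun i _ => ?_).mul_left _
  rw [sub_sub_cancel_left, dvd_neg]
  exact (pow_dvd_pow _ (by omega)).mul_left _

end Gauss

/-! ### The Jacobi triple product and the three-term theta identity. -/

section Theta

open PowerSeries

variable {K : Type*} [Field K]

lemma X_pow_dvd_poch_sub (x : K) {k n : ℕ} (h : k ≤ n) :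
    X ^ (k + 1) ∣ poch x - pochFin x n := by
  rw [X_pow_dvd_iff]
  intro m hm
  have := X_pow_dvd_iff.mp (X_pow_dvd_pochFin_sub x le_rfl (show m ≤ n by omega)) m (by omega)
  rw [map_sub, sub_eq_zero] at this ⊢
  rw [this, poch, coeff_mk, pochFin]

lemma X_pow_dvd_sub_trans {a b c : K⟦X⟧} {n : ℕ} (h1 : X ^ n ∣ a - b) (h2 : X ^ n ∣ b - c) :
    X ^ n ∣ a - c := by
  rw [← sub_add_sub_cancel a b c]; exact dvd_add h1 h2

lemma X_pow_dvd_mul_sub_mul {a b c d : K⟦X⟧} {n : ℕ} (h1 : X ^ n ∣ a - b) (h2 : X ^ n ∣ c - d) :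
    X ^ n ∣ a * c - b * d := by
  rw [show a * c - b * d = (a - b) * c + b * (c - d) by ring]
  exact dvd_add (h1.mul_right _) (h2.mul_left _)

/-- The binomial tends to $1/(p;p)_\infty$ as both $k$ and $n-k$ grow, with precision governed by
the smaller of the two. -/
lemma X_pow_dvd_gaussBinom_mul_poch (n k l : ℕ) (hk : k ≤ n) (h1 : l ≤ k) (h2 : l ≤ n - k) :
    X ^ (l + 1) ∣ gaussBinom K n k * poch 1 - 1 := by
  have e1 : X ^ (l + 1) ∣ gaussBinom K n k * poch 1 - gaussBinom K n k * pochFin 1 k :=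
    X_pow_dvd_mul_sub_mul (by simp) (X_pow_dvd_poch_sub 1 h1)
  refine X_pow_dvd_sub_trans e1 ?_
  rw [mul_comm, pochFin_one_mul_gaussBinom _ _ hk]
  refine X_pow_dvd_prod_sub_one _ _ _ fun i hi => ?_
  have := Finset.mem_range.mp hi
  rw [sub_sub_cancel_left, dvd_neg]
  exact pow_dvd_pow _ (by omega)

/-- `j (j - 1) / 2`, as a natural number. -/
def triInt (j : ℤ) : ℕ := (j * (j - 1) / 2).toNat

lemma two_mul_triInt (j : ℤ) : 2 * (triInt j : ℤ) = j * (j - 1) := by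
  have h2 : (2 : ℤ) ∣ j * (j - 1) := by
    have := Int.even_mul_pred_self j
    exact this.two_dvd
  have h0 : 0 ≤ j * (j - 1) / 2 := by
    apply Int.ediv_nonneg _ (by norm_num)
    rcases le_or_gt j 0 with h | h <;> nlinarith
  rw [triInt, Int.toNat_of_nonneg h0, Int.mul_ediv_cancel' h2]

/-- The finite form of the Jacobi triple product. -/
lemma finite_triple_product (x : K) (hx : x ≠ 0) (n : ℕ) :
    C (1 - x) * pochFin x n * pochFin x⁻¹ (n + 1) =
      ∑ k ∈ Finset.range (2 * (n + 1) + 1), C ((-1) ^ ((k : ℤ) - (n + 1)) * x ^ ((k : ℤ) - (n + 1))) *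
        X ^ (triInt ((k : ℤ) - (n + 1))) * gaussBinom K (2 * (n + 1)) k := by
  have key := prod_sub_mul_X_pow (X ^ (n + 1)) (C x) (2 * (n + 1)) (K := K)
  set N := n + 1 with hN
  have hC : (C x : K⟦X⟧) * C x⁻¹ = 1 := by rw [← map_mul, mul_inv_cancel₀ hx, map_one]
  -- With $a=p^N$, $b=x$ and $2N$ factors, the first $N$ factors read backwards give $(p/x;p)_N$ and
  -- the last $N$ give $(x;p)_N$, up to a monomial that is cancelled afterwards.
  have lhs : ∏ m ∈ Finset.range (2 * N), ((X : K⟦X⟧) ^ N - C x * X ^ m) =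
      X ^ (N.choose 2 + N * N) * (-C x) ^ N * (C (1 - x) * pochFin x n * pochFin x⁻¹ N) := by
    rw [two_mul, Finset.prod_range_add]
    have a1 : ∏ m ∈ Finset.range N, ((X : K⟦X⟧) ^ N - C x * X ^ m) =
        X ^ (N.choose 2) * (-C x) ^ N * pochFin x⁻¹ N := by
      have : ∀ m ∈ Finset.range N, ((X : K⟦X⟧) ^ N - C x * X ^ m) =
          X ^ m * (-C x) * (1 - C x⁻¹ * X ^ (N - 1 - m + 1)) := by
        intro m hm
        have hm := Finset.mem_range.mp hm
        have : (X : K⟦X⟧) ^ N = X ^ m * X ^ (N - 1 - m + 1) := by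
          rw [← pow_add]; congr 1; omega
        rw [this]
        linear_combination (- X ^ m * X ^ (N - 1 - m + 1)) * hC
      rw [Finset.prod_congr rfl this, Finset.prod_mul_distrib, Finset.prod_mul_distrib,
        Finset.prod_pow_eq_pow_sum, Finset.sum_range_id, ← Nat.choose_two_right,
        Finset.prod_const, Finset.card_range,
        Finset.prod_range_reflect (fun m => (1 - C x⁻¹ * X ^ (m + 1) : K⟦X⟧)), ← pochFin]
    have a2 : ∏ m ∈ Finset.range N, ((X : K⟦X⟧) ^ N - C x * X ^ (N + m)) =
        X ^ (N * N) * (C (1 - x) * pochFin x n) := by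
      have : ∀ m ∈ Finset.range N, ((X : K⟦X⟧) ^ N - C x * X ^ (N + m)) =
          X ^ N * (1 - C x * X ^ m) := by
        intro m _; ring
      rw [Finset.prod_congr rfl this, Finset.prod_mul_distrib, Finset.prod_const,
        Finset.card_range, ← pow_mul, hN, Finset.prod_range_succ', pochFin]
      simp [mul_comm]
    rw [a1, a2]; ring
  have hne : (X : K⟦X⟧) ^ (N.choose 2 + N * N) * (-C x) ^ N ≠ 0 := by
    refine mul_ne_zero (pow_ne_zero _ X_ne_zero) (pow_ne_zero _ (neg_ne_zero.mpr ?_))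
    intro h; rw [h, zero_mul] at hC; exact zero_ne_one hC
  apply mul_left_cancel₀ hne
  rw [← lhs, key, Finset.mul_sum]
  refine Finset.sum_congr rfl fun k hk => ?_
  have hk : k ≤ 2 * N := by have := Finset.mem_range.mp hk; omega
  have e1 : (-C x : K⟦X⟧) ^ N = C ((-x) ^ N) := by simp
  have e2 : (-1 : K⟦X⟧) ^ k * C x ^ k = C ((-x) ^ k) := by rw [← mul_pow]; simp
  have e3 : (-x) ^ k = (-x) ^ N * ((-1) ^ ((k : ℤ) - N) * x ^ ((k : ℤ) - N)) := by
    have hx' : -x ≠ 0 := neg_ne_zero.mpr hx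
    rw [← mul_zpow, neg_one_mul, ← zpow_natCast, ← zpow_natCast, ← zpow_add₀ hx']
    congr 1; ring
  have e4 : k.choose 2 + N * (2 * N - k) = N.choose 2 + N * N + triInt ((k : ℤ) - N) := by
    have t := two_mul_triInt ((k : ℤ) - N)
    have c1 : (2 : ℤ) * k.choose 2 = k * (k - 1) := by
      rw [Nat.choose_two_right]
      have := Nat.div_mul_cancel (Nat.even_mul_pred_self k).two_dvd
      rcases k with _ | k
      · simp
      · push_cast [← this] at *
        have : (k + 1) * k / 2 * 2 = (k + 1) * k := by simpa using this
        zify at this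
        simp
        linarith
    have c2 : (2 : ℤ) * N.choose 2 = N * (N - 1) := by
      rw [hN, Nat.choose_two_right]
      have := Nat.div_mul_cancel (Nat.even_mul_pred_self (n+1)).two_dvd
      have : (n + 1) * n / 2 * 2 = (n + 1) * n := by simpa using this
      zify at this
      push_cast
      simp
      linarith
    zify [hk]
    have : (2 : ℤ) * (k.choose 2 + N * (2 * N - k)) =
        2 * (N.choose 2 + N * N + triInt ((k : ℤ) - N)) := by
      rw [mul_add, c1, mul_add, mul_add, c2, t]; ring
    linarith
  have e5 : (-1 : K⟦X⟧) ^ k * X ^ k.choose 2 * gaussBinom K (2 * N) k * (X ^ N) ^ (2 * N - k) *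
      C x ^ k = ((-1 : K⟦X⟧) ^ k * C x ^ k) * X ^ (k.choose 2 + N * (2 * N - k)) *
        gaussBinom K (2 * N) k := by ring
  rw [e5, e2, e3, e4, e1, map_mul C ((-x) ^ N)]
  have e6 : (n : ℤ) + 1 = (N : ℤ) := by push_cast [hN]; rfl
  rw [e6]
  ring

/-- This linear bound is all that is needed of the quadratic growth: it gives finiteness of the
terms of bounded degree and offsets the loss of precision in the outer binomials. -/
lemma le_triInt_add_one (j : ℤ) : |j| ≤ triInt j + 1 := by
  have := two_mul_triInt j
  rcases le_or_gt j 0 with h | h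
  · rw [abs_of_nonpos h]; nlinarith
  · rw [abs_of_pos h]
    rcases lt_or_ge j 2 with h2 | h2
    · omega
    · nlinarith

/-- The terms of the theta series. -/
def thetaTerm (x : K) (j : ℤ) : K⟦X⟧ := C ((-1) ^ j * x ^ j) * X ^ triInt j

/-- The Jacobi triple product identity. -/
lemma hasSum_theta [TopologicalSpace K] [DiscreteTopology K] (x : K) (hx : x ≠ 0) :
    HasSum (thetaTerm x) (theta x) := by
  rw [WithPiTopology.hasSum_iff_hasSum_coeff]
  intro n
  have h1 : X ^ (n + 1) ∣ theta x -
      ∑ k ∈ Finset.range (2 * (n + 1) + 1),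
        C ((-1) ^ ((k : ℤ) - (n + 1)) * x ^ ((k : ℤ) - (n + 1))) *
          X ^ (triInt ((k : ℤ) - (n + 1))) := by
    have a1 : X ^ (n + 1) ∣ theta x -
        C (1 - x) * pochFin x n * pochFin x⁻¹ (n + 1) * poch 1 := by
      refine X_pow_dvd_mul_sub_mul (X_pow_dvd_mul_sub_mul (X_pow_dvd_mul_sub_mul ?_ ?_) ?_) ?_
      · simp
      · exact X_pow_dvd_poch_sub x le_rfl
      · exact X_pow_dvd_poch_sub x⁻¹ (Nat.le_succ n)
      · simp
    refine X_pow_dvd_sub_trans a1 ?_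
    rw [finite_triple_product x hx, Finset.sum_mul, ← Finset.sum_sub_distrib]
    refine Finset.dvd_sum fun k hk => ?_
    have hk := Finset.mem_range.mp hk
    rw [mul_assoc, ← mul_sub_one]
    have hj := le_triInt_add_one ((k : ℤ) - (n + 1))
    generalize triInt ((k : ℤ) - (n + 1)) = t at *
    -- `l` is the distance from `k` to the nearer end of the sum. The binomial is accurate modulo
    -- $p^{l+1}$ only, but the term carries $p^t$ with $t\ge|k-(n+1)|-1$, and $t+l+1\ge n+1$.
    obtain ⟨l, hl⟩ : ∃ l : ℕ, (l : ℤ) = n + 1 - |(k : ℤ) - (n + 1)| := by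
      refine ⟨(n + 1 - |(k : ℤ) - (n + 1)|).toNat, Int.toNat_of_nonneg ?_⟩
      have : |(k : ℤ) - (n + 1)| ≤ n + 1 := abs_le.mpr ⟨by omega, by omega⟩
      omega
    have l1 := le_abs_self ((k : ℤ) - (n + 1))
    have l2 := neg_abs_le ((k : ℤ) - (n + 1))
    have := X_pow_dvd_gaussBinom_mul_poch (K := K) (2 * (n + 1)) k l (by omega) (by omega)
      (by omega)
    have h3 := mul_dvd_mul (dvd_refl ((X : K⟦X⟧) ^ t)) this
    rw [← pow_add] at h3
    rw [mul_assoc]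
    exact ((pow_dvd_pow _ (by omega)).trans h3).mul_left _
  have h2 := X_pow_dvd_iff.mp h1 n (by omega)
  rw [map_sub, sub_eq_zero, map_sum] at h2
  rw [h2]
  have h3 := Finset.sum_image (f := fun j : ℤ => coeff n (C ((-1) ^ j * x ^ j) * X ^ triInt j))
    (s := Finset.range (2 * (n + 1) + 1)) (g := fun k : ℕ => (k : ℤ) - (n + 1))
    (fun a _ b _ h => by simpa using h)
  rw [← h3]
  refine hasSum_sum_of_ne_finset_zero fun j hj => ?_
  rw [thetaTerm, coeff_C_mul, coeff_X_pow, if_neg, mul_zero]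
  intro h
  apply hj
  have := le_triInt_add_one j
  have l1 := le_abs_self j
  have l2 := neg_abs_le j
  rw [Finset.mem_image]
  exact ⟨(j + (n + 1)).toNat, Finset.mem_range.mpr (by omega), by omega⟩

lemma summable_C_mul_X_pow [TopologicalSpace K] {ι : Type*} (c : ι → K)
    (w : ι → ℕ) (hw : ∀ d, {i | w i = d}.Finite) :
    Summable fun i => (C (c i) * X ^ w i : K⟦X⟧) := by
  rw [WithPiTopology.summable_iff_summable_coeff]
  intro d
  refine summable_of_hasFiniteSupport ((hw d).subset fun i hi => ?_)
  by_contra h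
  refine hi ?_
  simp only [coeff_C_mul, coeff_X_pow]
  rw [if_neg (fun e => h e.symm), mul_zero]

lemma summable_mul_C_mul_X_pow [TopologicalSpace K] {ι κ : Type*} (c : ι → K) (w : ι → ℕ)
    (c' : κ → K) (w' : κ → ℕ) (hw : ∀ d, {i | w i ≤ d}.Finite) (hw' : ∀ d, {i | w' i ≤ d}.Finite) :
    Summable fun t : ι × κ => (C (c t.1) * X ^ w t.1 * (C (c' t.2) * X ^ w' t.2) : K⟦X⟧) := by
  have : ∀ t : ι × κ, (C (c t.1) * X ^ w t.1 * (C (c' t.2) * X ^ w' t.2) : K⟦X⟧) =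
      C (c t.1 * c' t.2) * X ^ (w t.1 + w' t.2) := fun t => by rw [map_mul, pow_add]; ring
  simp_rw [this]
  refine summable_C_mul_X_pow _ _ fun d => ((hw d).prod (hw' d)).subset fun t ht => ?_
  have ht : w t.1 + w' t.2 = d := ht
  exact ⟨show w t.1 ≤ d by omega, show w' t.2 ≤ d by omega⟩

/-- The terms of `∑_k p^{k² - k} x^{2k}`. -/
def thetaEvenTerm (x : K) (k : ℤ) : K⟦X⟧ := C (x ^ (2 * k)) * X ^ (2 * triInt k)

/-- The terms of `∑_k p^{k²} x^{2k + 1}`. -/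
def thetaOddTerm (x : K) (k : ℤ) : K⟦X⟧ := C (x ^ (2 * k + 1)) * X ^ (k.natAbs ^ 2)

lemma finite_of_abs_le {s : Set ℤ} (d : ℤ) (h : ∀ k ∈ s, |k| ≤ d) : s.Finite :=
  (Set.finite_Icc (-d) d).subset fun k hk => abs_le.mp (h k hk)

lemma finite_triInt_le (d : ℕ) : {k | triInt k ≤ d}.Finite :=
  finite_of_abs_le (d + 1) fun k hk => by
    have := le_triInt_add_one k
    have hk : triInt k ≤ d := hk
    omega

lemma finite_two_mul_triInt_le (d : ℕ) : {k | 2 * triInt k ≤ d}.Finite :=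
  (finite_triInt_le d).subset fun k hk => by
    have hk : 2 * triInt k ≤ d := hk
    exact show triInt k ≤ d by omega

lemma finite_natAbs_sq_le (d : ℕ) : {k : ℤ | k.natAbs ^ 2 ≤ d}.Finite :=
  finite_of_abs_le d fun k hk => by
    have hk : k.natAbs ^ 2 ≤ d := hk
    have : k.natAbs ≤ k.natAbs ^ 2 := Nat.le_self_pow two_ne_zero _
    rw [Int.abs_eq_natAbs]
    omega

lemma summable_thetaEvenTerm [TopologicalSpace K] (x : K) : Summable (thetaEvenTerm x) :=
  summable_C_mul_X_pow _ _ fun d => (finite_two_mul_triInt_le d).subset fun _ h => le_of_eq h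

lemma summable_thetaOddTerm [TopologicalSpace K] (x : K) : Summable (thetaOddTerm x) :=
  summable_C_mul_X_pow _ _ fun d => (finite_natAbs_sq_le d).subset fun _ h => le_of_eq h

lemma C_mul_thetaTerm_mul (x y : K) (hx : x ≠ 0) (hy : y ≠ 0) (m n : ℤ) :
    C y * (thetaTerm (x * y) m * thetaTerm (x * y⁻¹) n) =
      C ((-1) ^ (m + n) * x ^ (m + n) * y ^ (m - n + 1)) * X ^ (triInt m + triInt n) := by
  have : (-1) ^ (m + n) * x ^ (m + n) * y ^ (m - n + 1) =
      y * (((-1) ^ m * (x * y) ^ m) * ((-1) ^ n * (x * y⁻¹) ^ n)) := by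
    rw [zpow_add₀ (by norm_num), zpow_add₀ hx, zpow_add₀ hy, zpow_sub₀ hy, mul_zpow, mul_zpow,
      inv_zpow, zpow_one]
    field_simp
  rw [this, thetaTerm, thetaTerm, map_mul C y, map_mul C ((-1) ^ m * (x * y) ^ m), pow_add]
  ring

/-- For $m=k+l$, $n=k-l$ the exponent $\binom m2+\binom n2$ equals $k(k-1)+l^2$, so the term
separates into a function of $x,k$ and one of $y,l$. The odd case works alike. -/
lemma C_mul_thetaTerm_mul_even (x y : K) (hx : x ≠ 0) (hy : y ≠ 0) (k l : ℤ) :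
    C y * (thetaTerm (x * y) (k + l) * thetaTerm (x * y⁻¹) (k - l)) = thetaEvenTerm x k * thetaOddTerm y l := by
  rw [C_mul_thetaTerm_mul x y hx hy, thetaEvenTerm, thetaOddTerm]
  have a1 : k + l + (k - l) = 2 * k := by ring
  have a2 : k + l - (k - l) + 1 = 2 * l + 1 := by ring
  have a3 : triInt (k + l) + triInt (k - l) = 2 * triInt k + l.natAbs ^ 2 := by
    have t1 := two_mul_triInt (k + l)
    have t2 := two_mul_triInt (k - l)
    have t3 := two_mul_triInt k
    zify
    rw [sq_abs]
    linarith
  rw [a1, a2, a3, Even.neg_one_zpow (even_two_mul k), one_mul, map_mul, pow_add]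
  ring

lemma C_mul_thetaTerm_mul_odd (x y : K) (hx : x ≠ 0) (hy : y ≠ 0) (k l : ℤ) :
    C y * (thetaTerm (x * y) (k + l) * thetaTerm (x * y⁻¹) (k + 1 - l)) = -(thetaOddTerm x k * thetaEvenTerm y l) := by
  rw [C_mul_thetaTerm_mul x y hx hy, thetaEvenTerm, thetaOddTerm]
  have a1 : k + l + (k + 1 - l) = 2 * k + 1 := by ring
  have a2 : k + l - (k + 1 - l) + 1 = 2 * l := by ring
  have a3 : triInt (k + l) + triInt (k + 1 - l) = k.natAbs ^ 2 + 2 * triInt l := by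
    have t1 := two_mul_triInt (k + l)
    have t2 := two_mul_triInt (k + 1 - l)
    have t3 := two_mul_triInt l
    zify
    rw [sq_abs]
    linarith
  rw [a1, a2, a3, Odd.neg_one_zpow ⟨k, rfl⟩, neg_one_mul, neg_mul, map_neg, map_mul, pow_add]
  ring

lemma hasSum_int_prod_of_parity {A : Type*} [AddCommMonoid A] [TopologicalSpace A] [ContinuousAdd A]
    (F : ℤ × ℤ → A) {a b : A} (h₁ : HasSum (fun t : ℤ × ℤ => F (t.1 + t.2, t.1 - t.2)) a)
    (h₂ : HasSum (fun t : ℤ × ℤ => F (t.1 + t.2, t.1 + 1 - t.2)) b) : HasSum F (a + b) := by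
  let g₁ : ℤ × ℤ → ℤ × ℤ := fun t => (t.1 + t.2, t.1 - t.2)
  let g₂ : ℤ × ℤ → ℤ × ℤ := fun t => (t.1 + t.2, t.1 + 1 - t.2)
  have i₁ : Function.Injective g₁ := by
    rintro ⟨a, b⟩ ⟨c, d⟩ h
    simp only [g₁, Prod.mk.injEq] at h ⊢
    omega
  have i₂ : Function.Injective g₂ := by
    rintro ⟨a, b⟩ ⟨c, d⟩ h
    simp only [g₂, Prod.mk.injEq] at h ⊢
    omega
  have hc : IsCompl (Set.range g₁) (Set.range g₂) := by
    constructor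
    · rw [Set.disjoint_left]
      rintro _ ⟨⟨a, b⟩, rfl⟩ ⟨⟨c, d⟩, h⟩
      simp only [g₁, g₂, Prod.mk.injEq] at h
      omega
    · rw [codisjoint_iff_le_sup]
      rintro ⟨m, n⟩ -
      rcases Int.even_or_odd' (m + n) with ⟨k, hk | hk⟩
      · exact Or.inl ⟨(k, m - k), by simp only [g₁, Prod.mk.injEq]; omega⟩
      · exact Or.inr ⟨(k, m - k), by simp only [g₂, Prod.mk.injEq]; omega⟩
  exact HasSum.add_isCompl hc (i₁.hasSum_range_iff.mpr h₁) (i₂.hasSum_range_iff.mpr h₂)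

lemma hasSum_theta_mul_theta (x y : K) (hx : x ≠ 0) (hy : y ≠ 0) [TopologicalSpace K]
    [DiscreteTopology K] :
    HasSum (fun t : ℤ × ℤ => thetaTerm x t.1 * thetaTerm y t.2) (theta x * theta y) :=
  (hasSum_theta x hx).mul (hasSum_theta y hy)
    (summable_mul_C_mul_X_pow (fun j : ℤ => (-1) ^ j * x ^ j) triInt
      (fun j : ℤ => (-1) ^ j * y ^ j) triInt finite_triInt_le finite_triInt_le)

lemma hasSum_thetaEven_mul_thetaOdd (x y : K) [TopologicalSpace K] [DiscreteTopology K] :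
    HasSum (fun t : ℤ × ℤ => thetaEvenTerm x t.1 * thetaOddTerm y t.2)
      ((∑' k, thetaEvenTerm x k) * ∑' k, thetaOddTerm y k) :=
  (summable_thetaEvenTerm x).hasSum.mul (summable_thetaOddTerm y).hasSum
    (summable_mul_C_mul_X_pow (fun k : ℤ => x ^ (2 * k)) (fun k => 2 * triInt k)
      (fun k : ℤ => y ^ (2 * k + 1)) (fun k => k.natAbs ^ 2)
      finite_two_mul_triInt_le finite_natAbs_sq_le)

lemma hasSum_thetaOdd_mul_thetaEven (x y : K) [TopologicalSpace K] [DiscreteTopology K] :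
    HasSum (fun t : ℤ × ℤ => thetaOddTerm x t.1 * thetaEvenTerm y t.2)
      ((∑' k, thetaOddTerm x k) * ∑' k, thetaEvenTerm y k) :=
  (summable_thetaOddTerm x).hasSum.mul (summable_thetaEvenTerm y).hasSum
    (summable_mul_C_mul_X_pow (fun k : ℤ => x ^ (2 * k + 1)) (fun k => k.natAbs ^ 2)
      (fun k : ℤ => y ^ (2 * k)) (fun k => 2 * triInt k)
      finite_natAbs_sq_le finite_two_mul_triInt_le)

/-- Splitting the double series by the parity of $m+n$ exhibits the product as a $2\times2$ minor
formed from the even and odd series at $x$ and at $y$. -/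
lemma theta_mul_theta (x y : K) (hx : x ≠ 0) (hy : y ≠ 0) [TopologicalSpace K]
    [DiscreteTopology K] :
    C y * (theta (x * y) * theta (x * y⁻¹)) =
      (∑' k, thetaEvenTerm x k) * (∑' k, thetaOddTerm y k) -
      (∑' k, thetaOddTerm x k) * (∑' k, thetaEvenTerm y k) := by
  have h := (hasSum_theta_mul_theta (x * y) (x * y⁻¹) (mul_ne_zero hx hy)
    (mul_ne_zero hx (inv_ne_zero hy))).mul_left (C y)
  rw [sub_eq_add_neg]
  refine h.unique (hasSum_int_prod_of_parity _ ?_ ?_)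
  · simpa only [C_mul_thetaTerm_mul_even x y hx hy] using hasSum_thetaEven_mul_thetaOdd x y
  · simpa only [C_mul_thetaTerm_mul_odd x y hx hy] using (hasSum_thetaOdd_mul_thetaEven x y).neg

/-- The Weierstrass three-term identity for theta functions. -/
lemma theta_weierstrass (a s z : K) (ha : a ≠ 0) (hs : s ≠ 0) (hz : z ≠ 0) :
    C a * (theta (s * a) * theta (s * a⁻¹)) * (theta z * theta z⁻¹) +
      theta a ^ 2 * (theta (s * z) * theta (s * z⁻¹)) =
      theta s ^ 2 * (theta (a * z) * theta (a * z⁻¹)) := by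
  let _ : TopologicalSpace K := ⊥
  have _ : DiscreteTopology K := ⟨rfl⟩
  have h1 := theta_mul_theta s a hs ha
  have h2 := theta_mul_theta 1 z one_ne_zero hz
  have h3 := theta_mul_theta a 1 ha one_ne_zero
  have h4 := theta_mul_theta s z hs hz
  have h5 := theta_mul_theta s 1 hs one_ne_zero
  have h6 := theta_mul_theta a z ha hz
  simp only [one_mul, mul_one, inv_one, map_one] at h2 h3 h5
  have hC : (C z : K⟦X⟧) ≠ 0 := fun h => hz (by simpa using congrArg (coeff 0) h)
  -- All six products are now $2\times2$ minors of the (even, odd) vectors at $a,s,z,1$; the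
  -- identity is the Plücker relation between them.
  apply mul_left_cancel₀ hC
  calc _ = (C a * (theta (s * a) * theta (s * a⁻¹))) * (C z * (theta z * theta z⁻¹)) +
        (theta a * theta a) * (C z * (theta (s * z) * theta (s * z⁻¹))) := by ring
    _ = (theta s * theta s) * (C z * (theta (a * z) * theta (a * z⁻¹))) := by
      rw [h1, h2, h3, h4, h5, h6]; ring
    _ = _ := by ring

end Theta

/-! ### The theta identities behind unitarity, over an arbitrary field. -/

section RUnitary

open PowerSeries

variable {K : Type*} [Field K]

lemma constantCoeff_poch (x : K) : constantCoeff (poch x) = 1 := by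
  rw [← coeff_zero_eq_constantCoeff_apply, poch, coeff_mk]
  simp

lemma constantCoeff_theta (x : K) : constantCoeff (theta x) = 1 - x := by
  simp [theta, constantCoeff_poch]

lemma theta_inv (x : K) (hx : x ≠ 0) : theta x⁻¹ = C (-x⁻¹) * theta x := by
  have : (1 - x⁻¹ : K) = -x⁻¹ * (1 - x) := by field_simp; ring
  rw [theta, theta, inv_inv, this, map_mul C]
  ring

lemma theta_mul_inv_cancel (x : K) (hx : x ≠ 1) : theta x * (theta x)⁻¹ = 1 :=
  PowerSeries.mul_inv_cancel _ (by rw [constantCoeff_theta, sub_ne_zero]; exact hx.symm)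

lemma C_inv_eq (a : K) : (C a : K⟦X⟧)⁻¹ = C a⁻¹ := PowerSeries.C_inv a

/-- The function `b(z, s)` with `q`, `q²`, `q^{2s}` replaced by arbitrary elements. -/
def bGen (q a s z : K) : K⟦X⟧ :=
  C q * (theta (a * s) * theta (a⁻¹ * s) * theta z) * (theta s ^ 2 * theta (a * z))⁻¹

/-- The function `b̄(z)` with `q`, `q²` replaced by arbitrary elements. -/
def bbarGen (q a z : K) : K⟦X⟧ := C q * theta z * (theta (a * z))⁻¹

/-- The function `c(z, s)` with `q²`, `q^{2s}` replaced by arbitrary elements. -/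
def cGen (a s z : K) : K⟦X⟧ := theta a * theta (s * z) * (theta s * theta (a * z))⁻¹

/-- Puts $c(z,-s)$ over the same denominator as $c(z,s)$, as needed to add entries of one $2\times2$
block. -/
lemma cGen_inv (a s z : K) (hs : s ≠ 0) (hz : z ≠ 0) :
    cGen a s⁻¹ z = C z * theta a * theta (s * z⁻¹) * (theta s * theta (a * z))⁻¹ := by
  have h : s⁻¹ * z = (s * z⁻¹)⁻¹ := by rw [mul_inv, inv_inv]
  have hC : C z = (C (-(s * z⁻¹)⁻¹) * C (-s) : K⟦X⟧) := by
    rw [← map_mul]; congr 1; field_simp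
  rw [cGen, h, theta_inv _ (mul_ne_zero hs (inv_ne_zero hz)), theta_inv s hs, hC,
    PowerSeries.mul_inv_rev, PowerSeries.mul_inv_rev, PowerSeries.mul_inv_rev, C_inv_eq,
    show (-s⁻¹)⁻¹ = -s by rw [inv_neg, inv_inv]]
  ring

section

variable (q a s z : K) (hq : q ^ 2 = a) (ha : a ≠ 0) (hs : s ≠ 0) (hs1 : s ≠ 1) (hz : z ≠ 0)
  (h1 : a * z ≠ 1) (h2 : a * z⁻¹ ≠ 1)
include hz

include hs in
lemma bGen_mul_cGen_add :
    bGen q a s z * cGen a s⁻¹ z⁻¹ + cGen a s z * bGen q a s z⁻¹ = 0 := by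
  rw [cGen_inv a s _ hs (inv_ne_zero hz), inv_inv, bGen, bGen, cGen, theta_inv z hz]
  simp only [PowerSeries.mul_inv_rev, map_neg]
  ring

include hs in
lemma bbarGen_mul_cGen_add :
    bbarGen q a z * cGen a s z⁻¹ + cGen a s⁻¹ z * bbarGen q a z⁻¹ = 0 := by
  rw [cGen_inv a s _ hs hz, bbarGen, bbarGen, cGen, theta_inv z hz]
  have h : (C z * C (-z⁻¹) : K⟦X⟧) = -1 := by
    rw [← map_mul, mul_neg, mul_inv_cancel₀ hz, map_neg, map_one]
  simp only [PowerSeries.mul_inv_rev]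
  linear_combination (C q * theta z * theta a * theta (s * z⁻¹) * (theta (a * z⁻¹))⁻¹ *
    (theta s)⁻¹ * (theta (a * z))⁻¹) * h

include hq ha hs hs1 h1 h2 in
-- Over the common denominator this is `theta_weierstrass`; the two prefactors $q$ multiply to the
-- coefficient $a=q^2$ occurring there.
lemma bGen_mul_bbarGen_add :
    bGen q a s z * bbarGen q a z⁻¹ + cGen a s z * cGen a s z⁻¹ = 1 := by
  have w := theta_weierstrass a s z ha hs hz
  have i1 := theta_mul_inv_cancel _ hs1
  have i2 := theta_mul_inv_cancel _ h1
  have i3 := theta_mul_inv_cancel _ h2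
  have hC : (C q * C q : K⟦X⟧) = C a := by rw [← map_mul, ← sq, hq]
  rw [mul_comm s a, mul_comm s a⁻¹] at w
  calc _ = (C q * C q * (theta (a * s) * theta (a⁻¹ * s)) * (theta z * theta z⁻¹) +
        theta a ^ 2 * (theta (s * z) * theta (s * z⁻¹))) *
          ((theta s)⁻¹ ^ 2 * (theta (a * z))⁻¹ * (theta (a * z⁻¹))⁻¹) := by
        rw [bGen, bbarGen, cGen, cGen]
        simp only [PowerSeries.mul_inv_rev, sq]
        ring
    _ = (theta s * (theta s)⁻¹) ^ 2 * (theta (a * z) * (theta (a * z))⁻¹) *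
          (theta (a * z⁻¹) * (theta (a * z⁻¹))⁻¹) := by rw [hC, w]; ring
    _ = 1 := by rw [i1, i2, i3]; simp

include hq ha hs hs1 h1 h2 in
-- Reduces to the previous identity, because $c(z,s)c(1/z,s)$ is even in $s$ and the product of $b$
-- and $\bar b$ does not see which of them is evaluated at $1/z$.
lemma bbarGen_mul_bGen_add :
    bbarGen q a z * bGen q a s z⁻¹ + cGen a s⁻¹ z * cGen a s⁻¹ z⁻¹ = 1 := by
  have h : cGen a s⁻¹ z * cGen a s⁻¹ z⁻¹ = cGen a s z * cGen a s z⁻¹ := by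
    have hC : (C z * C z⁻¹ : K⟦X⟧) = 1 := by rw [← map_mul, mul_inv_cancel₀ hz, map_one]
    rw [cGen_inv a s _ hs (inv_ne_zero hz), cGen_inv a s z hs hz, inv_inv, cGen, cGen]
    linear_combination (theta a * theta (s * z⁻¹) * (theta s * theta (a * z))⁻¹ * theta a *
      theta (s * z) * (theta s * theta (a * z⁻¹))⁻¹) * hC
  rw [h, ← bGen_mul_bbarGen_add q a s z hq ha hs hs1 hz h1 h2, bGen, bGen, bbarGen, bbarGen]
  simp only [PowerSeries.mul_inv_rev]
  ring

end

end RUnitary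

/-! ### Unitarity of the matrices $R^\pm$ over Laurent series. -/

section RMat

open PowerSeries

variable {F : Type*} [Field F]

lemma zvar_ne_zero (e : Sgn) : zvar F e ≠ 0 := by
  rw [zvar, Ne, HahnSeries.single_eq_zero_iff]; exact one_ne_zero

lemma zvar_minus : zvar F .minus = (zvar F .plus)⁻¹ := by
  apply eq_inv_of_mul_eq_one_left
  simp [zvar, Sgn.toInt]

/-- Makes the constant coefficient of $\Theta_p(q^2z)$ nonzero in the Laurent series field, so that
its formal inverse is a true inverse. -/
lemma C_mul_zvar_ne_one (e : Sgn) (a : F) : HahnSeries.C a * zvar F e ≠ 1 := by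
  intro h
  have := congrArg (fun f : LaurentSeries F => f.coeff 0) h
  cases e <;> simp [zvar, Sgn.toInt, HahnSeries.coeff_single_of_ne] at this

variable [Algebra ℂ F]

lemma qc_add (ħ a b : ℂ) : qc ħ (a + b) = qc ħ a * qc ħ b := by
  rw [qc, mul_add, Complex.exp_add]; rfl

lemma qc_zero (ħ : ℂ) : qc ħ 0 = 1 := by simp [qc]

lemma qc_ne_zero (ħ a : ℂ) : qc ħ a ≠ 0 := Complex.exp_ne_zero _

lemma qc_neg (ħ a : ℂ) : qc ħ (-a) = (qc ħ a)⁻¹ :=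
  eq_inv_of_mul_eq_one_left (by rw [← qc_add, neg_add_cancel, qc_zero])

lemma cst_mul (a b : ℂ) : cst F (a * b) = cst F a * cst F b := by simp [cst]

lemma cst_one : cst F 1 = 1 := by simp [cst]

lemma cst_inv (a : ℂ) : cst F a⁻¹ = (cst F a)⁻¹ := by
  by_cases h : a = 0
  · simp [h, cst]
  · exact eq_inv_of_mul_eq_one_left (by rw [← cst_mul, inv_mul_cancel₀ h, cst_one])

lemma cst_ne_zero {a : ℂ} (h : a ≠ 0) : cst F a ≠ 0 := by
  intro h0
  have := cst_mul (F := F) a a⁻¹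
  rw [mul_inv_cancel₀ h, h0, zero_mul, cst_one] at this
  exact one_ne_zero this

lemma bfun_eq (ħ : ℂ) (e : Sgn) (S : F) :
    bfun ħ e S = bGen (cst F (qc ħ 1)) (cst F (qc ħ 2)) (HahnSeries.C S) (zvar F e) := by
  rw [bfun, bGen, qc_neg, cst_inv]

lemma bbar_eq (ħ : ℂ) (e : Sgn) :
    bbar F ħ e = bbarGen (cst F (qc ħ 1)) (cst F (qc ħ 2)) (zvar F e) := rfl

lemma cfun_eq (ħ : ℂ) (e : Sgn) (S : F) :
    cfun ħ e S = cGen (cst F (qc ħ 2)) (HahnSeries.C S) (zvar F e) := rfl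

lemma cst_qc_one_sq (ħ : ℂ) : cst F (qc ħ 1) ^ 2 = cst F (qc ħ 2) := by
  rw [sq, ← cst_mul, ← qc_add]; norm_num

section

variable (ħ : ℂ) (S : F) (hS : S ≠ 0) (hS1 : S ≠ 1)
include hS

lemma bfun_mul_cfun_add :
    bfun ħ .minus S * cfun ħ .plus S⁻¹ + cfun ħ .minus S * bfun ħ .plus S = 0 := by
  have hz : zvar F .plus = (zvar F .minus)⁻¹ := by rw [zvar_minus, inv_inv]
  simp only [bfun_eq, cfun_eq, map_inv₀]
  rw [hz]
  exact bGen_mul_cGen_add _ _ _ _ (by simpa using hS) (zvar_ne_zero _)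

lemma bbar_mul_cfun_add :
    bbar F ħ .minus * cfun ħ .plus S + cfun ħ .minus S⁻¹ * bbar F ħ .plus = 0 := by
  have hz : zvar F .plus = (zvar F .minus)⁻¹ := by rw [zvar_minus, inv_inv]
  simp only [bbar_eq, cfun_eq, map_inv₀]
  rw [hz]
  exact bbarGen_mul_cGen_add _ _ _ _ (by simpa using hS) (zvar_ne_zero _)

include hS1

lemma bfun_mul_bbar_add :
    bfun ħ .minus S * bbar F ħ .plus + cfun ħ .minus S * cfun ħ .plus S = 1 := by
  have hz : zvar F .plus = (zvar F .minus)⁻¹ := by rw [zvar_minus, inv_inv]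
  have h1 : (HahnSeries.C S : LaurentSeries F) ≠ 1 := fun h =>
    hS1 (HahnSeries.C_injective (by simpa using h))
  simp only [bfun_eq, bbar_eq, cfun_eq]
  rw [hz]
  exact bGen_mul_bbarGen_add _ _ _ _ (cst_qc_one_sq ħ) (cst_ne_zero (qc_ne_zero _ _))
    (by simpa using hS) h1 (zvar_ne_zero _) (C_mul_zvar_ne_one _ _)
    (by rw [← hz]; exact C_mul_zvar_ne_one _ _)

lemma bbar_mul_bfun_add :
    bbar F ħ .minus * bfun ħ .plus S + cfun ħ .minus S⁻¹ * cfun ħ .plus S⁻¹ = 1 := by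
  have hz : zvar F .plus = (zvar F .minus)⁻¹ := by rw [zvar_minus, inv_inv]
  have h1 : (HahnSeries.C S : LaurentSeries F) ≠ 1 := fun h =>
    hS1 (HahnSeries.C_injective (by simpa using h))
  simp only [bfun_eq, bbar_eq, cfun_eq, map_inv₀]
  rw [hz]
  exact bbarGen_mul_bGen_add _ _ _ _ (cst_qc_one_sq ħ) (cst_ne_zero (qc_ne_zero _ _))
    (by simpa using hS) h1 (zvar_ne_zero _) (C_mul_zvar_ne_one _ _)
    (by rw [← hz]; exact C_mul_zvar_ne_one _ _)

end

open PowerSeries.WithPiTopology in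
lemma constantCoeff_qProd (r : ℂ) : constantCoeff (qProd r) = 1 := by
  rw [qProd]
  -- A product that does not converge is 1 by convention, so the constant coefficient is 1 in both
  -- cases.
  by_cases h : Multipliable fun n : ℕ => (1 - C (r ^ n) * X : ℂ⟦X⟧)
  · rw [h.map_tprod (constantCoeff (R := ℂ)) (continuous_constantCoeff ℂ)]
    simp
  · rw [tprod_eq_one_of_not_multipliable h]
    simp

lemma constantCoeff_dpoch {K : Type*} [Field K] [Algebra ℂ K] (r : ℂ) (x : K) :
    constantCoeff (dpoch r x) = 1 := by
  rw [← coeff_zero_eq_constantCoeff_apply, dpoch, coeff_mk]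
  simp

lemma coeff_zero_dpochVar (r a : ℂ) :
    (constantCoeff (dpochVar (F := F) r a)).coeff 0 = 1 := by
  rw [dpochVar, map_mul, constantCoeff_dpoch, mul_one, constantCoeff_C]
  have := HahnSeries.ofPowerSeries_apply_coeff (Γ := ℤ)
    (PowerSeries.map (algebraMap ℂ F) (rescale a (qProd r))) 0
  simp only [Nat.cast_zero] at this
  rw [this]
  simp [constantCoeff_qProd]

lemma constantCoeff_dpochVar_ne_zero (r a : ℂ) :
    constantCoeff (dpochVar (F := F) r a) ≠ 0 := by
  intro h
  have := coeff_zero_dpochVar (F := F) r a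
  rw [h] at this
  simp at this

lemma mul_inv_mul_mul_inv {K : Type*} [Field K] (c d A B : K⟦X⟧) (h : c * d = 1)
    (hA : constantCoeff A ≠ 0) (hB : constantCoeff B ≠ 0) : (c * A * B⁻¹) * (d * B * A⁻¹) = 1 := by
  calc _ = (c * d) * (A * A⁻¹) * (B * B⁻¹) := by ring
    _ = 1 := by rw [h, PowerSeries.mul_inv_cancel _ hA, PowerSeries.mul_inv_cancel _ hB]; simp

/-- In $\rho^-$ the variable is $z=t^{-1}$, in $\rho^+$ it is $z=t$. With these arguments the
numerator of each is the denominator of the other, and the constants are inverse. -/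
lemma rho_minus_mul_rho_plus (ħ : ℂ) (N : ℕ) : rho F ħ N .minus * rho F ħ N .plus = 1 := by
  simp only [rho]
  rw [zvar_minus]
  set z := (zvar F .plus)⁻¹
  set r := qc ħ (2 * N)
  have e1 : dpochVar r (qc ħ 2) * dpochVar r (qc ħ (2 * N - 2)) *
        dpoch r z * dpoch r (cst F (qc ħ (2 * N)) * z) = 
      dpoch r z * dpoch r (cst F (qc ħ (2 * N)) * z) *
        dpochVar r (qc ħ 2) * dpochVar r (qc ħ (2 * N - 2)) := by ring
  have e2 : dpochVar r 1 * dpochVar r (qc ħ (2 * N)) *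
        dpoch r (cst F (qc ħ 2) * z) * dpoch r (cst F (qc ħ (2 * N - 2)) * z) =
      dpoch r (cst F (qc ħ 2) * z) * dpoch r (cst F (qc ħ (2 * N - 2)) * z) *
        dpochVar r 1 * dpochVar r (qc ħ (2 * N)) := by ring
  rw [e1, e2]
  refine mul_inv_mul_mul_inv _ _ _ _ ?_ ?_ ?_
  · rw [← map_mul, ← cst_mul, ← qc_add, add_neg_cancel, qc_zero, cst_one, map_one]
  · simp [constantCoeff_dpoch, constantCoeff_dpochVar_ne_zero]
  · simp [constantCoeff_dpoch, constantCoeff_dpochVar_ne_zero]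

/-- The matrix `R^±(z, s)` over `F((t))[[p]]`, where `t = z^{±1}`. -/
def Rmat {N : ℕ} (ħ : ℂ) (e : Sgn) (S : Fin N → Fin N → F) :
    Matrix (Fin N × Fin N) (Fin N × Fin N) (LaurentSeries F)⟦X⟧ :=
  fun a b => rho F ħ N e * RbarEntry ħ e S a.1 a.2 b.1 b.2

/-- Reindexing by `Prod.swap` is the passage from $R^+$ to $R^+_{21}$, and both matrices live over
Laurent series in the same $t$, so the product is $R^-(z)R^+_{21}(1/z)$. Weight preservation splits
it into $1\times1$ blocks for $i=j$ and $2\times2$ blocks for $\{i,j\}$; the four identities for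
$b,\bar b,c$ settle the latter. -/
lemma Rmat_unitarity {N : ℕ} (ħ : ℂ) (S : Fin N → Fin N → F)
    (hS : ∀ i j, i < j → S i j ≠ 0 ∧ S i j ≠ 1) :
    Rmat ħ .minus S * (Rmat ħ .plus S).submatrix Prod.swap Prod.swap = 1 := by
  ext1 ⟨i, j⟩ ⟨k, l⟩
  rw [Matrix.mul_apply, Fintype.sum_prod_type]
  simp only [Matrix.submatrix_apply, Prod.swap_prod_mk, Rmat]
  have : ∀ i' j' : Fin N, rho F ħ N .minus * RbarEntry ħ .minus S i j i' j' *
      (rho F ħ N .plus * RbarEntry ħ .plus S j' i' l k) =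
      RbarEntry ħ .minus S i j i' j' * RbarEntry ħ .plus S j' i' l k := by
    intro i' j'
    linear_combination (RbarEntry ħ .minus S i j i' j' * RbarEntry ħ .plus S j' i' l k) *
      rho_minus_mul_rho_plus (F := F) ħ N
  simp only [this]
  by_cases hij : i = j
  · subst hij
    rw [Finset.sum_eq_single i, Finset.sum_eq_single i]
    · simp only [RbarEntry, Matrix.one_apply, Prod.mk.injEq]
      by_cases h1 : i = k <;> by_cases h2 : i = l <;> simp [h1, h2, eq_comm]
    · intro b _ hb; simp [RbarEntry, hb]
    · simp
    · intro b _ hb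
      exact Finset.sum_eq_zero fun c _ => by simp [RbarEntry, hb]
    · simp
  · have hji : ¬ j = i := fun h => hij h.symm
    have key : ∑ i', ∑ j', RbarEntry ħ .minus S i j i' j' * RbarEntry ħ .plus S j' i' l k =
        RbarEntry ħ .minus S i j i j * RbarEntry ħ .plus S j i l k +
        RbarEntry ħ .minus S i j j i * RbarEntry ħ .plus S i j l k := by
      rw [← Fintype.sum_prod_type'
        (f := fun i' j' => RbarEntry ħ .minus S i j i' j' * RbarEntry ħ .plus S j' i' l k)]
      rw [Finset.sum_eq_add (i, j) (j, i)]
      · simp [hij]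
      · rintro ⟨c, d⟩ _ ⟨h1, h2⟩
        simp only [Ne, Prod.mk.injEq] at h1 h2
        simp only [RbarEntry, if_neg hij, if_neg h1, if_neg h2, zero_mul]
      · simp
      · simp
    rw [key]
    rcases lt_or_gt_of_ne hij with h | h
    · obtain ⟨s0, s1⟩ := hS i j h
      have hn : ¬ j < i := not_lt_of_gt h
      have f1 := bfun_mul_cfun_add ħ (S i j) s0
      have f2 := bfun_mul_bbar_add ħ (S i j) s0 s1
      by_cases h1 : k = i
      · by_cases h2 : l = j
        · subst h1 h2
          simp only [RbarEntry, hij, hji, h, hn, if_true, if_false, and_self, Matrix.one_apply]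
          exact f2
        · subst h1
          simp [RbarEntry, hij, hji, h2, Ne.symm h2]
      · by_cases h2 : k = j
        · by_cases h3 : l = i
          · subst h2 h3
            simp only [RbarEntry, hij, hji, h, hn, if_true, if_false, and_self, Matrix.one_apply,
              Prod.mk.injEq]
            exact f1
          · subst h2
            simp [RbarEntry, hij, hji, h3]
        · simp [RbarEntry, hij, hji, h1, h2, Ne.symm h1]
    · obtain ⟨s0, s1⟩ := hS j i h
      have hn : ¬ i < j := not_lt_of_gt h
      have f1 := bbar_mul_cfun_add ħ (S j i) s0
      have f2 := bbar_mul_bfun_add ħ (S j i) s0 s1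
      by_cases h1 : k = i
      · by_cases h2 : l = j
        · subst h1 h2
          simp only [RbarEntry, hij, hji, h, hn, if_true, if_false, and_self, Matrix.one_apply]
          exact f2
        · subst h1
          simp [RbarEntry, hij, hji, h2, Ne.symm h2]
      · by_cases h2 : k = j
        · by_cases h3 : l = i
          · subst h2 h3
            simp only [RbarEntry, hij, hji, h, hn, if_true, if_false, and_self, Matrix.one_apply,
              Prod.mk.injEq]
            exact f1
          · subst h2
            simp [RbarEntry, hij, hji, h3]
        · simp [RbarEntry, hij, hji, h1, h2, Ne.symm h1]

end RMat

/-! ### The substitution $t\mapsto p/t$ and quasi-periodicity of the $R$-matrix. -/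

section Flip

open PowerSeries

variable {F : Type*} [Field F]

/-- The substitution `u ↦ t`, `w ↦ p t⁻¹`, where `u` is the inner and `w` the outer variable. -/
def flipHom (F : Type*) [Field F] : F⟦X⟧⟦X⟧ →+* (LaurentSeries F)⟦X⟧ :=
  (rescale (HahnSeries.single (-1 : ℤ) (1 : F) : LaurentSeries F)).comp
    (PowerSeries.map (HahnSeries.ofPowerSeries ℤ F))

lemma single_neg_one_pow (k : ℕ) :
    (HahnSeries.single (-1 : ℤ) (1 : F) : LaurentSeries F) ^ k = HahnSeries.single (-k : ℤ) 1 := by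
  rw [HahnSeries.single_pow]; simp

lemma ofPowerSeries_coeff_of_neg (f : F⟦X⟧) (n : ℤ) (hn : n < 0) :
    (HahnSeries.ofPowerSeries ℤ F f).coeff n = 0 := by
  have := PowerSeries.coeff_coe f n
  rw [if_pos hn] at this
  exact this

lemma coeff_flipHom (A : F⟦X⟧⟦X⟧) (k : ℕ) (n : ℤ) :
    (coeff k (flipHom F A)).coeff n =
      (HahnSeries.ofPowerSeries ℤ F (coeff k A)).coeff (n + k) := by
  rw [flipHom, RingHom.comp_apply, coeff_rescale, single_neg_one_pow, coeff_map]
  have := HahnSeries.coeff_single_mul_add (r := (1 : F))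
    (x := HahnSeries.ofPowerSeries ℤ F (coeff k A)) (a := n + k) (b := (-k : ℤ))
  rw [one_mul] at this
  rw [← this]
  congr 1
  ring

/-- The exchange of the two variables of `F⟦u⟧⟦w⟧`. -/
def swapHom (F : Type*) [Field F] : F⟦X⟧⟦X⟧ →+* F⟦X⟧⟦X⟧ where
  toFun A := mk fun a => mk fun b => coeff a (coeff b A)
  map_one' := by
    ext a b
    simp only [coeff_mk, coeff_one]
    split_ifs <;> simp_all [coeff_one]
  map_zero' := by ext a b; simp
  map_add' A B := by ext a b; simp
  map_mul' A B := by
    ext a b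
    simp only [coeff_mk, coeff_mul, map_sum]
    exact Finset.sum_comm

lemma coeff_swapHom (A : F⟦X⟧⟦X⟧) (a b : ℕ) :
    coeff b (coeff a (swapHom F A)) = coeff a (coeff b A) := by
  simp [swapHom]

lemma swapHom_swapHom (A : F⟦X⟧⟦X⟧) : swapHom F (swapHom F A) = A := by
  ext a b
  rw [coeff_swapHom, coeff_swapHom]

/-- Two series which are images of the same element of `F⟦u⟧⟦w⟧`, the first one under
`u ↦ t`, `w ↦ p t⁻¹` and the second one under `u ↦ p t⁻¹`, `w ↦ t`. -/
def FlipPair (f g : (LaurentSeries F)⟦X⟧) : Prop :=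
  ∃ A : F⟦X⟧⟦X⟧, f = flipHom F A ∧ g = flipHom F (swapHom F A)

/-- The monomial $u^aw^k$ goes to $p^kt^{a-k}$, and after the exchange to $p^at^{k-a}$. The image is
therefore cut out by a support condition, and the exchange is a relabelling of coefficients. -/
lemma flipPair_iff (f g : (LaurentSeries F)⟦X⟧) : FlipPair f g ↔
    (∀ (k : ℕ) (n : ℤ), n + k < 0 → (coeff k f).coeff n = 0) ∧
    (∀ (k : ℕ) (n : ℤ), n + k < 0 → (coeff k g).coeff n = 0) ∧
    ∀ a k : ℕ, (coeff k f).coeff (a - k) = (coeff a g).coeff (k - a) := by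
  constructor
  · rintro ⟨A, rfl, rfl⟩
    refine ⟨fun k n h => ?_, fun k n h => ?_, fun a k => ?_⟩
    · rw [coeff_flipHom, ofPowerSeries_coeff_of_neg _ _ h]
    · rw [coeff_flipHom, ofPowerSeries_coeff_of_neg _ _ h]
    · rw [coeff_flipHom, coeff_flipHom, sub_add_cancel, sub_add_cancel,
        HahnSeries.ofPowerSeries_apply_coeff, HahnSeries.ofPowerSeries_apply_coeff, coeff_swapHom]
  · rintro ⟨h1, h2, h3⟩
    refine ⟨mk fun k => mk fun a => (coeff k f).coeff (a - k), ?_, ?_⟩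
    · ext k n
      rw [coeff_flipHom]
      rcases lt_or_ge (n + k) 0 with h | h
      · rw [ofPowerSeries_coeff_of_neg _ _ h, h1 k n h]
      · obtain ⟨a, ha⟩ := Int.eq_ofNat_of_zero_le h
        rw [ha, HahnSeries.ofPowerSeries_apply_coeff, coeff_mk, coeff_mk]
        congr 1; omega
    · ext k n
      rw [coeff_flipHom]
      rcases lt_or_ge (n + k) 0 with h | h
      · rw [ofPowerSeries_coeff_of_neg _ _ h, h2 k n h]
      · obtain ⟨a, ha⟩ := Int.eq_ofNat_of_zero_le h
        rw [ha, HahnSeries.ofPowerSeries_apply_coeff, coeff_swapHom, coeff_mk, coeff_mk, h3]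
        congr 1; omega

namespace FlipPair

variable {f g f' g' : (LaurentSeries F)⟦X⟧}

lemma symm (h : FlipPair f g) : FlipPair g f := by
  obtain ⟨A, rfl, rfl⟩ := h
  exact ⟨swapHom F A, rfl, by rw [swapHom_swapHom]⟩

lemma mul (h : FlipPair f g) (h' : FlipPair f' g') : FlipPair (f * f') (g * g') := by
  obtain ⟨A, rfl, rfl⟩ := h
  obtain ⟨B, rfl, rfl⟩ := h'
  exact ⟨A * B, by simp, by simp⟩

lemma one : FlipPair (1 : (LaurentSeries F)⟦X⟧) 1 := ⟨1, by simp, by simp⟩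

lemma zero : FlipPair (0 : (LaurentSeries F)⟦X⟧) 0 := ⟨0, by simp, by simp⟩

lemma prod {ι : Type*} (s : Finset ι) {f g : ι → (LaurentSeries F)⟦X⟧}
    (h : ∀ i, FlipPair (f i) (g i)) : FlipPair (∏ i ∈ s, f i) (∏ i ∈ s, g i) := by
  classical
  induction s using Finset.induction_on with
  | empty => simpa using one
  | insert i s hi ih =>
    rw [Finset.prod_insert hi, Finset.prod_insert hi]
    exact (h i).mul ih

lemma inv_eq_of_mul_eq_one {K : Type*} [Field K] {a b : K⟦X⟧} (h : a * b = 1) : a⁻¹ = b := by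
  have h0 : constantCoeff a ≠ 0 := by
    intro h0
    have := congrArg constantCoeff h
    simp [h0] at this
  rw [PowerSeries.inv_eq_iff_mul_eq_one h0, mul_comm, h]

/-- The nonvanishing coefficient is that of $u^0w^0$, so the common preimage is a unit of
$F[[u]][[w]]$ and both inverses come from its inverse. -/
lemma inv (h : FlipPair f g) (h0 : (constantCoeff f).coeff 0 ≠ 0) : FlipPair f⁻¹ g⁻¹ := by
  obtain ⟨A, rfl, rfl⟩ := h
  have hA : IsUnit A := by
    rw [PowerSeries.isUnit_iff_constantCoeff, PowerSeries.isUnit_iff_constantCoeff, isUnit_iff_ne_zero]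
    have h1 := coeff_flipHom A 0 0
    have h2 := HahnSeries.ofPowerSeries_apply_coeff (Γ := ℤ) (coeff 0 A) 0
    rw [Nat.cast_zero] at h1 h2
    rw [add_zero, h2] at h1
    simp only [coeff_zero_eq_constantCoeff_apply] at h1
    rwa [h1] at h0
  obtain ⟨B, hB⟩ := hA.exists_right_inv
  refine ⟨B, inv_eq_of_mul_eq_one ?_, inv_eq_of_mul_eq_one ?_⟩
  · rw [← map_mul, hB, map_one]
  · rw [← map_mul, ← map_mul, hB, map_one, map_one]

/-- By `flipPair_iff` only pairs of individual coefficients are compared, so the property passes to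
$p$-adic limits. This reduces infinite products to finite ones. -/
lemma of_approx (h : ∀ n, ∃ f' g', FlipPair f' g' ∧ X ^ n ∣ f - f' ∧ X ^ n ∣ g - g') :
    FlipPair f g := by
  have key : ∀ n, ∃ f' g', FlipPair f' g' ∧ (∀ k < n, coeff k f = coeff k f') ∧
      ∀ k < n, coeff k g = coeff k g' := by
    intro n
    obtain ⟨f', g', h1, h2, h3⟩ := h n
    refine ⟨f', g', h1, fun k hk => ?_, fun k hk => ?_⟩
    · simpa [sub_eq_zero] using X_pow_dvd_iff.mp h2 k hk
    · simpa [sub_eq_zero] using X_pow_dvd_iff.mp h3 k hk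
  rw [flipPair_iff]
  refine ⟨fun k n hn => ?_, fun k n hn => ?_, fun a k => ?_⟩
  · obtain ⟨f', g', h1, h2, h3⟩ := key (k + 1)
    rw [h2 k (by omega)]
    exact ((flipPair_iff _ _).mp h1).1 k n hn
  · obtain ⟨f', g', h1, h2, h3⟩ := key (k + 1)
    rw [h3 k (by omega)]
    exact ((flipPair_iff _ _).mp h1).2.1 k n hn
  · obtain ⟨f', g', h1, h2, h3⟩ := key (k + a + 1)
    rw [h2 k (by omega), h3 a (by omega)]
    exact ((flipPair_iff _ _).mp h1).2.2 a k

lemma map_C (f : F⟦X⟧) : FlipPair (PowerSeries.map (HahnSeries.C : F →+* LaurentSeries F) f)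
    (PowerSeries.map HahnSeries.C f) := by
  rw [flipPair_iff]
  have h1 : ∀ (k : ℕ) (n : ℤ), n + k < 0 →
      (coeff k (PowerSeries.map (HahnSeries.C : F →+* LaurentSeries F) f)).coeff n = 0 := by
    intro k n h
    rw [coeff_map, HahnSeries.C_apply, HahnSeries.coeff_single_of_ne (by omega)]
  refine ⟨h1, h1, fun a k => ?_⟩
  simp only [coeff_map, HahnSeries.C_apply]
  by_cases h : a = k
  · subst h; simp
  · rw [HahnSeries.coeff_single_of_ne (by omega), HahnSeries.coeff_single_of_ne (by omega)]

lemma C_C (a : F) : FlipPair (C (HahnSeries.C a : LaurentSeries F)) (C (HahnSeries.C a)) := by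
  have := map_C (C a)
  simpa using this

/-- Formally $g(t)=f(p/t)$, hence $g_{-n}=p^nf_n$ for the coefficients of powers of $t$; the two
exponents avoid dividing by $p$. -/
lemma shift_coeff (h : FlipPair f g) (n : ℤ) :
    X ^ n.toNat * mk (fun k => (coeff k f).coeff n) =
      X ^ (-n).toNat * mk (fun k => (coeff k g).coeff (-n)) := by
  obtain ⟨h1, h2, h3⟩ := (flipPair_iff _ _).mp h
  ext j
  rcases le_total 0 n with hn | hn
  · obtain ⟨m, rfl⟩ := Int.eq_ofNat_of_zero_le hn
    rw [show (-(m : ℤ)).toNat = 0 by omega, Int.toNat_natCast, coeff_X_pow_mul', pow_zero, one_mul,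
      coeff_mk]
    split_ifs with hj
    · rw [coeff_mk]
      have := h3 j (j - m)
      rw [show ((j : ℤ) - (j - m : ℕ)) = m by omega] at this
      rw [this]
      congr 1; omega
    · rw [coeff_mk, h2]; omega
  · obtain ⟨m, hm⟩ := Int.eq_ofNat_of_zero_le (neg_nonneg.mpr hn)
    obtain rfl : n = -m := by omega
    rw [show (-(m : ℤ)).toNat = 0 by omega, neg_neg, Int.toNat_natCast, pow_zero, one_mul,
      coeff_X_pow_mul', coeff_mk]
    split_ifs with hj
    · rw [coeff_mk]
      have := h3 (j - m) j
      rw [show (j : ℤ) - (j - m : ℕ) = m by omega] at this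
      rw [← this]
      congr 1; omega
    · rw [h1]; omega

end FlipPair

/-- The monomial `a t^i p^k`. -/
def tMon (a : F) (i : ℤ) (k : ℕ) : (LaurentSeries F)⟦X⟧ := C (HahnSeries.single i a) * X ^ k

lemma coeff_tMon (a : F) (i n : ℤ) (k l : ℕ) :
    (coeff l (tMon a i k)).coeff n = if l = k ∧ n = i then a else 0 := by
  rw [tMon, coeff_C_mul, coeff_X_pow]
  by_cases h : l = k
  · by_cases h' : n = i
    · simp [h, h']
    · simp [h, h', HahnSeries.coeff_single_of_ne h']
  · simp [h]

lemma flipPair_one_sub_tMon (a : F) (m : ℕ) :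
    FlipPair (1 - tMon a 1 m) (1 - tMon a (-1) (m + 1)) := by
  have h : FlipPair (tMon a 1 m) (tMon a (-1) (m + 1)) := by
    rw [flipPair_iff]
    refine ⟨fun k n h => ?_, fun k n h => ?_, fun b k => ?_⟩
    · rw [coeff_tMon, if_neg]; omega
    · rw [coeff_tMon, if_neg]; omega
    · rw [coeff_tMon, coeff_tMon]
      congr 1
      apply propext; omega
  obtain ⟨A, h1, h2⟩ := h
  exact ⟨1 - A, by simp [h1], by simp [h2]⟩

lemma flipPair_poch (a : F) :
    FlipPair (C (1 - HahnSeries.single (1 : ℤ) a) * poch (HahnSeries.single (1 : ℤ) a))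
      (poch (HahnSeries.single (-1 : ℤ) a)) := by
  refine FlipPair.of_approx fun n => ⟨C (1 - HahnSeries.single (1 : ℤ) a) *
    pochFin (HahnSeries.single (1 : ℤ) a) n, pochFin (HahnSeries.single (-1 : ℤ) a) (n + 1),
    ?_, ?_, ?_⟩
  · have h := FlipPair.prod (Finset.range (n + 1)) (flipPair_one_sub_tMon a)
    rw [Finset.prod_range_succ', mul_comm] at h
    have e : (1 - tMon a 1 0 : (LaurentSeries F)⟦X⟧) = C (1 - HahnSeries.single (1 : ℤ) a) := by
      simp [tMon]
    rw [e] at h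
    exact h
  · rw [← mul_sub]
    exact ((pow_dvd_pow _ (Nat.le_succ n)).trans (X_pow_dvd_poch_sub _ le_rfl)).mul_left _
  · exact (pow_dvd_pow _ (Nat.le_succ n)).trans (X_pow_dvd_poch_sub _ (Nat.le_succ n))

lemma single_inv (i : ℤ) (a : F) :
    (HahnSeries.single i a : LaurentSeries F)⁻¹ = HahnSeries.single (-i) a⁻¹ := by
  rw [HahnSeries.inv_single]

lemma poch_map {K K' : Type*} [Field K] [Field K'] (φ : K →+* K') (x : K) :
    poch (φ x) = PowerSeries.map φ (poch x) := by
  ext k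
  rw [coeff_map, poch, poch, coeff_mk, coeff_mk, ← coeff_map, map_prod (PowerSeries.map φ)]
  simp

lemma theta_map {K K' : Type*} [Field K] [Field K'] (φ : K →+* K') (x : K) :
    theta (φ x) = PowerSeries.map φ (theta x) := by
  have h1 := poch_map φ 1
  rw [map_one] at h1
  rw [theta, theta, ← map_inv₀, poch_map, poch_map, h1]
  simp

lemma flipPair_theta_C (a : F) :
    FlipPair (theta (HahnSeries.C a : LaurentSeries F)) (theta (HahnSeries.C a)) := by
  rw [theta_map]
  exact FlipPair.map_C _

/-- The substitution sends $\Theta_p(at)$ to $\Theta_p(ap/t)=\Theta_p(t/a)$: the two Pochhammer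
factors trade places. -/
lemma flipPair_theta (a : F) :
    FlipPair (theta (HahnSeries.single (1 : ℤ) a)) (theta (HahnSeries.single (1 : ℤ) a⁻¹)) := by
  have h1 := flipPair_poch a
  have h2 := (flipPair_poch a⁻¹).symm
  have h3 : FlipPair (poch (1 : LaurentSeries F)) (poch 1) := by
    have := poch_map (HahnSeries.C : F →+* LaurentSeries F) 1
    rw [map_one] at this
    rw [this]
    exact FlipPair.map_C _
  have h := (h1.mul h2).mul h3
  rw [theta, theta, single_inv, single_inv, inv_inv]
  convert h using 1
  ring

section Dpoch

variable [Algebra ℂ F]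

lemma algebraMap_laurentSeries (c : ℂ) :
    algebraMap ℂ (LaurentSeries F) c = HahnSeries.C (algebraMap ℂ F c) := by
  have h : algebraMap ℂ (PowerSeries F) c = PowerSeries.C (algebraMap ℂ F c) := by
    rw [PowerSeries.algebraMap_apply]
  rw [HahnSeries.algebraMap_apply', ← HahnSeries.ofPowerSeries_C]
  exact congrArg _ h

lemma coeff_qProdAt_single (r : ℂ) (i : ℤ) (a : F) (m k : ℕ) (n : ℤ) :
    (coeff k (qProdAt r (HahnSeries.single i a : LaurentSeries F) m)).coeff n =
      if m ∣ k ∧ n = (k / m : ℕ) * i then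
        algebraMap ℂ F (coeff (k / m) (qProd r)) * a ^ (k / m) else 0 := by
  rw [qProdAt, coeff_mk]
  by_cases h : m ∣ k
  · rw [if_pos h, HahnSeries.single_pow, algebraMap_laurentSeries, HahnSeries.C_mul_eq_smul,
      HahnSeries.coeff_smul, nsmul_eq_mul, smul_eq_mul]
    by_cases h' : n = (k / m : ℕ) * i
    · rw [if_pos ⟨h, h'⟩, h', HahnSeries.coeff_single_same]
    · rw [if_neg (fun h2 => h' h2.2), HahnSeries.coeff_single_of_ne h', mul_zero]
  · rw [if_neg h, if_neg (fun h2 => h h2.1), HahnSeries.coeff_zero]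

lemma flipPair_qProdAt (r : ℂ) (a : F) (m : ℕ) :
    FlipPair (qProdAt r (HahnSeries.single (1 : ℤ) a) (m + 1))
      (qProdAt r (HahnSeries.single (-1 : ℤ) a) (m + 2)) := by
  rw [flipPair_iff]
  simp only [coeff_qProdAt_single]
  refine ⟨fun k n h => if_neg ?_, fun k n h => if_neg ?_, fun b k => ?_⟩
  · rintro ⟨-, h2⟩
    have := Int.natCast_nonneg (k / (m + 1))
    omega
  · rintro ⟨⟨j, rfl⟩, h2⟩
    rw [Nat.mul_div_cancel_left _ (by omega)] at h2
    subst h2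
    push_cast at h
    nlinarith
  · by_cases h : ∃ j, k = (m + 1) * j ∧ b = (m + 2) * j
    · obtain ⟨j, rfl, rfl⟩ := h
      rw [Nat.mul_div_cancel_left _ (by omega), Nat.mul_div_cancel_left _ (by omega),
        if_pos ⟨dvd_mul_right _ _, by push_cast; ring⟩, if_pos ⟨dvd_mul_right _ _, by push_cast; ring⟩]
    · rw [if_neg, if_neg]
      · rintro ⟨⟨j, rfl⟩, h2⟩
        rw [Nat.mul_div_cancel_left _ (by omega)] at h2
        refine h ⟨j, ?_, rfl⟩
        zify; push_cast at h2; linarith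
      · rintro ⟨⟨j, rfl⟩, h2⟩
        rw [Nat.mul_div_cancel_left _ (by omega)] at h2
        refine h ⟨j, rfl, ?_⟩
        zify; push_cast at h2; linarith

lemma flipPair_qProd (r a : ℂ) :
    FlipPair (C (HahnSeries.ofPowerSeries ℤ F
      (PowerSeries.map (algebraMap ℂ F) (PowerSeries.rescale a (qProd r)))))
      (qProdAt r (HahnSeries.single (-1 : ℤ) (algebraMap ℂ F a)) 1) := by
  rw [flipPair_iff]
  simp only [coeff_qProdAt_single]
  refine ⟨fun k n h => ?_, fun k n h => if_neg ?_, fun b k => ?_⟩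
  · rw [coeff_C]
    split_ifs with hk
    · exact ofPowerSeries_coeff_of_neg _ _ (by omega)
    · rfl
  · rintro ⟨-, h2⟩
    rw [Nat.div_one] at h2; omega
  · rw [coeff_C]
    split_ifs with h1 h2 h2
    · subst h1
      rw [Nat.cast_zero, sub_zero, HahnSeries.ofPowerSeries_apply_coeff, coeff_map, coeff_rescale,
        map_mul, map_pow, Nat.div_one, mul_comm]
    · exact absurd ⟨one_dvd _, by rw [Nat.div_one]; omega⟩ h2
    · rw [Nat.div_one] at h2; omega
    · rfl

/-- The finite product `∏_{1 ≤ m ≤ n} (x p^m; r)_∞`. -/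
def dpochFin {K : Type*} [Field K] [Algebra ℂ K] (r : ℂ) (x : K) (n : ℕ) : K⟦X⟧ :=
  ∏ m ∈ Finset.range n, qProdAt r x (m + 1)

lemma X_pow_dvd_qProdAt_sub_one {K : Type*} [Field K] [Algebra ℂ K] (r : ℂ) (x : K) (m : ℕ) :
    X ^ m ∣ qProdAt r x m - 1 := by
  rw [X_pow_dvd_iff]
  intro k hk
  rw [map_sub, qProdAt, coeff_mk, coeff_one]
  by_cases h : k = 0
  · subst h
    simp [constantCoeff_qProd]
  · rw [if_neg h, if_neg (fun hd => h (Nat.eq_zero_of_dvd_of_lt hd hk)), sub_zero]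

lemma X_pow_dvd_dpoch_sub {K : Type*} [Field K] [Algebra ℂ K] (r : ℂ) (x : K) {k n : ℕ}
    (h : k ≤ n) : X ^ (k + 1) ∣ dpoch r x - dpochFin r x n := by
  have key : ∀ {k n : ℕ}, k ≤ n → X ^ (k + 1) ∣ dpochFin r x n - dpochFin r x k := by
    intro k n hk
    obtain ⟨d, rfl⟩ := Nat.exists_eq_add_of_le hk
    rw [dpochFin, Finset.prod_range_add, ← dpochFin,
      show ∀ a b : K⟦X⟧, a * b - a = a * (b - 1) by intros; ring]
    refine (X_pow_dvd_prod_sub_one _ _ _ fun i _ => ?_).mul_left _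
    exact (pow_dvd_pow _ (by omega)).trans (X_pow_dvd_qProdAt_sub_one r x (k + i + 1))
  rw [X_pow_dvd_iff]
  intro m hm
  have := X_pow_dvd_iff.mp (key (show m ≤ n by omega)) m (by omega)
  rw [map_sub, sub_eq_zero] at this ⊢
  rw [this, dpoch, coeff_mk, dpochFin]

/-- The substitution sends $(atp^m;r)_\infty$ to $(ap^{m+1}/t;r)_\infty$, so $\{at\}$ goes to
$\{pa/t\}$. The factor $m=0$, a power series in $t$ alone, matches the first factor on the other
side; hence the truncations of lengths $n$ and $n+1$. -/
lemma flipPair_dpochVar (r a : ℂ) :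
    FlipPair (dpochVar (F := F) r a) (dpoch r (cst F a * zvar F .minus)) := by
  have e : cst F a * zvar F .minus = HahnSeries.single (-1 : ℤ) (algebraMap ℂ F a) := by
    rw [cst, zvar, HahnSeries.C_mul_eq_smul]
    ext n
    simp [Sgn.toInt, HahnSeries.coeff_single, Algebra.smul_def]
  rw [e]
  refine FlipPair.of_approx fun n => ⟨C (HahnSeries.ofPowerSeries ℤ F
      (PowerSeries.map (algebraMap ℂ F) (PowerSeries.rescale a (qProd r)))) *
    dpochFin r (HahnSeries.single (1 : ℤ) (algebraMap ℂ F a)) n,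
    dpochFin r (HahnSeries.single (-1 : ℤ) (algebraMap ℂ F a)) (n + 1), ?_, ?_, ?_⟩
  · have h := (FlipPair.prod (Finset.range n) (flipPair_qProdAt r (algebraMap ℂ F a)))
    have h2 := (flipPair_qProd (F := F) r a).mul h
    rw [dpochFin, dpochFin, Finset.prod_range_succ', mul_comm (∏ k ∈ Finset.range n, _)]
    exact h2
  · rw [dpochVar, ← mul_sub]
    exact ((pow_dvd_pow _ (Nat.le_succ n)).trans (X_pow_dvd_dpoch_sub _ _ le_rfl)).mul_left _
  · exact (pow_dvd_pow _ (Nat.le_succ n)).trans (X_pow_dvd_dpoch_sub _ _ (Nat.le_succ n))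

/-- Each of the eight double products in $\rho^+$ is carried to the corresponding one in $\rho^-$,
so only the ratio $q^{-2(N-1)/N}$ of the prefactors remains. -/
lemma flipPair_rho (ħ : ℂ) (N : ℕ) :
    FlipPair (rho F ħ N .plus)
      (C (cst F (qc ħ (-(2 * ((N - 1) / N))))) * rho F ħ N .minus) := by
  simp only [rho]
  rw [← zvar_minus]
  have hD := fun a : ℂ => flipPair_dpochVar (F := F) (qc ħ (2 * N)) a
  have hD1 := hD 1
  rw [cst_one, one_mul] at hD1
  have hc := FlipPair.C_C (algebraMap ℂ F (qc ħ (-((N - 1) / N))))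
  have hnum := (((hD (qc ħ 2)).mul (hD (qc ħ (2 * N - 2)))).mul hD1.symm).mul
    (hD (qc ħ (2 * N))).symm
  have hden := ((hD1.mul (hD (qc ħ (2 * N)))).mul (hD (qc ħ 2)).symm).mul
    (hD (qc ħ (2 * N - 2))).symm
  have h0 : (constantCoeff (dpochVar (qc ħ (2 * N)) 1 * dpochVar (qc ħ (2 * N)) (qc ħ (2 * N)) *
      dpoch (qc ħ (2 * N)) (cst F (qc ħ 2) * zvar F .minus) *
      dpoch (qc ħ (2 * N)) (cst F (qc ħ (2 * N - 2)) * zvar F .minus))).coeff 0 ≠ 0 := by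
    have e : ∀ a, ∃ A : F⟦X⟧, constantCoeff A = 1 ∧
        constantCoeff (dpochVar (F := F) (qc ħ (2 * N)) a) = HahnSeries.ofPowerSeries ℤ F A := by
      intro a
      refine ⟨_, ?_, by rw [dpochVar, map_mul, constantCoeff_dpoch, mul_one, constantCoeff_C]⟩
      rw [← coeff_zero_eq_constantCoeff_apply, coeff_map, coeff_rescale]
      simp [constantCoeff_qProd]
    obtain ⟨A, hA, eA⟩ := e 1
    obtain ⟨B, hB, eB⟩ := e (qc ħ (2 * N))
    rw [map_mul, map_mul, map_mul, constantCoeff_dpoch, constantCoeff_dpoch, mul_one, mul_one, eA,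
      eB, ← map_mul]
    have := HahnSeries.ofPowerSeries_apply_coeff (Γ := ℤ) (A * B) 0
    rw [Nat.cast_zero] at this
    rw [this]
    simp [hA, hB]
  have h := (hc.mul hnum).mul (hden.inv h0)
  have e2 : cst F (qc ħ (-((N - 1) / N))) =
      cst F (qc ħ (-(2 * ((N - 1) / N)))) * cst F (qc ħ ((N - 1) / N)) := by
    rw [← cst_mul, ← qc_add]; congr 2; ring
  have e3 : (C (cst F (qc ħ (-(2 * ((N - 1) / N))))) * C (cst F (qc ħ ((N - 1) / N))) :
      (LaurentSeries F)⟦X⟧) = C (HahnSeries.C (algebraMap ℂ F (qc ħ (-((N - 1) / N))))) := by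
    rw [← map_mul, ← e2, cst]
  rw [← e3] at h
  convert h using 1
  · rw [e2, map_mul]
  · ring

end Dpoch

lemma theta_single_neg (x : F) (hx : x ≠ 0) : theta (HahnSeries.single (-1 : ℤ) x) =
    C (HahnSeries.single (-1 : ℤ) (-x)) * theta (HahnSeries.single (1 : ℤ) x⁻¹) := by
  have h := theta_inv (HahnSeries.single (1 : ℤ) x⁻¹ : LaurentSeries F)
    (by simpa [HahnSeries.single_eq_zero_iff] using hx)
  rwa [single_inv, inv_inv, ← HahnSeries.single_neg] at h

/-- From $\Theta_p(px)=-x^{-1}\Theta_p(x)$: the powers of $t$ cancel in the quotient and leave the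
constant $y/x$. -/
lemma flipPair_theta_mul_inv (x y : F) (hx : x ≠ 0) (hy : y ≠ 0) :
    FlipPair (theta (HahnSeries.single (1 : ℤ) x) * (theta (HahnSeries.single (1 : ℤ) y))⁻¹)
      (C (HahnSeries.C (y * x⁻¹)) * (theta (HahnSeries.single (-1 : ℤ) x) *
        (theta (HahnSeries.single (-1 : ℤ) y))⁻¹)) := by
  have h0 : (constantCoeff (theta (HahnSeries.single (1 : ℤ) y))).coeff 0 ≠ 0 := by
    rw [constantCoeff_theta]
    simp [HahnSeries.coeff_single_of_ne]
  have h := (flipPair_theta x).mul ((flipPair_theta y).inv h0)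
  have e : (C (HahnSeries.C (y * x⁻¹) : LaurentSeries F)) * C (HahnSeries.single (-1 : ℤ) (-x)) *
      C (HahnSeries.single (1 : ℤ) (-y)⁻¹) = 1 := by
    rw [← map_mul, ← map_mul, HahnSeries.C_apply, HahnSeries.single_mul_single,
      HahnSeries.single_mul_single]
    have : y * x⁻¹ * -x * (-y)⁻¹ = 1 := by field_simp
    rw [this]
    simp
  convert h using 1
  rw [theta_single_neg x hx, theta_single_neg y hy, PowerSeries.mul_inv_rev, C_inv_eq, single_inv,
    neg_neg]
  linear_combination (theta (HahnSeries.single (1 : ℤ) x⁻¹) *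
    (theta (HahnSeries.single (1 : ℤ) y⁻¹))⁻¹) * e

section REntry

lemma C_mul_zvar (a : F) (e : Sgn) : HahnSeries.C a * zvar F e = HahnSeries.single e.toInt a := by
  rw [zvar, HahnSeries.C_apply, HahnSeries.single_mul_single]
  simp

lemma flipPair_theta_C_inv (S : F) (hS1 : S ≠ 1) :
    FlipPair (theta (HahnSeries.C S : LaurentSeries F))⁻¹ (theta (HahnSeries.C S))⁻¹ := by
  refine (flipPair_theta_C S).inv ?_
  rw [constantCoeff_theta]
  simpa [sub_eq_zero] using hS1.symm

variable [Algebra ℂ F]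

lemma flipPair_bbar (ħ : ℂ) :
    FlipPair (bbar F ħ .plus) (C (cst F (qc ħ 2)) * bbar F ħ .minus) := by
  have h := flipPair_theta_mul_inv (1 : F) (algebraMap ℂ F (qc ħ 2)) one_ne_zero
    (by simpa using qc_ne_zero ħ 2)
  have h' := (FlipPair.C_C (algebraMap ℂ F (qc ħ 1))).mul h
  rw [inv_one, mul_one] at h'
  convert h' using 1
  · simp only [bbar, cst, C_mul_zvar]
    simp only [zvar, Sgn.toInt]
    ring
  · simp only [bbar, cst, C_mul_zvar]
    simp only [zvar, Sgn.toInt]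
    ring

lemma flipPair_bfun (ħ : ℂ) (S : F) (hS1 : S ≠ 1) :
    FlipPair (bfun ħ .plus S) (C (cst F (qc ħ 2)) * bfun ħ .minus S) := by
  have hi := flipPair_theta_C_inv S hS1
  have h' := (((flipPair_bbar (F := F) ħ).mul
    ((flipPair_theta_C (algebraMap ℂ F (qc ħ 2) * S)).mul
      (flipPair_theta_C (algebraMap ℂ F (qc ħ (-2)) * S)))).mul hi).mul hi
  have e : ∀ e, bfun ħ e S = bbar F ħ e * (theta (HahnSeries.C (algebraMap ℂ F (qc ħ 2) * S)) *
      theta (HahnSeries.C (algebraMap ℂ F (qc ħ (-2)) * S))) * (theta (HahnSeries.C S))⁻¹ *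
      (theta (HahnSeries.C S))⁻¹ := by
    intro e
    simp only [bfun, bbar, cst, map_mul, PowerSeries.mul_inv_rev, sq]
    ring
  rw [← e] at h'
  convert h' using 1
  rw [e]
  ring

lemma flipPair_cfun (ħ : ℂ) (S : F) (hS : S ≠ 0) (hS1 : S ≠ 1) :
    FlipPair (cfun ħ .plus S)
      (C (HahnSeries.C (algebraMap ℂ F (qc ħ 2) * S⁻¹)) * cfun ħ .minus S) := by
  have h := flipPair_theta_mul_inv S (algebraMap ℂ F (qc ħ 2)) hS (by simpa using qc_ne_zero ħ 2)
  have h' := ((flipPair_theta_C (algebraMap ℂ F (qc ħ 2))).mul h).mul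
    (flipPair_theta_C_inv S hS1)
  have e : ∀ e : Sgn, cfun ħ e S = theta (HahnSeries.C (algebraMap ℂ F (qc ħ 2))) *
      (theta (HahnSeries.single e.toInt S) *
        (theta (HahnSeries.single e.toInt (algebraMap ℂ F (qc ħ 2))))⁻¹) *
      (theta (HahnSeries.C S))⁻¹ := by
    intro e
    simp only [cfun, cst, C_mul_zvar, PowerSeries.mul_inv_rev]
    ring
  convert h' using 1
  · rw [e]; simp only [Sgn.toInt]
  · rw [e]; simp only [Sgn.toInt]; ring

/-- The factor of `R^-(z)` in its relation with `R^+(p z)`, where `Q_i = q^{2 s_i}`. -/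
def flipFactor {N : ℕ} (ħ : ℂ) (Q : Fin N → F) (i j i' : Fin N) : F :=
  algebraMap ℂ F (qc ħ (-(2 * ((if i = j then 1 else 0) - 1 / (N : ℂ))))) * (Q i' * (Q i)⁻¹)

/-- The scalar combines $q^{-2(N-1)/N}$ from $\rho$ with $q^2$ for each nonzero entry having $i\ne
j$; the entries exchanging $i$ and $j$ contribute the remaining ratio of the $Q$'s. `flipFactor`
writes all cases uniformly. -/
lemma flipPair_Rmat {N : ℕ} (ħ : ℂ) (Q : Fin N → F) (hQ : ∀ i, Q i ≠ 0)
    (hQ1 : ∀ i j, i ≠ j → Q i ≠ Q j) (i j i' j' : Fin N) :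
    FlipPair (Rmat ħ .plus (fun j l => Q j * (Q l)⁻¹) (i, j) (i', j'))
      (C (HahnSeries.C (flipFactor ħ Q i j i')) *
        Rmat ħ .minus (fun j l => Q j * (Q l)⁻¹) (i, j) (i', j')) := by
  have hN : (N : ℂ) ≠ 0 := Nat.cast_ne_zero.mpr (Nat.pos_iff_ne_zero.mp i.pos)
  have hr := flipPair_rho (F := F) ħ N
  have hone : ∀ i j : Fin N, i ≠ j → Q i * (Q j)⁻¹ ≠ 1 := fun i j h h1 =>
    hQ1 i j h (by rwa [mul_inv_eq_one₀ (hQ j)] at h1)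
  have hc : ∀ a b c : ℂ, a + b = c → algebraMap ℂ F (qc ħ a) * algebraMap ℂ F (qc ħ b) =
      algebraMap ℂ F (qc ħ c) := by
    rintro a b _ rfl
    rw [qc_add, map_mul]
  have key : ∀ x, FlipPair (RbarEntry ħ .plus (fun j l => Q j * (Q l)⁻¹) i j i' j')
      (C (HahnSeries.C x) * RbarEntry ħ .minus (fun j l => Q j * (Q l)⁻¹) i j i' j') →
      algebraMap ℂ F (qc ħ (-(2 * ((N - 1) / N)))) * x = flipFactor ħ Q i j i' →
      FlipPair (Rmat ħ .plus (fun j l => Q j * (Q l)⁻¹) (i, j) (i', j'))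
      (C (HahnSeries.C (flipFactor ħ Q i j i')) *
        Rmat ħ .minus (fun j l => Q j * (Q l)⁻¹) (i, j) (i', j')) := by
    intro x h hx
    have h' := hr.mul h
    rw [← hx]
    simp only [Rmat]
    convert h' using 1
    rw [cst, map_mul, map_mul]
    ring
  have hzero : RbarEntry ħ .plus (fun j l => Q j * (Q l)⁻¹) i j i' j' = 0 →
      RbarEntry ħ .minus (fun j l => Q j * (Q l)⁻¹) i j i' j' = 0 →
      FlipPair (Rmat ħ .plus (fun j l => Q j * (Q l)⁻¹) (i, j) (i', j'))
      (C (HahnSeries.C (flipFactor ħ Q i j i')) *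
        Rmat ħ .minus (fun j l => Q j * (Q l)⁻¹) (i, j) (i', j')) := by
    intro h1 h2
    simp only [Rmat, h1, h2, mul_zero]
    exact FlipPair.zero
  by_cases hij : i = j
  · subst hij
    by_cases h : i' = i ∧ j' = i
    · obtain ⟨rfl, rfl⟩ := h
      refine key 1 (by simpa [RbarEntry] using FlipPair.one) ?_
      rw [flipFactor, if_pos rfl, mul_inv_cancel₀ (hQ _), sub_div, div_self hN]
    · refine hzero ?_ ?_ <;> simp [RbarEntry, h]
  · by_cases h : i' = i ∧ j' = j
    · obtain ⟨rfl, rfl⟩ := h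
      refine key (algebraMap ℂ F (qc ħ 2)) ?_ ?_
      · simp only [RbarEntry, if_neg hij, and_self, if_true]
        split_ifs with hlt
        · exact flipPair_bfun ħ _ (hone _ _ hij)
        · exact flipPair_bbar ħ
      · rw [flipFactor, if_neg hij, mul_inv_cancel₀ (hQ _), mul_one]
        refine hc _ _ _ ?_
        field_simp
        ring
    · by_cases h2 : i' = j ∧ j' = i
      · obtain ⟨rfl, rfl⟩ := h2
        refine key (algebraMap ℂ F (qc ħ 2) * (Q j' * (Q i')⁻¹)⁻¹) ?_ ?_
        · have hs := flipPair_cfun ħ (Q j' * (Q i')⁻¹) (mul_ne_zero (hQ _) (inv_ne_zero (hQ _)))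
            (hone _ _ hij)
          have hinv : (Q i' * (Q j')⁻¹)⁻¹ = Q j' * (Q i')⁻¹ := by
            rw [mul_inv, inv_inv, mul_comm]
          simp only [RbarEntry, if_neg hij, if_neg h, and_self, if_true, hinv, ite_self]
          exact hs
        · rw [flipFactor, if_neg hij, mul_inv, inv_inv, ← mul_assoc, mul_comm (Q j')⁻¹]
          congr 1
          refine hc _ _ _ ?_
          field_simp
          ring
      · refine hzero ?_ ?_ <;> simp [RbarEntry, hij, h, h2]

lemma Rcoeff_eq {N : ℕ} (ħ : ℂ) (e : Sgn) (S : Fin N → Fin N → F) (i j i' j' : Fin N) (n : ℤ) :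
    Rcoeff ħ e S i j i' j' n =
      mk fun k => (coeff k (Rmat ħ e S (i, j) (i', j'))).coeff (e.toInt * n) := rfl

/-- The quasi-periodicity `R^+(p z) ~ R^-(z)`, in terms of the coefficients of `z^n`. -/
lemma Rcoeff_shift {N : ℕ} (ħ : ℂ) (Q : Fin N → F) (hQ : ∀ i, Q i ≠ 0)
    (hQ1 : ∀ i j, i ≠ j → Q i ≠ Q j) (i j i' j' : Fin N) (n : ℤ) :
    X ^ n.toNat * Rcoeff ħ .plus (fun j l => Q j * (Q l)⁻¹) i j i' j' n =
      X ^ (-n).toNat * (C (flipFactor ħ Q i j i') *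
        Rcoeff ħ .minus (fun j l => Q j * (Q l)⁻¹) i j i' j' n) := by
  have h := (flipPair_Rmat ħ Q hQ hQ1 i j i' j').shift_coeff n
  rw [Rcoeff_eq, Rcoeff_eq]
  convert h using 2
  · simp [Sgn.toInt]
  · ext k
    simp only [coeff_C_mul, coeff_mk, HahnSeries.C_mul_eq_smul, HahnSeries.coeff_smul, smul_eq_mul,
      Sgn.toInt, neg_mul, one_mul]

end REntry

end Flip

/-! ### The monomials $q^{a+h}$ and their translations. -/

section Qpow

variable {N : ℕ}

lemma qpow_mul (ħ a b : ℂ) (h k : H N) : qpow ħ a h * qpow ħ b k = qpow ħ (a + b) (h + k) := by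
  rw [qpow, qpow, qpow, ← map_mul]
  congr 1
  apply Subtype.ext
  funext μ
  change Complex.exp (ħ * (a + h μ)) * Complex.exp (ħ * (b + k μ)) =
    Complex.exp (ħ * (a + b + (h μ + k μ)))
  rw [← Complex.exp_add]
  congr 1; ring

lemma qpow_const (ħ a : ℂ) : qpow (N := N) ħ a 0 = algebraMap ℂ (MerField N) (qc ħ a) := by
  rw [IsScalarTower.algebraMap_apply ℂ (Entire N) (MerField N), qpow]
  congr 1
  apply Subtype.ext
  funext μ
  change Complex.exp (ħ * (a + 0)) = qc ħ a
  rw [add_zero, qc]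

lemma qpow_zero_zero (ħ : ℂ) : qpow (N := N) ħ 0 0 = 1 := by
  rw [qpow_const, qc_zero, map_one]

lemma qpow_ne_zero (ħ a : ℂ) (h : H N) : qpow ħ a h ≠ 0 := by
  intro h0
  have := qpow_mul ħ a (-a) h (-h)
  have e : h + -h = 0 := add_neg_cancel h
  rw [add_neg_cancel, e, qpow_zero_zero, h0, zero_mul] at this
  exact zero_ne_one this

lemma qpow_inv (ħ a : ℂ) (h : H N) : (qpow ħ a h)⁻¹ = qpow ħ (-a) (-h) :=
  inv_eq_of_mul_eq_one_right (by
    have e : h + -h = 0 := add_neg_cancel h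
    rw [qpow_mul, add_neg_cancel, e, qpow_zero_zero])

lemma qpow_pow (ħ a : ℂ) (h : H N) (n : ℕ) : qpow ħ a h ^ n = qpow ħ (n * a) ((n : ℂ) • h) := by
  induction n with
  | zero =>
    have e : ((0 : ℕ) : ℂ) • h = 0 := by rw [Nat.cast_zero]; exact zero_smul ℂ h
    rw [e, pow_zero, Nat.cast_zero, zero_mul, qpow_zero_zero]
  | succ n ih =>
    rw [pow_succ, ih, qpow_mul]
    congr 1
    · push_cast; ring
    · push_cast; module

lemma shift_qpow (ħ a : ℂ) (h : H N) (v : HStar N) :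
    shift v (qpow ħ a h) = qpow ħ (a + h v) h := by
  rw [shift, qpow, IsFractionRing.ringEquivOfRingEquiv_algebraMap, qpow]
  congr 1
  apply Subtype.ext
  funext μ
  change Complex.exp (ħ * (a + h (μ + v))) = Complex.exp (ħ * (a + h v + h μ))
  rw [map_add]
  congr 1; ring

lemma shift_shift_neg (v : HStar N) (f : MerField N) : shift (-v) (shift v f) = f := by
  have h : ∀ g : Entire N, entireShift (-v) (entireShift v g) = g := by
    intro g
    apply Subtype.ext
    funext μ
    change g.1 (μ + -v + v) = g.1 μ
    rw [neg_add_cancel_right]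
  obtain ⟨x, y, hy, rfl⟩ := IsFractionRing.div_surjective (A := Entire N) f
  simp only [shift, map_div₀, IsFractionRing.ringEquivOfRingEquiv_algebraMap, h]

@[simp] lemma Ph_apply (j : Fin N) (v : HStar N) : Ph j v = v.1.1 j := rfl

@[simp] lemma Pd_apply (j : Fin N) (v : HStar N) : Pd j v = v.2.1.1 j := rfl

@[simp] lemma cc_apply (v : HStar N) : cc N v = v.2.2 := rfl

lemma epsBar_apply (i k : Fin N) : (epsBar i).1 k = (if k = i then 1 else 0) - 1 / (N : ℂ) := rfl

lemma sum_Ph : ∑ j : Fin N, Ph j = (0 : H N) :=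
  ContinuousLinearMap.ext fun v =>
    (map_sum (AddMonoidHom.mk' (fun h : H N => h v) fun _ _ => rfl) _ _).trans v.1.2

lemma sum_Pd : ∑ j : Fin N, Pd j = (0 : H N) :=
  ContinuousLinearMap.ext fun v =>
    (map_sum (AddMonoidHom.mk' (fun h : H N => h v) fun _ _ => rfl) _ _).trans v.2.1.2

lemma qpow_injective {ħ : ℂ} {h k : H N} (hq : qpow ħ 0 h = qpow ħ 0 k) (v : HStar N) :
    Complex.exp (ħ * h v) = Complex.exp (ħ * k v) := by
  have := congrArg Subtype.val (IsFractionRing.injective (Entire N) (MerField N) hq)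
  have := congrFun this v
  simpa using this

lemma exp_ne_of_sub_eq_one {x y : ℂ} (h : x - y = 1) : Complex.exp x ≠ Complex.exp y := by
  intro he
  have h1 : Complex.exp 1 = 1 := by
    conv_lhs => rw [← h]
    rw [Complex.exp_sub, he, div_self (Complex.exp_ne_zero _)]
  have h2 := congrArg Complex.re h1
  rw [← Complex.ofReal_one, Complex.exp_ofReal_re, Complex.ofReal_re] at h2
  have := Real.add_one_lt_exp (one_ne_zero)
  linarith

lemma qpow_Ph_ne {ħ : ℂ} (hħ : ħ ≠ 0) {i j : Fin N} (h : i ≠ j) :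
    qpow ħ 0 ((2 : ℂ) • Ph i) ≠ qpow ħ 0 ((2 : ℂ) • Ph j) := by
  intro hq
  -- At this point the two exponents differ by exactly 1, and $e\ne1$.
  refine exp_ne_of_sub_eq_one ?_ (qpow_injective hq ((1 / (2 * ħ)) • epsBar i, 0, 0))
  simp [epsBar_apply, h.symm]
  field_simp
  ring

lemma qpow_Pd_ne {ħ : ℂ} (hħ : ħ ≠ 0) {i j : Fin N} (h : i ≠ j) :
    qpow ħ 0 ((2 : ℂ) • Pd i) ≠ qpow ħ 0 ((2 : ℂ) • Pd j) := by
  intro hq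
  refine exp_ne_of_sub_eq_one ?_ (qpow_injective hq (0, (1 / (2 * ħ)) • epsBar i, 0))
  simp [epsBar_apply, h.symm]
  field_simp
  ring

lemma qpow_two_smul_sub (ħ : ℂ) (h k : H N) :
    qpow ħ 0 ((2 : ℂ) • (h - k)) = qpow ħ 0 ((2 : ℂ) • h) * (qpow ħ 0 ((2 : ℂ) • k))⁻¹ := by
  rw [qpow_inv, qpow_mul]
  congr 1
  · simp
  · module

end Qpow

/-! ### Diagonal entries of $\theta_V$ and $T_V$, by summation by parts. -/

section Gauge

variable {N : ℕ}

/-- Summation against $\pi_V(h_k)$ is a discrete derivative. The vanishing of `G` at both ends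
stands in for the indices missing from $1\le k\le N-1$. -/
lemma sum_piH_smul {M : Type*} [AddCommGroup M] [Module ℂ M] (G : ℕ → M) (h0 : G 0 = 0)
    (hN : G N = 0) (i : Fin N) :
    ∑ k : Fin (N - 1), piH k i • G (k + 1) = G (i + 1) - G i := by
  have hi := i.2
  simp only [piH]
  rw [Fin.sum_univ_eq_sum_range
    (fun k => ((if (i : ℕ) = k then (1 : ℂ) else 0) - (if (i : ℕ) = k + 1 then 1 else 0)) • G (k + 1))]
  simp only [sub_smul, ite_smul, one_smul, zero_smul, Finset.sum_sub_distrib]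
  congr 1
  · rw [Finset.sum_ite_eq]
    split_ifs with h
    · rfl
    · have : (i : ℕ) + 1 = N := by rw [Finset.mem_range] at h; omega
      rw [this, hN]
  · obtain h | ⟨m, hm⟩ : (i : ℕ) = 0 ∨ ∃ m, (i : ℕ) = m + 1 := by
      cases h : (i : ℕ) <;> simp
    · rw [h, h0]
      exact Finset.sum_eq_zero fun k _ => if_neg (by omega)
    · rw [hm]
      simp only [Nat.add_right_cancel_iff, Finset.sum_ite_eq]
      rw [if_pos (Finset.mem_range.mpr (by omega))]

/-- The partial sums of a family indexed by `Fin N`. -/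
def partialSum {M : Type*} [AddCommGroup M] (g : Fin N → M) (n : ℕ) : M :=
  ∑ l : Fin N, if (l : ℕ) < n then g l else 0

lemma sum_piH_smul_partialSum {M : Type*} [AddCommGroup M] [Module ℂ M] (g : Fin N → M)
    (hg : ∑ l, g l = 0) (i : Fin N) :
    ∑ k : Fin (N - 1), piH k i • partialSum g (k + 1) = g i := by
  rw [sum_piH_smul (partialSum g) (by simp [partialSum]) (by simpa [partialSum] using hg),
    partialSum, partialSum, ← Finset.sum_sub_distrib, Finset.sum_eq_single i]
  · simp
  · intro l _ hl
    have : (l : ℕ) ≠ i := fun h => hl (Fin.ext h)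
    by_cases h : (l : ℕ) < i
    · rw [if_pos (by omega), if_pos h, sub_self]
    · rw [if_neg (by omega), if_neg h, sub_self]
  · simp

lemma TV_eq (i : Fin N) : TV i = Ph i - Pd i := by
  rw [← sum_piH_smul_partialSum (fun l => Ph l - Pd l)
    ((Finset.sum_sub_distrib Ph Pd).trans
      ((congrArg₂ (· - ·) sum_Ph sum_Pd).trans (sub_zero (0 : H N)))) i, TV]
  simp only [partialSum, hUp, Nat.lt_succ_iff]

lemma piHUp_eq (k : Fin (N - 1)) (i : Fin N) :
    piHUp k i = partialSum (fun l : Fin N => (if i = l then (1 : ℂ) else 0) - 1 / (N : ℂ)) (k + 1) := by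
  simp only [partialSum, piHUp, Nat.lt_succ_iff]

lemma sum_ite_sub (i : Fin N) : ∑ l : Fin N, ((if i = l then (1 : ℂ) else 0) - 1 / (N : ℂ)) = 0 := by
  have hN : (N : ℂ) ≠ 0 := Nat.cast_ne_zero.mpr (Nat.pos_iff_ne_zero.mp i.pos)
  simp [Finset.sum_sub_distrib, hN]

/-- The constant is $-\frac12(\bar\epsilon_i,\bar\epsilon_i)=-\frac12(1-\frac1N)$ for every $i$, so
it drops out of the conjugation. -/
lemma thetaConst_eq (i j : Fin N) : thetaConst i = thetaConst j := by
  have : ∀ i : Fin N, thetaConst i = -(1 / 2 * (1 - 1 / (N : ℂ))) := by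
    intro i
    have := sum_piH_smul_partialSum _ (sum_ite_sub i) i
    simp only [← piHUp_eq, if_true, smul_eq_mul] at this
    rw [thetaConst, ← Finset.mul_sum, this]
  rw [this, this]

lemma sum_piH_smul_eq_sub {M : Type*} [AddCommGroup M] [Module ℂ M] (g : Fin N → M)
    (k : Fin (N - 1)) :
    ∑ l : Fin N, piH k l • g l = g ⟨k, by omega⟩ - g ⟨k + 1, by omega⟩ := by
  simp only [piH, sub_smul, ite_smul, one_smul, zero_smul, Finset.sum_sub_distrib]
  rw [Finset.sum_eq_single ⟨k, by omega⟩, Finset.sum_eq_single ⟨k + 1, by omega⟩]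
  · simp
  · intro l _ hl
    exact if_neg fun h => hl (Fin.ext h)
  · simp
  · intro l _ hl
    exact if_neg fun h => hl (Fin.ext h)
  · simp

/-- Duality of fundamental weights and simple roots: summing by parts moves the difference from `g`
onto the partial sums. -/
lemma sum_piHUp_smul {M : Type*} [AddCommGroup M] [Module ℂ M] (g : Fin N → M)
    (hg : ∑ l, g l = 0) (i : Fin N) :
    ∑ k : Fin (N - 1), piHUp k i • (g ⟨k, by omega⟩ - g ⟨k + 1, by omega⟩) = g i := by
  have h : ∑ k : Fin (N - 1), piHUp k i • (g ⟨k, by omega⟩ - g ⟨k + 1, by omega⟩) =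
      ∑ l : Fin N, ((if i = l then (1 : ℂ) else 0) - 1 / (N : ℂ)) • g l := by
    simp only [← sum_piH_smul_eq_sub, Finset.smul_sum]
    rw [Finset.sum_comm]
    refine Finset.sum_congr rfl fun l _ => ?_
    have := sum_piH_smul_partialSum _ (sum_ite_sub i) l
    rw [← this, Finset.sum_smul]
    refine Finset.sum_congr rfl fun k _ => ?_
    rw [piHUp_eq, smul_smul, smul_eq_mul, mul_comm]
  rw [h]
  simp [sub_smul, Finset.sum_sub_distrib, ← Finset.smul_sum, hg]

lemma thetaLin_eq (i : Fin N) : thetaLin i = -Pd i :=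
  congrArg Neg.neg (sum_piHUp_smul Pd sum_Pd i)

end Gauge

/-! ### Normal forms for the modes of $L^\pm$. -/

section PreAlgebra

open PowerSeries

variable (ħ : ℂ) {N : ℕ}

/-- The generator `L̄_{ij,n}` of `PAlg`. -/
def Lgen (i j : Fin N) (n : ℤ) : PAlg ħ N := C (gen (.L i j n))

lemma preScal_mul_gen (f : MerField N) (i j : Fin N) (n : ℤ) :
    preScal ħ N f * gen (.L i j n) =
      gen (.L i j n) * preScal ħ N (shift (-epsBar i, -epsBar j, 0) f) := by
  have h := RingQuot.mkAlgHom_rel ℂ (PreRel.scal_L (ħ := ħ) f i j n)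
  rwa [map_mul, map_mul] at h

/-- The shift of the dynamical parameters by `(ε̄_i, ε̄_j)`, on power series in `p`. -/
def pShift (i j : Fin N) : (MerField N)⟦X⟧ →+* (MerField N)⟦X⟧ :=
  PowerSeries.map (shift (epsBar i, epsBar j, 0) : MerField N →+* MerField N)

lemma Lgen_mul_pScal (i j : Fin N) (n : ℤ) (r : (MerField N)⟦X⟧) :
    Lgen ħ i j n * pScal ħ N r = pScal ħ N (pShift i j r) * Lgen ħ i j n := by
  ext k
  rw [Lgen, coeff_C_mul, coeff_mul_C, pScal, coeff_map, coeff_map, pShift, coeff_map,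
    preScal_mul_gen]
  have : (-epsBar i, -epsBar j, 0) = -((epsBar i, epsBar j, 0) : HStar N) := by simp
  rw [this]
  congr 2
  exact (shift_shift_neg _ _).symm

lemma pShift_C (i j : Fin N) (f : MerField N) :
    pShift i j (C f) = C (shift (epsBar i, epsBar j, 0) f) := by
  rw [pShift, map_C]; rfl

lemma pScal_X : pScal ħ N X = X := by rw [pScal, map_X]

lemma LplusP_eq (i j : Fin N) (m : ℤ) :
    LplusP ħ i j m = pScal ħ N (X ^ (-m).toNat) * Lgen ħ i j (-m) := by
  rw [LplusP, Lmode, map_pow, pScal_X, Lgen]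

/-- The left factor $q^{2P_{\bar\epsilon_i}}$ of the conjugation cancels the $P$-part of $q^{2T_V}$.
The right factor $q^{-2P_{\bar\epsilon_j}}$ is moved across $\bar L_{ij}$, which shifts it and
produces $q^{-2(1-1/N)}$. -/
lemma LminusP_eq (i j : Fin N) (m : ℤ) :
    LminusP ħ i j m =
      pScal ħ N (X ^ m.toNat * C (qpow ħ (-(2 * (1 - 1 / (N : ℂ))))
        ((2 : ℂ) • Ph i - (2 : ℂ) • Pd j - (m : ℂ) • cc N))) * Lgen ħ i j (-m) := by
  have e : qpow ħ (-(2 * (1 - 1 / (N : ℂ)))) ((2 : ℂ) • Ph i - (2 : ℂ) • Pd j - (m : ℂ) • cc N) =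
      qpow ħ (-2 * thetaConst i) ((-2 : ℂ) • thetaLin i) * qpow ħ 0 ((2 : ℂ) • TV i) *
      qpow ħ 0 ((-m : ℂ) • cc N) * shift (epsBar i, epsBar j, 0)
        (qpow ħ (2 * thetaConst j) ((2 : ℂ) • thetaLin j)) := by
    rw [shift_qpow, qpow_mul, qpow_mul, qpow_mul, thetaConst_eq i j, thetaLin_eq, thetaLin_eq,
      TV_eq]
    congr 1
    · simp [epsBar_apply]
      ring
    · module
  rw [e, LminusP, LplusShiftP]
  have hg : C (gen (.L i j (-m))) = Lgen ħ i j (-m) := rfl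
  rw [hg, ← pScal_X (ħ := ħ) (N := N), ← map_pow, mul_assoc _ _ (Lgen ħ i j (-m)), ← mul_assoc,
    ← mul_assoc, ← mul_assoc, mul_assoc _ (Lgen ħ i j (-m)), Lgen_mul_pScal, pShift_C, ← mul_assoc]
  simp only [← map_mul (pScal ħ N)]
  congr 2
  simp only [map_mul]
  ring

end PreAlgebra

/-! ### Coefficients of $t^m$ and their convolution products. -/

section Modes

open PowerSeries

variable {B : Type*} [Ring B]

/-- The coefficient of `t^m`, a power series in `p`. -/
def modeCoeff (m : ℤ) : (LaurentSeries B)⟦X⟧ →+ B⟦X⟧ where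
  toFun f := PowerSeries.mk fun k => (coeff k f).coeff m
  map_zero' := by ext; simp
  map_add' f g := by ext; simp

@[simp] lemma coeff_modeCoeff (m : ℤ) (f : (LaurentSeries B)⟦X⟧) (k : ℕ) :
    coeff k (modeCoeff m f) = (coeff k f).coeff m :=
  coeff_mk k fun k => (coeff k f).coeff m

/-- Divisibility by growing powers of $p$ as $n\to-\infty$ bounds below the exponents of $t$ that
occur at each fixed power of $p$. This places products of $L^+$ modes in a ring where $R^\pm$ can
multiply them. -/
lemma exists_modeCoeff_eq (c : ℤ → B⟦X⟧) (n₀ : ℤ)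
    (h : ∀ n, X ^ (n₀ - n).toNat ∣ c n) : ∃ f, ∀ n, modeCoeff n f = c n := by
  refine ⟨PowerSeries.mk fun k => HahnSeries.ofSuppBddBelow (fun n => coeff k (c n))
    ⟨n₀ - k, fun n hn => ?_⟩, fun n => ?_⟩
  · by_contra hlt
    exact hn (X_pow_dvd_iff.mp (h n) k (by omega))
  · ext k
    rw [coeff_modeCoeff, coeff_mk]
    rfl

variable [TopologicalSpace B]

lemma hasSum_laurent_coeff_mul (x y : LaurentSeries B) (m : ℤ) :
    HasSum (fun n : ℤ => x.coeff n * y.coeff (m - n)) ((x * y).coeff m) := by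
  classical
  have h : (x * y).coeff m =
      ∑ n ∈ (Finset.antidiagonal x.isPWO_support y.isPWO_support m).image Prod.fst,
        x.coeff n * y.coeff (m - n) := by
    rw [HahnSeries.coeff_mul, Finset.sum_image]
    · refine Finset.sum_congr rfl fun ij hij => ?_
      rw [← (Finset.mem_antidiagonal.mp hij).2.2, add_sub_cancel_left]
    · intro a ha b hb hab
      have h1 := (Finset.mem_antidiagonal.mp ha).2.2
      have h2 := (Finset.mem_antidiagonal.mp hb).2.2
      ext
      · exact hab
      · have hab : a.1 = b.1 := hab
        omega
  rw [h]
  refine hasSum_sum_of_ne_finset_zero fun n hn => ?_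
  by_contra h0
  refine hn (Finset.mem_image.mpr ⟨(n, m - n), Finset.mem_antidiagonal.mpr ⟨?_, ?_, ?_⟩, rfl⟩)
  · exact left_ne_zero_of_mul h0
  · exact right_ne_zero_of_mul h0
  · exact add_sub_cancel n m

variable [DiscreteTopology B]

lemma hasSum_modeCoeff_mul (f g : (LaurentSeries B)⟦X⟧) (m : ℤ) :
    HasSum (fun n : ℤ => modeCoeff n f * modeCoeff (m - n) g) (modeCoeff m (f * g)) := by
  rw [WithPiTopology.hasSum_iff_hasSum_coeff]
  intro k
  simp only [coeff_mul, coeff_modeCoeff, HahnSeries.coeff_sum]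
  exact hasSum_sum fun ij _ => hasSum_laurent_coeff_mul _ _ _

lemma hasSum_modeCoeff_neg_mul (f g : (LaurentSeries B)⟦X⟧) :
    HasSum (fun n : ℤ => modeCoeff (-n) f * modeCoeff n g) (modeCoeff 0 (f * g)) := by
  have h := (Equiv.neg ℤ).hasSum_iff.mpr (hasSum_modeCoeff_mul f g 0)
  simpa [Function.comp_def] using h

lemma hasSum_modeCoeff_mul_neg (f g : (LaurentSeries B)⟦X⟧) :
    HasSum (fun n : ℤ => modeCoeff n f * modeCoeff (-n) g) (modeCoeff 0 (f * g)) := by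
  simpa using hasSum_modeCoeff_mul f g 0

lemma hasSum_mem {M T : Type*} [AddCommMonoid M] [TopologicalSpace M] {I : AddSubmonoid M}
    (hI : IsClosed (I : Set M)) {f : T → M} {s : M} (hs : HasSum f s) (h : ∀ t, f t ∈ I) : s ∈ I :=
  hI.mem_of_tendsto hs (Filter.Eventually.of_forall fun _ => I.sum_mem fun t _ => h t)

variable {I : Ideal B⟦X⟧}

lemma modeCoeff_mul_mem_right (hI : IsClosed (I : Set B⟦X⟧)) (f : (LaurentSeries B)⟦X⟧)
    {g : (LaurentSeries B)⟦X⟧} (hg : ∀ n, modeCoeff n g ∈ I) (m : ℤ) : modeCoeff m (f * g) ∈ I :=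
  hasSum_mem (I := I.toAddSubmonoid) hI (hasSum_modeCoeff_mul f g m)
    fun _ => I.mul_mem_left _ (hg _)

lemma modeCoeff_mul_mem_left [I.IsTwoSided] (hI : IsClosed (I : Set B⟦X⟧))
    (f : (LaurentSeries B)⟦X⟧)
    {g : (LaurentSeries B)⟦X⟧} (hg : ∀ n, modeCoeff n g ∈ I) (m : ℤ) : modeCoeff m (g * f) ∈ I :=
  hasSum_mem (I := I.toAddSubmonoid) hI (hasSum_modeCoeff_mul g f m)
    fun _ => I.mul_mem_right _ (hg _)

/-- If `A Y - X A'` has coefficients in a closed two-sided ideal and `A`, `A'` have the inverses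
`D`, `D'`, then `Y D' - D X` has coefficients in this ideal. -/
lemma modeCoeff_inverse_relation_mem {ι : Type*} [Fintype ι] [DecidableEq ι] [I.IsTwoSided]
    (hI : IsClosed (I : Set B⟦X⟧)) {A A' D D' X Y : Matrix ι ι (LaurentSeries B)⟦X⟧}
    (h : D * A = 1) (h' : A' * D' = 1) (hmem : ∀ x y n, modeCoeff n ((A * Y - X * A') x y) ∈ I)
    (x y : ι) (n : ℤ) : modeCoeff n ((Y * D') x y) - modeCoeff n ((D * X) x y) ∈ I := by
  -- Multiply the given relation by the inverses from both sides; the closed two-sided ideal absorbs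
  -- the resulting infinite convolutions.
  have e : Y * D' - D * X = D * (A * Y - X * A') * D' := by
    rw [mul_sub, sub_mul, ← mul_assoc, h, one_mul, mul_assoc D (X * A') D', mul_assoc X A' D', h',
      mul_one]
  rw [← map_sub, ← Matrix.sub_apply, e, Matrix.mul_apply, map_sum]
  refine I.sum_mem fun z _ => modeCoeff_mul_mem_left hI _ (fun m => ?_) n
  rw [Matrix.mul_apply, map_sum]
  exact I.sum_mem fun w _ => modeCoeff_mul_mem_right hI _ (hmem w z) m

lemma hasSum_finite_prod {M α β : Type*} [AddCommMonoid M] [TopologicalSpace M] [ContinuousAdd M]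
    [Fintype α] {f : α × β → M} {s : α → M} (h : ∀ a, HasSum (fun b => f (a, b)) (s a)) :
    HasSum f (∑ a, s a) := by
  classical
  have e : f = fun t => ∑ a, if t.1 = a then f t else 0 := by
    funext t
    rw [Finset.sum_ite_eq, if_pos (Finset.mem_univ _)]
  rw [e]
  refine hasSum_sum fun a _ => ?_
  refine ((Prod.mk_right_injective a).hasSum_iff fun t ht => if_neg fun hta => ht ?_).mp ?_
  · exact ⟨t.2, by rw [← hta]⟩
  · simpa [Function.comp_def] using h a

lemma hasSum_finite_prod_prod {M α β γ : Type*} [AddCommMonoid M] [TopologicalSpace M]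
    [ContinuousAdd M] [Fintype α] [Fintype β] {f : α × β × γ → M} {s : α × β → M}
    (h : ∀ a, HasSum (fun c => f (a.1, a.2, c)) (s a)) : HasSum f (∑ a, s a) :=
  (Equiv.prodAssoc α β γ).hasSum_iff.mp
    (hasSum_finite_prod (f := f ∘ Equiv.prodAssoc α β γ) fun a => h a)

/-- The action of a ring homomorphism on coefficients. -/
def laurentMap {R S : Type*} [Ring R] [Ring S] (φ : R →+* S) :
    (LaurentSeries R)⟦X⟧ →+* (LaurentSeries S)⟦X⟧ :=
  PowerSeries.map
    { toFun := fun x => x.map φ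
      map_one' := by
        ext n
        rw [HahnSeries.map_coeff, HahnSeries.coeff_one, HahnSeries.coeff_one]
        split_ifs <;> simp
      map_zero' := by ext; simp
      map_add' := fun x y => by ext; simp
      map_mul' := fun x y => HahnSeries.map_mul φ.toNonUnitalRingHom }

lemma modeCoeff_laurentMap {R S : Type*} [Ring R] [Ring S] (φ : R →+* S) (m : ℤ)
    (f : (LaurentSeries R)⟦X⟧) : modeCoeff m (laurentMap φ f) = PowerSeries.map φ (modeCoeff m f) := by
  ext k
  rw [coeff_modeCoeff, laurentMap, coeff_map, coeff_map, coeff_modeCoeff]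
  rfl

lemma modeCoeff_rescale {F : Type*} [Field F] (a : F) (m : ℤ) (f : (LaurentSeries F)⟦X⟧) :
    modeCoeff m (rescale (HahnSeries.C a : LaurentSeries F) f) = rescale a (modeCoeff m f) := by
  ext k
  rw [coeff_modeCoeff, coeff_rescale, coeff_rescale, coeff_modeCoeff, ← map_pow, HahnSeries.C_mul_eq_smul]
  rfl

end Modes

/-! ### The $L^+L^+$ relation with $R^+$, and from it the one with $R^-$. -/

section PlusRelations

open PowerSeries

variable {ħ : ℂ} {N : ℕ}

lemma isRelIdeal_relIdeal (ħ : ℂ) (N : ℕ) : IsRelIdeal ħ N (relIdeal ħ N) where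
  isTwoSided := inferInstance
  isClosed := by
    rw [relIdeal, Submodule.coe_sInf]
    exact isClosed_biInter fun I hI => hI.isClosed
  saturated x hx := Submodule.mem_sInf.mpr fun I hI =>
    hI.saturated x (Submodule.mem_sInf.mp hx I hI)
  rll i j k l a b := Submodule.mem_sInf.mpr fun I hI => hI.rll i j k l a b
  d_L i j n := Submodule.mem_sInf.mpr fun I hI => hI.d_L i j n

/-- The coefficient of `z₁^a z₂^b` in `R(z₁/z₂) L^{(1)}(z₁) L'^{(2)}(z₂) = L'^{(2)}(z₂) L^{(1)}(z₁)
R'(z₁/z₂)`: both sides converge, and they agree modulo `I`. -/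
def RLLMod (I : Ideal (PAlg ħ N)) (R R' : RSeries N) (L L' : Fin N → Fin N → ℤ → PAlg ħ N)
    (i j k l : Fin N) (a b : ℤ) : Prop :=
  ∃ s s', HasSum (lhsTerm (pScal ħ N) R L L' i j k l a b) s ∧
    HasSum (rhsTerm (pScal ħ N) R' L L' i j k l a b) s' ∧ s - s' ∈ I

/-- The matrix `R^±(z, P+h)` over the formal series with coefficients in `PAlg`. -/
def RmatPh (ħ : ℂ) (N : ℕ) (e : Sgn) :
    Matrix (Fin N × Fin N) (Fin N × Fin N) (LaurentSeries (PreAlg ħ N))⟦X⟧ :=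
  (laurentMap (preScal ħ N)).mapMatrix
    (Rmat ħ e fun j l => qpow ħ 0 ((2 : ℂ) • (Ph j - Ph l)))

/-- The matrix `R^{±*}(z, P)` over the formal series with coefficients in `PAlg`. -/
def RmatStar (ħ : ℂ) (N : ℕ) (e : Sgn) :
    Matrix (Fin N × Fin N) (Fin N × Fin N) (LaurentSeries (PreAlg ħ N))⟦X⟧ :=
  ((laurentMap (preScal ħ N)).comp (rescale
    (HahnSeries.C (qpow ħ 0 ((-2 : ℂ) • cc N)) : LaurentSeries (MerField N)))).mapMatrix
      (Rmat ħ e fun j l => qpow ħ 0 ((2 : ℂ) • (Pd j - Pd l)))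

lemma modeCoeff_RmatPh (e : Sgn) (x y : Fin N × Fin N) (n : ℤ) :
    modeCoeff (e.toInt * n) (RmatPh ħ N e x y) = pScal ħ N (RPh ħ N e x.1 x.2 y.1 y.2 n) :=
  modeCoeff_laurentMap _ _ _

lemma modeCoeff_RmatStar (e : Sgn) (x y : Fin N × Fin N) (n : ℤ) :
    modeCoeff (e.toInt * n) (RmatStar ħ N e x y) = pScal ħ N (RStarP ħ N e x.1 x.2 y.1 y.2 n) :=
  (modeCoeff_laurentMap _ _ _).trans (congrArg _ (modeCoeff_rescale _ _ _))

lemma Rmat_dynamical_unitarity (ħ : ℂ) {Q : Fin N → H N}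
    (hQ : ∀ i j, i ≠ j → qpow ħ 0 ((2 : ℂ) • Q i) ≠ qpow ħ 0 ((2 : ℂ) • Q j)) :
    Rmat ħ .minus (fun j l => qpow ħ 0 ((2 : ℂ) • (Q j - Q l))) *
      (Rmat ħ .plus fun j l => qpow ħ 0 ((2 : ℂ) • (Q j - Q l))).submatrix Prod.swap Prod.swap
        = 1 := by
  refine Rmat_unitarity ħ _ fun i j hij => ⟨qpow_ne_zero _ _ _, fun h => hQ i j hij.ne ?_⟩
  rw [qpow_two_smul_sub] at h
  exact eq_of_div_eq_one ((div_eq_mul_inv _ _).trans h)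

lemma RmatPh_unitarity (hħ : ħ ≠ 0) :
    RmatPh ħ N .minus * (RmatPh ħ N .plus).submatrix Prod.swap Prod.swap = 1 := by
  have h := congrArg (laurentMap (preScal ħ N)).mapMatrix
    (Rmat_dynamical_unitarity (N := N) ħ (Q := Ph) fun i j => qpow_Ph_ne hħ)
  rwa [map_mul, map_one] at h

lemma RmatStar_unitarity (hħ : ħ ≠ 0) :
    (RmatStar ħ N .plus).submatrix Prod.swap Prod.swap * RmatStar ħ N .minus = 1 := by
  have h := congrArg ((laurentMap (preScal ħ N)).comp (rescale
    (HahnSeries.C (qpow ħ 0 ((-2 : ℂ) • cc N)) : LaurentSeries (MerField N)))).mapMatrix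
      (mul_eq_one_comm.mp
        (Rmat_dynamical_unitarity (N := N) ħ (Q := Pd) fun i j => qpow_Pd_ne hħ))
  rwa [map_mul, map_one] at h

lemma X_pow_dvd_LplusP_mul (i j k l : Fin N) (m m' : ℤ) :
    X ^ (-m).toNat ∣ LplusP ħ i j m * LplusP ħ k l m' := by
  rw [LplusP, Lmode, mul_assoc]
  exact Dvd.intro _ rfl

lemma X_pow_dvd_mul_LplusP (i j k l : Fin N) (m m' : ℤ) :
    X ^ (-m').toNat ∣ LplusP ħ i j m * LplusP ħ k l m' := by
  rw [LplusP.eq_def ħ k l, Lmode, ← mul_assoc, (commute_X_pow _ _).eq, mul_assoc]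
  exact Dvd.intro _ rfl

/-- The matrix whose mode `n` is the coefficient of `z₁^{a-n} z₂^{b+n}` in
`L^{+(1)}(z₁) L^{+(2)}(z₂)`. -/
lemma exists_lplus_one_two (a b : ℤ) :
    ∃ M : Matrix (Fin N × Fin N) (Fin N × Fin N) (LaurentSeries (PreAlg ħ N))⟦X⟧, ∀ x y n,
      modeCoeff n (M x y) = LplusP ħ x.1 y.1 (a - n) * LplusP ħ x.2 y.2 (b + n) := by
  -- The factor in $z_2$ alone supplies $p^{\max(-b-n,0)}$, which bounds $n$ below at each power of
  -- $p$.
  choose M hM using fun x y : Fin N × Fin N => exists_modeCoeff_eq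
    (fun n => LplusP ħ x.1 y.1 (a - n) * LplusP ħ x.2 y.2 (b + n)) (-b) fun n => by
      rw [← neg_add']
      exact X_pow_dvd_mul_LplusP _ _ _ _ _ _
  exact ⟨M, hM⟩

/-- The matrix whose mode `n` is the coefficient of `z₁^{a-n} z₂^{b+n}` in
`L^{+(2)}(z₂) L^{+(1)}(z₁)`. -/
lemma exists_lplus_two_one (a b : ℤ) :
    ∃ M : Matrix (Fin N × Fin N) (Fin N × Fin N) (LaurentSeries (PreAlg ħ N))⟦X⟧, ∀ x y n,
      modeCoeff n (M x y) = LplusP ħ x.2 y.2 (b + n) * LplusP ħ x.1 y.1 (a - n) := by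
  choose M hM using fun x y : Fin N × Fin N => exists_modeCoeff_eq
    (fun n => LplusP ħ x.2 y.2 (b + n) * LplusP ħ x.1 y.1 (a - n)) (-b) fun n => by
      rw [← neg_add']
      exact X_pow_dvd_LplusP_mul _ _ _ _ _ _
  exact ⟨M, hM⟩

/-- The defining relation is read with tensor factors and variables exchanged: here $t=z_2/z_1$, so
$R^+_{21}(z_2/z_1)$ is a series in $t$, over the same ring as $R^-(z_1/z_2)$. -/
lemma hasSum_lhsTerm_plus {Y : Matrix (Fin N × Fin N) (Fin N × Fin N) (LaurentSeries (PreAlg ħ N))⟦X⟧}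
    {a b : ℤ} (hY : ∀ x y n,
      modeCoeff n (Y x y) = LplusP ħ x.2 y.2 (b + n) * LplusP ħ x.1 y.1 (a - n))
    (i j k l : Fin N) (n : ℤ) :
    HasSum (lhsTerm (pScal ħ N) (RPh ħ N .plus) (LplusP ħ) (LplusP ħ) j i l k (b + n) (a - n))
      (modeCoeff n (((RmatPh ħ N .plus).submatrix Prod.swap Prod.swap * Y) (i, j) (k, l))) := by
  rw [Matrix.mul_apply, map_sum, ← Equiv.sum_comp (Equiv.prodComm (Fin N) (Fin N))]
  refine hasSum_finite_prod_prod fun x => ?_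
  convert hasSum_modeCoeff_mul (B := PreAlg ħ N) _ _ n using 2 with m
  have h := modeCoeff_RmatPh (ħ := ħ) .plus (j, i) x m
  rw [Sgn.toInt, one_mul] at h
  rw [lhsTerm, hY, ← h, mul_assoc]
  congr 3 <;> simp <;> ring_nf

lemma hasSum_rhsTerm_plus {X' : Matrix (Fin N × Fin N) (Fin N × Fin N) (LaurentSeries (PreAlg ħ N))⟦X⟧}
    {a b : ℤ} (hX : ∀ x y n,
      modeCoeff n (X' x y) = LplusP ħ x.1 y.1 (a - n) * LplusP ħ x.2 y.2 (b + n))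
    (i j k l : Fin N) (n : ℤ) :
    HasSum (rhsTerm (pScal ħ N) (RStarP ħ N .plus) (LplusP ħ) (LplusP ħ) j i l k (b + n) (a - n))
      (modeCoeff n ((X' * (RmatStar ħ N .plus).submatrix Prod.swap Prod.swap) (i, j) (k, l))) := by
  rw [Matrix.mul_apply, map_sum, ← Equiv.sum_comp (Equiv.prodComm (Fin N) (Fin N))]
  refine hasSum_finite_prod_prod fun x => ?_
  convert (Equiv.subLeft n).hasSum_iff.mpr (hasSum_modeCoeff_mul (B := PreAlg ħ N) _ _ n) using 2 with m
  have h := modeCoeff_RmatStar (ħ := ħ) .plus x (l, k) m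
  rw [Sgn.toInt, one_mul] at h
  rw [rhsTerm, Function.comp_apply, hX, ← h]
  congr 3 <;> simp <;> ring_nf

variable {I : Ideal (PAlg ħ N)}

/-- Adds convergence to the defining relation of the ideal, which is phrased with `tsum` only. -/
lemma rllMod_plus (hI : IsRelIdeal ħ N I) (i j k l : Fin N) (a b : ℤ) :
    RLLMod I (RPh ħ N .plus) (RStarP ħ N .plus) (LplusP ħ) (LplusP ħ) i j k l a b := by
  obtain ⟨Y, hY⟩ := exists_lplus_two_one (ħ := ħ) (N := N) b a
  obtain ⟨X', hX⟩ := exists_lplus_one_two (ħ := ħ) (N := N) b a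
  have h1 := hasSum_lhsTerm_plus hY j i l k 0
  have h2 := hasSum_rhsTerm_plus hX j i l k 0
  rw [add_zero, sub_zero] at h1 h2
  refine ⟨_, _, h1, h2, ?_⟩
  rw [← h1.tsum_eq, ← h2.tsum_eq]
  exact hI.rll i j k l a b

/-- The relation `R^-(z₁/z₂, P+h) L^{+(1)}(z₁) L^{+(2)}(z₂) =
L^{+(2)}(z₂) L^{+(1)}(z₁) R^{-*}(z₁/z₂, P)`. -/
lemma rllMod_minus (hħ : ħ ≠ 0) (hI : IsRelIdeal ħ N I) (i j k l : Fin N) (a b : ℤ) :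
    RLLMod I (RPh ħ N .minus) (RStarP ħ N .minus) (LplusP ħ) (LplusP ħ) i j k l a b := by
  have := hI.isTwoSided
  obtain ⟨Y, hY⟩ := exists_lplus_two_one (ħ := ħ) (N := N) a b
  obtain ⟨X', hX⟩ := exists_lplus_one_two (ħ := ħ) (N := N) a b
  -- $R^-(P+h)$ and $R^{-*}(P)$ serve as the inverses of the exchanged matrices $R^+_{21}(P+h)$ and
  -- $R^{+*}_{21}(P)$.
  have hmem := modeCoeff_inverse_relation_mem hI.isClosed (RmatPh_unitarity hħ)
    (RmatStar_unitarity hħ) (X := X') (Y := Y) (fun ⟨i, j⟩ ⟨k, l⟩ n => by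
      rw [Matrix.sub_apply, map_sub, ← (hasSum_lhsTerm_plus hY i j k l n).tsum_eq,
        ← (hasSum_rhsTerm_plus hX i j k l n).tsum_eq]
      exact hI.rll _ _ _ _ _ _) (i, j) (k, l) 0
  refine ⟨_, _, ?_, ?_, by rw [← neg_sub]; exact I.neg_mem hmem⟩
  · rw [Matrix.mul_apply, map_sum]
    refine hasSum_finite_prod_prod fun x => ?_
    convert hasSum_modeCoeff_neg_mul (B := PreAlg ħ N) _ _ using 2 with n
    have h := modeCoeff_RmatPh (ħ := ħ) .minus (i, j) x n
    rw [Sgn.toInt, neg_one_mul] at h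
    rw [lhsTerm, hX, ← h, mul_assoc]
  · rw [Matrix.mul_apply, map_sum]
    refine hasSum_finite_prod_prod fun x => ?_
    convert hasSum_modeCoeff_mul_neg (B := PreAlg ħ N) _ _ using 2 with n
    have h := modeCoeff_RmatStar (ħ := ħ) .minus x (k, l) n
    rw [Sgn.toInt, neg_one_mul] at h
    rw [rhsTerm, hY, ← h]

end PlusRelations

/-! ### Equality up to an integral power of $p$. -/

section PowerRelation

open PowerSeries

variable {R : Type*} [Ring R]

/-- The relation `y = p^m x`, for `m ∈ ℤ`. -/
def PowRel (m : ℤ) (x y : R⟦X⟧) : Prop := X ^ m.toNat * x = X ^ (-m).toNat * y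

lemma PowRel.symm {m : ℤ} {x y : R⟦X⟧} (h : PowRel m x y) : PowRel (-m) y x := by
  rw [PowRel, neg_neg]
  exact Eq.symm h

lemma PowRel.refl (x : R⟦X⟧) : PowRel 0 x x := rfl

lemma PowRel.mul {m n : ℤ} {x y x' y' : R⟦X⟧} (h : PowRel m x y) (h' : PowRel n x' y') :
    PowRel (m + n) (x * x') (y * y') := by
  have key : ∀ (a b : ℕ) (u v : R⟦X⟧), X ^ a * u * (X ^ b * v) = X ^ (a + b) * (u * v) := by
    intro a b u v
    rw [mul_assoc, ← mul_assoc u, (commute_X_pow u b).eq, pow_add]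
    simp only [mul_assoc]
  -- For opposite signs of $m$ and $n$ both sides carry a superfluous $p^d$, with the same $d$; it
  -- is cancelled.
  obtain ⟨d, h1, h2⟩ : ∃ d, m.toNat + n.toNat = d + (m + n).toNat ∧
      (-m).toNat + (-n).toNat = d + (-(m + n)).toNat :=
    ⟨m.toNat + n.toNat - (m + n).toNat, by omega, by omega⟩
  have e := congrArg₂ (· * ·) h h'
  simp only [key, h1, h2, pow_add, mul_assoc] at e
  exact X_pow_mul_cancel e

lemma PowRel.map {S : Type*} [Ring S] {m : ℤ} {x y : R⟦X⟧} (h : PowRel m x y) (φ : R →+* S) :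
    PowRel m (PowerSeries.map φ x) (PowerSeries.map φ y) := by
  have e := congrArg (PowerSeries.map φ) h
  rw [PowRel]
  simpa only [map_mul, map_pow, map_X] using e

variable [TopologicalSpace R] [DiscreteTopology R]

lemma hasSum_of_hasSum_X_pow_mul {T : Type*} {f : T → R⟦X⟧} {s : R⟦X⟧} {d : ℕ}
    (h : HasSum (fun t => X ^ d * f t) s) : ∃ s', HasSum f s' ∧ X ^ d * s' = s := by
  have h' : HasSum f (PowerSeries.mk fun k => coeff (k + d) s) := by
    rw [WithPiTopology.hasSum_iff_hasSum_coeff] at h ⊢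
    intro k
    have hk := h (k + d)
    simp only [coeff_X_pow_mul] at hk
    rwa [coeff_mk]
  exact ⟨_, h', (h'.mul_left _).unique h⟩

/-- A negative power of $p$ can be divided out of a convergent sum, because convergence is tested on
coefficients and division by $p^d$ only shifts them. -/
lemma PowRel.hasSum {T : Type*} {f f' : T → R⟦X⟧} {s u : R⟦X⟧} {m : ℤ} (hs : HasSum f s)
    (h : ∀ t, PowRel m (u * f t) (f' t)) : ∃ s', HasSum f' s' ∧ PowRel m (u * s) s' := by
  have h1 := (hs.mul_left u).mul_left (X ^ m.toNat)
  obtain ⟨s', h2, h3⟩ := hasSum_of_hasSum_X_pow_mul (h1.congr_fun fun t => Eq.symm (h t))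
  exact ⟨s', h2, h3.symm⟩

end PowerRelation

/-! ### Carrying a relation along powers of $p$ and monomials. -/

section Transport

open PowerSeries

variable {ħ : ℂ} {N : ℕ} {I : Ideal (PAlg ħ N)}

lemma IsRelIdeal.mem_of_X_pow_mul (hI : IsRelIdeal ħ N I) {d : ℕ} {x : PAlg ħ N}
    (h : X ^ d * x ∈ I) : x ∈ I := by
  induction d with
  | zero => simpa using h
  | succ d ih =>
    rw [pow_succ', mul_assoc] at h
    exact ih (hI.saturated _ h)

/-- The factor $p^mu$ must be the same for all terms on both sides, so the difference of the sums is
multiplied by it too. For $m<0$ this shows only that $p^{-m}$ times the new difference lies in the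
ideal, and saturation removes the power. -/
lemma RLLMod.of_powRel (hI : IsRelIdeal ħ N I) {R₀ R₀' R₁ R₁' : RSeries N}
    {L₀ L₀' L₁ L₁' : Fin N → Fin N → ℤ → PAlg ħ N} {i j k l : Fin N} {a b : ℤ}
    (h : RLLMod I R₀ R₀' L₀ L₀' i j k l a b) (m : ℤ) (u : PAlg ħ N)
    (hl : ∀ t, PowRel m (u * lhsTerm (pScal ħ N) R₀ L₀ L₀' i j k l a b t)
      (lhsTerm (pScal ħ N) R₁ L₁ L₁' i j k l a b t))
    (hr : ∀ t, PowRel m (u * rhsTerm (pScal ħ N) R₀' L₀ L₀' i j k l a b t)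
      (rhsTerm (pScal ħ N) R₁' L₁ L₁' i j k l a b t)) :
    RLLMod I R₁ R₁' L₁ L₁' i j k l a b := by
  obtain ⟨s, s', hs, hs', hmem⟩ := h
  obtain ⟨r, h1, h2⟩ := PowRel.hasSum hs hl
  obtain ⟨r', h1', h2'⟩ := PowRel.hasSum hs' hr
  refine ⟨r, r', h1, h1', hI.mem_of_X_pow_mul (d := (-m).toNat) ?_⟩
  rw [mul_sub, ← h2, ← h2', ← mul_sub, ← mul_sub]
  exact I.mul_mem_left _ (I.mul_mem_left _ hmem)

/-- The scalar `q^{a + h}` in `PAlg`. -/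
def qScal (ħ a : ℂ) {N : ℕ} (h : H N) : PAlg ħ N := pScal ħ N (C (qpow ħ a h))

lemma qScal_mul (a b : ℂ) (h k : H N) : qScal ħ a h * qScal ħ b k = qScal ħ (a + b) (h + k) := by
  rw [qScal, qScal, ← map_mul, ← map_mul, qpow_mul, qScal]

lemma qScal_zero : qScal ħ 0 (0 : H N) = 1 := by
  rw [qScal, qpow_zero_zero, map_one, map_one]

lemma pScal_mul_qScal (r : (MerField N)⟦X⟧) (a : ℂ) (h : H N) :
    pScal ħ N r * qScal ħ a h = qScal ħ a h * pScal ħ N r := by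
  rw [qScal, ← map_mul, mul_comm, map_mul]

lemma LplusP_mul_qScal (i j : Fin N) (m : ℤ) (a : ℂ) (h : H N) :
    LplusP ħ i j m * qScal ħ a h =
      qScal ħ (a + h (epsBar i, epsBar j, 0)) h * LplusP ħ i j m := by
  rw [LplusP_eq, mul_assoc, qScal, Lgen_mul_pScal, pShift_C, shift_qpow, ← mul_assoc, ← map_mul,
    mul_comm, map_mul, mul_assoc, qScal]

lemma powRel_LplusP (i j : Fin N) (m : ℤ) :
    PowRel 0 (qScal ħ 0 0 * LplusP ħ i j m) (LplusP ħ i j m) := by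
  rw [qScal_zero, one_mul]
  exact PowRel.refl _

lemma powRel_LminusP (i j : Fin N) (m : ℤ) :
    PowRel m (qScal ħ (-(2 * (1 - 1 / (N : ℂ))))
      ((2 : ℂ) • Ph i - (2 : ℂ) • Pd j - (m : ℂ) • cc N) * LplusP ħ i j m) (LminusP ħ i j m) := by
  rw [PowRel, LminusP_eq, LplusP_eq, qScal, ← pScal_X, ← map_pow, ← map_pow]
  simp only [← mul_assoc, ← map_mul]
  congr 2
  ring

/-- All monomials are collected on the left. The one attached to the second $L$ crosses the first
and picks up the value of $h_2$ at its weight. Totals are separate variables so that different terms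
can be matched to one `u`. -/
lemma powRel_lhs {r₀ r₁ : (MerField N)⟦X⟧} {x₁ x₂ : PAlg ħ N} {m₀ m₁ m₂ M n n' : ℤ}
    {a₀ a₁ a₂ A : ℂ} {h₀ h₁ h₂ W : H N} {i' j' k l : Fin N}
    (hr : PowRel m₀ (qScal ħ a₀ h₀ * pScal ħ N r₀) (pScal ħ N r₁))
    (h1 : PowRel m₁ (qScal ħ a₁ h₁ * LplusP ħ i' k n) x₁)
    (h2 : PowRel m₂ (qScal ħ a₂ h₂ * LplusP ħ j' l n') x₂)
    (hM : m₀ + m₁ + m₂ = M) (hA : a₀ + (a₁ + (a₂ + h₂ (epsBar i', epsBar k, 0))) = A)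
    (hW : h₀ + (h₁ + h₂) = W) :
    PowRel M (qScal ħ A W * (pScal ħ N r₀ * LplusP ħ i' k n * LplusP ħ j' l n'))
      (pScal ħ N r₁ * x₁ * x₂) := by
  subst hM hA hW
  convert (hr.mul h1).mul h2 using 1
  rw [mul_assoc _ _ (qScal ħ a₂ h₂ * _), mul_assoc _ _ (qScal ħ a₂ h₂ * _),
    ← mul_assoc (LplusP ħ i' k n) (qScal ħ a₂ h₂), LplusP_mul_qScal, mul_assoc (qScal ħ _ h₂),
    ← mul_assoc (qScal ħ a₁ h₁), qScal_mul, mul_assoc (qScal ħ a₀ h₀),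
    ← mul_assoc (pScal ħ N r₀) (qScal ħ _ _), pScal_mul_qScal, mul_assoc (qScal ħ _ _),
    ← mul_assoc (qScal ħ a₀ h₀), qScal_mul, mul_assoc (pScal ħ N r₀)]

/-- Here the monomial of $R$ crosses both $L$'s and that of the first $L$ crosses the other one,
which gives two corrections. -/
lemma powRel_rhs {r₀ r₁ : (MerField N)⟦X⟧} {x₁ x₂ : PAlg ħ N} {m₀ m₁ m₂ M n n' : ℤ}
    {a₀ a₁ a₂ A : ℂ} {h₀ h₁ h₂ W : H N} {i i' j j' : Fin N}
    (hr : PowRel m₀ (qScal ħ a₀ h₀ * pScal ħ N r₀) (pScal ħ N r₁))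
    (h1 : PowRel m₁ (qScal ħ a₁ h₁ * LplusP ħ i i' n) x₁)
    (h2 : PowRel m₂ (qScal ħ a₂ h₂ * LplusP ħ j j' n') x₂)
    (hM : m₂ + m₁ + m₀ = M)
    (hA : a₂ + (a₁ + (a₀ + h₀ (epsBar i, epsBar i', 0)) +
      (h₁ + h₀) (epsBar j, epsBar j', 0)) = A)
    (hW : h₂ + (h₁ + h₀) = W) :
    PowRel M (qScal ħ A W * (LplusP ħ j j' n' * LplusP ħ i i' n * pScal ħ N r₀))
      (x₂ * x₁ * pScal ħ N r₁) := by
  subst hM hA hW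
  convert (h2.mul h1).mul hr using 1
  rw [mul_assoc _ _ (qScal ħ a₀ h₀ * _), mul_assoc _ _ (qScal ħ a₀ h₀ * _),
    ← mul_assoc (LplusP ħ i i' n) (qScal ħ a₀ h₀), LplusP_mul_qScal, mul_assoc (qScal ħ _ h₀),
    ← mul_assoc (qScal ħ a₁ h₁), qScal_mul, mul_assoc (qScal ħ a₂ h₂),
    ← mul_assoc (LplusP ħ j j' n') (qScal ħ _ _), LplusP_mul_qScal, mul_assoc (qScal ħ _ _),
    ← mul_assoc (qScal ħ a₂ h₂), qScal_mul, mul_assoc (LplusP ħ j j' n')]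

end Transport

/-! ### Passing from $R^+$ to $R^-$ mode by mode, inside the algebra. -/

section RShift

open PowerSeries

variable {ħ : ℂ} {N : ℕ}

lemma Rcoeff_eq_zero {F : Type*} [Field F] [Algebra ℂ F] (e : Sgn) (S : Fin N → Fin N → F)
    {i j i' j' : Fin N} (h : ¬((i' = i ∧ j' = j) ∨ (i' = j ∧ j' = i))) (n : ℤ) :
    Rcoeff ħ e S i j i' j' n = 0 := by
  have h0 : RbarEntry ħ e S i j i' j' = 0 := by
    rw [not_or] at h
    rw [RbarEntry, if_neg h.1, if_neg h.1, if_neg h.2, ite_self]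
  ext k
  rw [Rcoeff, h0, mul_zero, coeff_mk, map_zero, map_zero, HahnSeries.coeff_zero]

lemma flipFactor_qpow {Q : Fin N → H N} (i j i' : Fin N) :
    flipFactor ħ (fun i => qpow ħ 0 ((2 : ℂ) • Q i)) i j i' =
      qpow ħ (-(2 * ((if i = j then 1 else 0) - 1 / (N : ℂ))))
        ((2 : ℂ) • Q i' - (2 : ℂ) • Q i) := by
  rw [flipFactor, qpow_inv, qpow_mul, ← qpow_const, qpow_mul]
  congr 1
  · ring
  · module

lemma Rcoeff_dynamical_shift {Q : Fin N → H N}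
    (hQ : ∀ i j, i ≠ j → qpow ħ 0 ((2 : ℂ) • Q i) ≠ qpow ħ 0 ((2 : ℂ) • Q j))
    (i j i' j' : Fin N) (n : ℤ) :
    X ^ n.toNat * Rcoeff ħ .plus (fun j l => qpow ħ 0 ((2 : ℂ) • (Q j - Q l))) i j i' j' n =
      X ^ (-n).toNat * (C (qpow ħ (-(2 * ((if i = j then 1 else 0) - 1 / (N : ℂ))))
        ((2 : ℂ) • Q i' - (2 : ℂ) • Q i)) *
        Rcoeff ħ .minus (fun j l => qpow ħ 0 ((2 : ℂ) • (Q j - Q l))) i j i' j' n) := by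
  have h := Rcoeff_shift ħ (fun i => qpow ħ 0 ((2 : ℂ) • Q i)) (fun i => qpow_ne_zero _ _ _) hQ
    i j i' j' n
  simpa only [flipFactor_qpow, ← qpow_two_smul_sub] using h

lemma powRel_RPh (hħ : ħ ≠ 0) (i j i' j' : Fin N) (n : ℤ) :
    PowRel n (qScal ħ (2 * ((if i = j then 1 else 0) - 1 / (N : ℂ)))
        ((2 : ℂ) • Ph i - (2 : ℂ) • Ph i') * pScal ħ N (RPh ħ N .plus i j i' j' n))
      (pScal ħ N (RPh ħ N .minus i j i' j' n)) := by
  rw [qScal, ← map_mul]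
  refine PowRel.map (R := MerField N) ?_ (preScal ħ N)
  have h := Rcoeff_dynamical_shift (fun i j => qpow_Ph_ne hħ) i j i' j' n
  rw [PowRel, mul_left_comm, RPh, h, mul_left_comm, ← mul_assoc (C _), ← map_mul, qpow_mul]
  have e : qpow ħ (2 * ((if i = j then 1 else 0) - 1 / (N : ℂ)) +
      -(2 * ((if i = j then 1 else 0) - 1 / (N : ℂ))))
      ((2 : ℂ) • Ph i - (2 : ℂ) • Ph i' + ((2 : ℂ) • Ph i' - (2 : ℂ) • Ph i)) = 1 := by
    rw [← qpow_zero_zero ħ]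
    congr 1
    · ring
    · module
  rw [e, map_one, one_mul, RPh]

/-- In the starred matrix the quasi-period is $p^*=pq^{-2c}$, so $p^n$ is accompanied by $q^{-2nc}$.
-/
lemma powRel_RStarP (hħ : ħ ≠ 0) (i j i' j' : Fin N) (n : ℤ) :
    PowRel n (qScal ħ (2 * ((if i = j then 1 else 0) - 1 / (N : ℂ)))
        ((2 : ℂ) • Pd i - (2 : ℂ) • Pd i' - (2 * n : ℂ) • cc N) *
          pScal ħ N (RStarP ħ N .plus i j i' j' n))
      (pScal ħ N (RStarP ħ N .minus i j i' j' n)) := by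
  rw [qScal, ← map_mul]
  refine PowRel.map (R := MerField N) ?_ (preScal ħ N)
  have h := congrArg (rescale (qpow ħ 0 ((-2 : ℂ) • cc N)))
    (Rcoeff_dynamical_shift (fun i j => qpow_Pd_ne hħ) i j i' j' n)
  have hX : rescale (qpow ħ 0 ((-2 : ℂ) • cc N)) X = C (qpow ħ 0 ((-2 : ℂ) • cc N)) * X :=
    rescale_X _
  have hC : ∀ x, rescale (qpow ħ 0 ((-2 : ℂ) • cc N)) (C x) = C x := fun x => by
    ext k
    rw [coeff_rescale, coeff_C]
    split_ifs with hk <;> simp [hk]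
  simp only [map_mul, map_pow, hX, hC, mul_pow] at h
  simp only [← map_pow, qpow_pow] at h
  change _ * RStarP ħ N .plus i j i' j' n = _ * (_ * RStarP ħ N .minus i j i' j' n) at h
  -- Rescaling puts powers of $q^{-2c}$ on both sides of the identity, one for each truncated
  -- exponent; together they give $q^{-2nc}$.
  have hn : ((n.toNat : ℂ) - ((-n).toNat : ℂ)) = n := by
    exact_mod_cast Int.toNat_sub_toNat_neg n
  have e1 : qpow ħ (2 * ((if i = j then 1 else 0) - 1 / (N : ℂ)))
        ((2 : ℂ) • Pd i - (2 : ℂ) • Pd i' - (2 * n : ℂ) • cc N) =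
      qpow ħ (2 * ((if i = j then 1 else 0) - 1 / (N : ℂ)))
        ((2 : ℂ) • Pd i - (2 : ℂ) • Pd i' + (2 * (-n).toNat : ℂ) • cc N) *
      qpow ħ (n.toNat * 0) ((n.toNat : ℂ) • (-2 : ℂ) • cc N) := by
    rw [qpow_mul, ← hn]
    congr 1
    · ring
    · module
  have e2 : qpow ħ (2 * ((if i = j then 1 else 0) - 1 / (N : ℂ)))
        ((2 : ℂ) • Pd i - (2 : ℂ) • Pd i' + (2 * (-n).toNat : ℂ) • cc N) *
      (qpow ħ ((-n).toNat * 0) (((-n).toNat : ℂ) • (-2 : ℂ) • cc N) *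
        qpow ħ (-(2 * ((if i = j then 1 else 0) - 1 / (N : ℂ))))
          ((2 : ℂ) • Pd i' - (2 : ℂ) • Pd i)) = 1 := by
    rw [qpow_mul, qpow_mul, ← qpow_zero_zero ħ]
    congr 1
    · ring
    · module
  have h' := congrArg (C (qpow ħ (2 * ((if i = j then 1 else 0) - 1 / (N : ℂ)))
        ((2 : ℂ) • Pd i - (2 : ℂ) • Pd i' + (2 * (-n).toNat : ℂ) • cc N)) * ·) h
  have e2' := congrArg (C (R := MerField N)) e2
  rw [map_one, map_mul, map_mul] at e2'
  rw [PowRel, e1, map_mul]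
  linear_combination h' + X ^ (-n).toNat * RStarP ħ N .minus i j i' j' n * e2'

end RShift

/-! ### The three relations, modulo the ideal. -/

section MixedRelations

open PowerSeries

variable {ħ : ℂ} {N : ℕ} {I : Ideal (PAlg ħ N)}

lemma PowRel.qScal_symm {m : ℤ} {a : ℂ} {h : H N} {x y : PAlg ħ N}
    (hxy : PowRel m (qScal ħ a h * x) y) : PowRel (-m) (qScal ħ (-a) (-h) * y) x := by
  have e := ((PowRel.refl (qScal ħ (-a) (-h))).mul hxy).symm
  have e0 : -h + h = 0 := neg_add_cancel h
  rwa [← mul_assoc, qScal_mul, neg_add_cancel, e0, qScal_zero, one_mul, zero_add] at e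

lemma PowRel.spectralShift {m n : ℤ} {a : ℂ} {h : H N} {x : PAlg ħ N} {R : RSeries N}
    {i j i' j' : Fin N} (hx : PowRel m (qScal ħ a h * x) (pScal ħ N (R i j i' j' n))) (e : Sgn) :
    PowRel m (qScal ħ a ((e.toInt * n : ℂ) • cc N + h) * x)
      (pScal ħ N (R.spectralShift ħ e i j i' j' n)) := by
  have h0 := (PowRel.refl (qScal ħ 0 ((e.toInt * n : ℂ) • cc N))).mul hx
  rw [← mul_assoc, qScal_mul, zero_add, zero_add] at h0
  rwa [RSeries.spectralShift, map_mul]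

/-- `R(z)_{ij}^{i'j'}` vanishes unless `{i, j} = {i', j'}`. -/
def RSeries.WeightZero (R : RSeries N) : Prop :=
  ∀ i j i' j' n, ¬((i' = i ∧ j' = j) ∨ (i' = j ∧ j' = i)) → R i j i' j' n = 0

lemma weightZero_RPh (e : Sgn) : (RPh ħ N e).WeightZero := fun _ _ _ _ n h =>
  Rcoeff_eq_zero _ _ h n

lemma weightZero_RStarP (e : Sgn) : (RStarP ħ N e).WeightZero := fun _ _ _ _ n h => by
  rw [RStarP, Rcoeff_eq_zero _ _ h n, map_zero]

lemma RSeries.WeightZero.spectralShift {R : RSeries N} (h : R.WeightZero) (e : Sgn) :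
    (R.spectralShift ħ e).WeightZero := fun i j i' j' n h' => by
  rw [RSeries.spectralShift, h _ _ _ _ _ h', mul_zero]

/-- The totals need to agree only where $R$ can be nonzero, that is, when the summation indices
permute the outer ones; all other terms vanish on both sides. -/
lemma RLLMod.of_powRel_of_weightZero (hI : IsRelIdeal ħ N I) {R₀ R₀' R₁ R₁' : RSeries N}
    (h₀ : R₀.WeightZero) (h₀' : R₀'.WeightZero) (h₁ : R₁.WeightZero) (h₁' : R₁'.WeightZero)
    {L L' : Fin N → Fin N → ℤ → PAlg ħ N} {i j k l : Fin N} {a b : ℤ}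
    (h : RLLMod I R₀ R₀' (LplusP ħ) (LplusP ħ) i j k l a b) (m : ℤ) (u : PAlg ħ N)
    (hl : ∀ i' j' n, (i' = i ∧ j' = j) ∨ (i' = j ∧ j' = i) →
      PowRel m (u * (pScal ħ N (R₀ i j i' j' n) * LplusP ħ i' k (a - n) * LplusP ħ j' l (b + n)))
        (pScal ħ N (R₁ i j i' j' n) * L i' k (a - n) * L' j' l (b + n)))
    (hr : ∀ i' j' n, (i' = k ∧ j' = l) ∨ (i' = l ∧ j' = k) →
      PowRel m (u * (LplusP ħ j j' (b + n) * LplusP ħ i i' (a - n) * pScal ħ N (R₀' i' j' k l n)))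
        (L' j j' (b + n) * L i i' (a - n) * pScal ħ N (R₁' i' j' k l n))) :
    RLLMod I R₁ R₁' L L' i j k l a b := by
  have hz : PowRel m (0 : PAlg ħ N) 0 := by rw [PowRel, mul_zero, mul_zero]
  refine h.of_powRel hI m u (fun ⟨i', j', n⟩ => ?_) fun ⟨i', j', n⟩ => ?_
  · by_cases hw : (i' = i ∧ j' = j) ∨ (i' = j ∧ j' = i)
    · exact hl i' j' n hw
    · simp only [lhsTerm, h₀ _ _ _ _ n hw, h₁ _ _ _ _ n hw, map_zero, zero_mul, mul_zero]
      exact hz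
  · by_cases hw : (i' = k ∧ j' = l) ∨ (i' = l ∧ j' = k)
    · exact hr i' j' n hw
    · have hw' : ¬((k = i' ∧ l = j') ∨ (k = j' ∧ l = i')) := fun h => hw (by tauto)
      simp only [rhsTerm, h₀' _ _ _ _ n hw', h₁' _ _ _ _ n hw', map_zero, mul_zero]
      exact hz

/-- The $R$-matrices stay as they are and the two $L^-$ modes give $p^{a-n}p^{b+n}=p^{a+b}$. In the
constant of `u`, each $L^-$ contributes $-2(1-\frac1N)$, and reordering contributes
$2\delta_{ij}-2\delta_{kl}$. -/
lemma rllMod_minus_minus (hħ : ħ ≠ 0) (hI : IsRelIdeal ħ N I) (i j k l : Fin N) (a b : ℤ) :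
    RLLMod I (RPh ħ N .minus) (RStarP ħ N .minus) (LminusP ħ) (LminusP ħ) i j k l a b := by
  have hR : ∀ r, PowRel 0 (qScal ħ 0 0 * pScal ħ N r) (pScal ħ N r) := fun r => by
    rw [qScal_zero, one_mul]
    exact PowRel.refl _
  refine (rllMod_minus hħ hI i j k l a b).of_powRel_of_weightZero hI
    (weightZero_RPh _) (weightZero_RStarP _) (weightZero_RPh _) (weightZero_RStarP _) (a + b)
    (qScal ħ (-(4 * (1 - 1 / (N : ℂ))) + 2 * (if i = j then 1 else 0) - 2 * (if k = l then 1 else 0))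
      ((2 : ℂ) • Ph i + (2 : ℂ) • Ph j - (2 : ℂ) • Pd k - (2 : ℂ) • Pd l - (a + b : ℂ) • cc N))
    (fun i' j' n hw => powRel_lhs (hR _) (powRel_LminusP _ _ _) (powRel_LminusP _ _ _)
      (by ring) ?_ ?_)
    (fun i' j' n hw => powRel_rhs (hR _) (powRel_LminusP _ _ _) (powRel_LminusP _ _ _)
      (by ring) ?_ ?_)
  · have e : (if j' = i' then (1 : ℂ) else 0) = if i = j then 1 else 0 := by
      rcases hw with ⟨rfl, rfl⟩ | ⟨rfl, rfl⟩ <;> simp only [eq_comm]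
    simp [epsBar_apply, e, eq_comm (a := l), -mul_ite]
    ring
  · push_cast
    rcases hw with ⟨rfl, rfl⟩ | ⟨rfl, rfl⟩ <;> module
  · have e : (if i' = j' then (1 : ℂ) else 0) = if k = l then 1 else 0 := by
      rcases hw with ⟨rfl, rfl⟩ | ⟨rfl, rfl⟩ <;> simp only [eq_comm]
    simp [epsBar_apply, e, -mul_ite]
    ring
  · push_cast
    rcases hw with ⟨rfl, rfl⟩ | ⟨rfl, rfl⟩ <;> module

/-- `R^+(q^c z₁/z₂) L^{+(1)}(z₁) L^{-(2)}(z₂) = L^{-(2)}(z₂) L^{+(1)}(z₁) R^{+*}(q^{-c} z₁/z₂)`. -/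
lemma rllMod_plus_minus (hħ : ħ ≠ 0) (hI : IsRelIdeal ħ N I) (i j k l : Fin N) (a b : ℤ) :
    RLLMod I ((RPh ħ N .plus).spectralShift ħ .plus) ((RStarP ħ N .plus).spectralShift ħ .minus)
      (LplusP ħ) (LminusP ħ) i j k l a b := by
  -- Going back from $R^-$ to $R^+$ gives $p^{-n}$ against $p^{b+n}$ from $L^-$. The spectral shift
  -- by $q^c$ cancels the $q^{-nc}$ of $L^-$ on the left; on the right the starred matrix brings
  -- $q^{2nc}$, which requires the shift by $q^{-c}$.
  refine (rllMod_minus hħ hI i j k l a b).of_powRel_of_weightZero hI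
    (weightZero_RPh _) (weightZero_RStarP _) ((weightZero_RPh _).spectralShift _)
    ((weightZero_RStarP _).spectralShift _) b
    (qScal ħ (-(2 * (1 - 1 / (N : ℂ))) - 2 * ((if k = l then 1 else 0) - 1 / (N : ℂ)))
      ((2 : ℂ) • Ph j - (2 : ℂ) • Pd l - (b : ℂ) • cc N))
    (fun i' j' n hw => powRel_lhs ((powRel_RPh hħ _ _ _ _ _).qScal_symm.spectralShift _)
      (powRel_LplusP _ _ _) (powRel_LminusP _ _ _) (by ring) ?_ ?_)
    (fun i' j' n hw => powRel_rhs ((powRel_RStarP hħ _ _ _ _ _).qScal_symm.spectralShift _)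
      (powRel_LplusP _ _ _) (powRel_LminusP _ _ _) (by ring) ?_ ?_)
  · have e : (if j' = i' then (1 : ℂ) else 0) = if i = j then 1 else 0 := by
      rcases hw with ⟨rfl, rfl⟩ | ⟨rfl, rfl⟩ <;> simp only [eq_comm]
    simp [epsBar_apply, e, eq_comm (a := l), -mul_ite]
    ring
  · simp only [Sgn.toInt]
    push_cast
    rcases hw with ⟨rfl, rfl⟩ | ⟨rfl, rfl⟩ <;> module
  · rcases hw with ⟨rfl, rfl⟩ | ⟨rfl, rfl⟩
    · simp [epsBar_apply]
      ring
    · simp [epsBar_apply, eq_comm (a := j')]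
      ring
  · simp only [Sgn.toInt]
    push_cast
    rcases hw with ⟨rfl, rfl⟩ | ⟨rfl, rfl⟩ <;> module

/-- `R^-(q^{-c} z₁/z₂) L^{-(1)}(z₁) L^{+(2)}(z₂) = L^{+(2)}(z₂) L^{-(1)}(z₁) R^{-*}(q^c z₁/z₂)`. -/
lemma rllMod_minus_plus (hħ : ħ ≠ 0) (hI : IsRelIdeal ħ N I) (i j k l : Fin N) (a b : ℤ) :
    RLLMod I ((RPh ħ N .minus).spectralShift ħ .minus) ((RStarP ħ N .minus).spectralShift ħ .plus)
      (LminusP ħ) (LplusP ħ) i j k l a b := by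
  -- Now $R^+$ is turned into $R^-$, giving $p^n$ against $p^{a-n}$ from $L^-$. The signs of the
  -- spectral shifts are reversed accordingly.
  refine (rllMod_plus hI i j k l a b).of_powRel_of_weightZero hI
    (weightZero_RPh _) (weightZero_RStarP _) ((weightZero_RPh _).spectralShift _)
    ((weightZero_RStarP _).spectralShift _) a
    (qScal ħ (2 * ((if i = j then 1 else 0) - 1 / (N : ℂ)) - (2 * (1 - 1 / (N : ℂ))))
      ((2 : ℂ) • Ph i - (2 : ℂ) • Pd k - (a : ℂ) • cc N))
    (fun i' j' n hw => powRel_lhs ((powRel_RPh hħ _ _ _ _ _).spectralShift _)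
      (powRel_LminusP _ _ _) (powRel_LplusP _ _ _) (by ring) ?_ ?_)
    (fun i' j' n hw => powRel_rhs ((powRel_RStarP hħ _ _ _ _ _).spectralShift _)
      (powRel_LminusP _ _ _) (powRel_LplusP _ _ _) (by ring) ?_ ?_)
  · simp
    ring
  · simp only [Sgn.toInt]
    push_cast
    rcases hw with ⟨rfl, rfl⟩ | ⟨rfl, rfl⟩ <;> module
  · rcases hw with ⟨rfl, rfl⟩ | ⟨rfl, rfl⟩
    · simp [epsBar_apply]
      ring
    · simp [epsBar_apply, eq_comm (a := j')]
  · simp only [Sgn.toInt]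
    push_cast
    rcases hw with ⟨rfl, rfl⟩ | ⟨rfl, rfl⟩ <;> module

end MixedRelations

/-! ### Descent to the quotient algebra. -/

section Eqp

variable {ħ : ℂ} {N : ℕ}

/-- Closedness of the ideal makes limits in the quotient unique, so that `tsum` there is the image
of the sum computed upstairs. -/
instance : T2Space (Eqp ħ N) := by
  have : IsClosed ((relIdeal ħ N).toAddSubgroup : Set (PAlg ħ N)) :=
    (isRelIdeal_relIdeal ħ N).isClosed
  exact inferInstanceAs (T2Space (PAlg ħ N ⧸ (relIdeal ħ N).toAddSubgroup))

lemma continuous_mk_relIdeal : Continuous (Ideal.Quotient.mk (relIdeal ħ N)) :=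
  continuous_coinduced_rng

lemma rllHolds_of_rllMod {R R' : RSeries N} {L L' : Fin N → Fin N → ℤ → PAlg ħ N}
    (h : ∀ i j k l a b, RLLMod (relIdeal ħ N) R R' L L' i j k l a b) :
    RLLHolds (scal ħ N) R R' (fun i j m => Ideal.Quotient.mk (relIdeal ħ N) (L i j m))
      (fun i j m => Ideal.Quotient.mk (relIdeal ħ N) (L' i j m)) := by
  intro i j k l a b
  obtain ⟨s, s', hs, hs', hmem⟩ := h i j k l a b
  have hl := hs.map (Ideal.Quotient.mk (relIdeal ħ N)) continuous_mk_relIdeal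
  have hr := hs'.map (Ideal.Quotient.mk (relIdeal ħ N)) continuous_mk_relIdeal
  have e := Ideal.Quotient.eq.mpr hmem
  exact ⟨hl.summable, hr.summable, hl.tsum_eq.trans (e.trans hr.tsum_eq.symm)⟩

end Eqp

end EllipticQG

end

theorem mainTheorem11 (N : ℕ) (hN : 1 ≤ N) (ħ : ℂ) (hħ : ħ.re < 0) :
    EllipticQG.RLLHolds (EllipticQG.scal ħ N)
      (EllipticQG.RPh ħ N .minus) (EllipticQG.RStarP ħ N .minus)
      (EllipticQG.Lminus ħ N) (EllipticQG.Lminus ħ N) ∧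
    EllipticQG.RLLHolds (EllipticQG.scal ħ N)
      ((EllipticQG.RPh ħ N .plus).spectralShift ħ .plus)
      ((EllipticQG.RStarP ħ N .plus).spectralShift ħ .minus)
      (EllipticQG.Lplus ħ N) (EllipticQG.Lminus ħ N) ∧
    EllipticQG.RLLHolds (EllipticQG.scal ħ N)
      ((EllipticQG.RPh ħ N .minus).spectralShift ħ .minus)
      ((EllipticQG.RStarP ħ N .minus).spectralShift ħ .plus)
      (EllipticQG.Lminus ħ N) (EllipticQG.Lplus ħ N) := by
  have hħ0 : ħ ≠ 0 := by
    rintro rfl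
    exact lt_irrefl _ hħ
  have hI := EllipticQG.isRelIdeal_relIdeal ħ N
  exact ⟨EllipticQG.rllHolds_of_rllMod (EllipticQG.rllMod_minus_minus hħ0 hI),
    EllipticQG.rllHolds_of_rllMod (EllipticQG.rllMod_plus_minus hħ0 hI),
    EllipticQG.rllHolds_of_rllMod (EllipticQG.rllMod_minus_plus hħ0 hI)⟩
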